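/- **Setting.** There are $M$ arms and a known number $K$ of clusters. Arm $m$ has a parametric family of distributions $P_m(\cdot\mid\rho)$ with positive densities, defined for $\rho$ in an open set $D\subset\mathbb R^d$. The known parameter space $\Theta\subset D$ is compact and convex with positive volume $|\Theta|$, and the unknown instance is $\theta=(\theta_1,\dots,\theta_M)\in\Theta^M$. Write $D^{(m)}_{KL}(\rho,\rho')$ for the KL divergence of $P_m(\cdot\mid\rho)$ from $P_m(\cdot\mid\rho')$. Assume for all $m$, all sample values $x$ and all $\rho\in\Theta$: (1) $\log P_m(x\mid\cdot)$ is twice differentiable and concave on $\Theta$; (2) $\mathbb E_{X\sim P_m(\cdot\mid\theta_m)}\|\nabla\log P_m(X\mid\theta_m)\|^3<\infty$; (3) $\mathcal I_m(\rho)=\mathbb E_{X\sim P_m(\cdot\mid\rho)}[\lambda_{\max}(-\nabla_\rho^2\log P_m(X\mid\rho))]$ is finite and bounded over $\rho\in\Theta$; (4) $\lambda_{\min}(-\nabla_\rho^2\log P_m(x\mid\rho))\ge\sigma^2$ for some constant $\sigma^2>0$; (5) $D^{(m)}_{KL}$ is finite and uniformly continuous on $\Theta\times\Theta$. Let $\mathcal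 C(\lambda)\in[K]^M$ be the cluster index vector of the $K$ clusters found by single-linkage clustering of $\lambda\in\Theta^M$ (ties broken in any way); $\sim$ is equality of index vectors up to a permutation of $[K]$. Put $\mathrm{Alt}(\theta)=\{\lambda\in\Theta^M:\mathcal C(\lambda)\nsim\mathcal C(\theta)\}$, $\psi(w,\theta)=\inf_{\lambda\in\mathrm{Alt}(\theta)}\sum_m w_mD^{(m)}_{KL}(\theta_m,\lambda_m)$ for $w$ in the probability simplex $\mathcal P_M$, $\mathcal S^*(\theta)=\arg\max_{w\in\mathcal P_M}\psi(w,\theta)$, $T^*(\theta)=[\sup_{w\in\mathcal P_M}\psi(w,\theta)]^{-1}$ and $$\eta(\epsilon)=\sup_{\rho\in\Theta}\max_{m}\sum_{i=1}^d\max\{D^{(m)}_{KL}(\rho,\rho-\epsilon e_i),\,D^{(m)}_{KL}(\rho,\rho+\epsilon e_i)\}.$$ **Algorithm EBC.** Let $N_m(t)$ be the number of samples of arm $m$ in the first $t$ rounds, $\hat\theta_m(t)$ the maximum likelihood estimate over $\Theta$ from these samples, $w(0)\in\mathcal P_M$ arbitrary and $\bar w(t)=\frac1t\sum_{s=1}^tw(s)$.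 Based on the past, the arm of round $t+1$ is a minimizer of $N_m(t)$ if $\min_mN_m(t)<\sqrt{t/M}$, and otherwise a minimizer of $N_m(t)/t-\bar w_m(t)$ (any arm in the first round). After round $t\ge1$, $w(t)$ is the Euclidean projection to $\mathcal P_M$ of $w(t-1)+\frac{c}{\sqrt t}g_t$, where $c>0$ is a constant, $g_t=(D^{(m)}_{KL}(\hat\theta_m(t),\lambda^*_m))_m$, and $\lambda^*$ minimizes $\sum_mw_m(t-1)D^{(m)}_{KL}(\hat\theta_m(t),\lambda_m)$ over the closure of $\mathrm{Alt}(\hat\theta(t))$. EBC stops at the first time $\tau_\delta$ at which every arm has been sampled and $t\,\psi(N(t)/t,\hat\theta(t))>\beta(\delta,t)$, where $$\beta(\delta,t)=\tfrac d2\sum_m\log(\mathcal I_m(\hat\theta_m(t))N_m(t))+\log\tfrac1\delta-d\sum_mW^\epsilon_m(t)+Md\log\frac{|\Theta|^{1/d}}{\sqrt{2\pi}}+\sum_mN_m(t)\sum_{i=1}^d\max\{D^{(m)}_{KL}(\hat\theta_m(t),\hat\theta_m(t)\pm\epsilon e_i)\}.$$ Here $W^\epsilon_m(t)$ is, for $n=N_m(t)$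 and $\rho=\hat\theta_m(t)$ held fixed, the expectation of $\log(1-2Q(\epsilon\sqrt{\lambda_{\max}(V)}))$, with $V=-\sum_{s=1}^n\nabla_\rho^2\log P_m(Y_s\mid\rho)$, $Y_1,\dots,Y_n$ i.i.d. from $P_m(\cdot\mid\rho)$, and $Q$ the standard normal tail function. **Theorem 3.** Let $w^*\in\mathcal S^*(\theta)$. For every $\epsilon>0$ such that $\rho\pm\epsilon e_i\in D$ for all $\rho\in\Theta$, $i\le d$, and $\eta(\epsilon)<\psi(w^*,\theta)$, EBC satisfies $$\limsup_{\delta\to0}\frac{\mathbb E_\theta[\tau_\delta]}{\log(1/\delta)}\le\frac1{\psi(w^*,\theta)-\eta(\epsilon)}.$$ If moreover each $D^{(m)}_{KL}$ is continuous on $\Theta\times V$ for some open $V$ with $\Theta\subset V\subset D$, then as $\epsilon\to0$ the right-hand side, read as $+\infty$ where $\eta(\epsilon)\ge\psi(w^*,\theta)$, tends to the lower-bound rate $T^*(\theta)$, and hence $\limsup_{\epsilon\to0}\limsup_{\delta\to0}\mathbb E_\theta[\tau_\delta]/\log(1/\delta)\le T^*(\theta)$ (asymptotic optimality). Here $1/0=+\infty$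 and $1/(+\infty)=0$. -/

import Mathlib

open MeasureTheory ProbabilityTheory Filter Topology
open scoped ENNReal

noncomputable section

namespace BanditClustering

/-- Parameter vectors, with the Euclidean norm. -/
abbrev Param (d : ℕ) : Type := EuclideanSpace ℝ (Fin d)

/-! ### Eigenvalues, Hessians, the Gaussian tail -/

/-- Largest eigenvalue of a (symmetric) real matrix. -/
def lamMax {d : ℕ} (A : Matrix (Fin d) (Fin d) ℝ) : ℝ := sSup (spectrum ℝ A)

/-- Smallest eigenvalue of a (symmetric) real matrix. -/
def lamMin {d : ℕ} (A : Matrix (Fin d) (Fin d) ℝ) : ℝ := sInf (spectrum ℝ A)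

/-- The `i`-th standard basis vector. -/
def basisVec {d : ℕ} (i : Fin d) : Param d := EuclideanSpace.single i (1 : ℝ)

/-- The Hessian matrix of `f` at `ρ`. -/
def hessian {d : ℕ} (f : Param d → ℝ) (ρ : Param d) : Matrix (Fin d) (Fin d) ℝ :=
  Matrix.of fun i j => fderiv ℝ (fderiv ℝ f) ρ (basisVec i) (basisVec j)

/-- `f` is twice differentiable at `ρ`. -/
def TwiceDifferentiableAt {d : ℕ} (f : Param d → ℝ) (ρ : Param d) : Prop :=
  (∀ᶠ ρ' in 𝓝 ρ, DifferentiableAt ℝ f ρ') ∧ DifferentiableAt ℝ (fderiv ℝ f) ρ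

/-- The tail function `Q(x) = ℙ[N(0,1) > x]` of the standard normal distribution. -/
def gaussQ (x : ℝ) : ℝ := (gaussianReal 0 1).real (Set.Ioi x)

/-! ### The arms -/

/-- Parametric families of distributions of `M` arms on the sample space `𝒳`: the law of arm `m`
under the parameter `ρ` has the positive density `dens m ρ` with respect to a reference measure
`base m`. The parameters range over an open set `dom`. -/
structure ArmFamily (M d : ℕ) (𝒳 : Type*) [MeasurableSpace 𝒳] where
  dom : Set (Param d)
  isOpen_dom : IsOpen dom
  base : Fin M → Measure 𝒳
  sigmaFinite_base : ∀ m, SigmaFinite (base m)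
  dens : Fin M → Param d → 𝒳 → ℝ
  measurable_dens : ∀ m, ∀ ρ ∈ dom, Measurable (dens m ρ)
  dens_pos : ∀ m, ∀ ρ ∈ dom, ∀ x, 0 < dens m ρ x
  lintegral_dens : ∀ m, ∀ ρ ∈ dom, ∫⁻ x, ENNReal.ofReal (dens m ρ x) ∂(base m) = 1

variable {M d K : ℕ} {𝒳 : Type*} [MeasurableSpace 𝒳]

/-- The distribution `P_m(· ∣ ρ)`. -/
def ArmFamily.law (F : ArmFamily M d 𝒳) (m : Fin M) (ρ : Param d) : Measure 𝒳 :=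
  (F.base m).withDensity fun x => ENNReal.ofReal (F.dens m ρ x)

/-- The log-likelihood `log P_m(x ∣ ρ)`, as a function of the parameter. -/
def ArmFamily.logLik (F : ArmFamily M d 𝒳) (m : Fin M) (x : 𝒳) (ρ : Param d) : ℝ :=
  Real.log (F.dens m ρ x)

/-- The KL divergence `D_KL^{(m)}(ρ₁, ρ₂)`. -/
def ArmFamily.kl (F : ArmFamily M d 𝒳) (m : Fin M) (ρ₁ ρ₂ : Param d) : ℝ≥0∞ :=
  InformationTheory.klDiv (F.law m ρ₁) (F.law m ρ₂)

/-- The Fisher information `𝓘_m(ρ) = 𝔼_{X ∼ P_m(· ∣ ρ)}[λ_max(-∇² log P_m(X ∣ ρ))]`. -/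
def ArmFamily.fisher (F : ArmFamily M d 𝒳) (m : Fin M) (ρ : Param d) : ℝ :=
  ∫ x, lamMax (-hessian (F.logLik m x) ρ) ∂(F.law m ρ)

/-- The standing assumptions on the compact parameter space `Θ`, the families of distributions
and the problem instance `θ`. (`ConcaveOn` contains the convexity of `Θ`.) -/
structure ArmFamily.Regular (F : ArmFamily M d 𝒳) (Θ : Set (Param d)) (θ : Fin M → Param d) :
    Prop where
  isCompact : IsCompact Θ
  volume_pos : 0 < volume Θ
  subset_dom : Θ ⊆ F.dom
  instance_mem : ∀ m, θ m ∈ Θ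
  twiceDiff : ∀ m x, ∀ ρ ∈ Θ, TwiceDifferentiableAt (F.logLik m x) ρ
  concave : ∀ m x, ConcaveOn ℝ Θ (F.logLik m x)
  score_moment : ∀ m,
    Integrable (fun x => ‖gradient (F.logLik m x) (θ m)‖ ^ 3) (F.law m (θ m))
  fisher_integrable : ∀ m, ∀ ρ ∈ Θ,
    Integrable (fun x => lamMax (-hessian (F.logLik m x) ρ)) (F.law m ρ)
  fisher_bounded : ∃ C : ℝ, ∀ m, ∀ ρ ∈ Θ, F.fisher m ρ ≤ C
  strongly_concave : ∃ σ : ℝ, 0 < σ ∧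
    ∀ m x, ∀ ρ ∈ Θ, σ ^ 2 ≤ lamMin (-hessian (F.logLik m x) ρ)
  kl_ne_top : ∀ m, ∀ ρ₁ ∈ Θ, ∀ ρ₂ ∈ Θ, F.kl m ρ₁ ρ₂ ≠ ∞
  kl_uniformContinuous : ∀ m,
    UniformContinuousOn (fun q : Param d × Param d => (F.kl m q.1 q.2).toReal) (Θ ×ˢ Θ)

/-! ### Single linkage clustering -/

/-- Single-linkage distance of two groups of arms: the least distance between their members. -/
def linkDist (lam : Fin M → Param d) (A B : Finset (Fin M)) : ℝ :=
  sInf {r | ∃ a ∈ A, ∃ b ∈ B, r = dist (lam a) (lam b)}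

/-- The collections of clusters that single-linkage clustering can pass through: start from the
singletons and repeatedly merge two closest clusters (ties are broken arbitrarily). -/
inductive SlinkStage (lam : Fin M → Param d) : Finset (Finset (Fin M)) → Prop
  | init : SlinkStage lam (Finset.univ.image fun m => {m})
  | merge {P : Finset (Finset (Fin M))} {A B : Finset (Fin M)} (hP : SlinkStage lam P)
      (hA : A ∈ P) (hB : B ∈ P) (hAB : A ≠ B)
      (hmin : ∀ A' ∈ P, ∀ B' ∈ P, A' ≠ B' → linkDist lam A B ≤ linkDist lam A' B') :
      SlinkStage lam (insert (A ∪ B) ((P.erase A).erase B))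

/-- `c` is a cluster index vector of the `K` clusters that single-linkage clustering forms from
the points `lam 1, …, lam M`. -/
def IsSlinkOutput (lam : Fin M → Param d) (c : Fin M → Fin K) : Prop :=
  ∃ P, SlinkStage lam P ∧ P.card = K ∧ ∀ i j, c i = c j ↔ ∃ A ∈ P, i ∈ A ∧ j ∈ A

/-- Equivalence of cluster index vectors: equality up to a permutation of the indices. -/
def ClusterEquiv (c₁ c₂ : Fin M → Fin K) : Prop := ∃ σ : Equiv.Perm (Fin K), c₁ = σ ∘ c₂

/-- `𝒞` maps every instance in `Θ^M` to a cluster index vector found by single-linkage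
clustering with `K` clusters. -/
def IsSlink (Θ : Set (Param d)) (𝒞 : (Fin M → Param d) → Fin M → Fin K) : Prop :=
  ∀ lam : Fin M → Param d, (∀ m, lam m ∈ Θ) → IsSlinkOutput lam (𝒞 lam)

/-- The alternative space `Alt(θ)`. -/
def altSet (Θ : Set (Param d)) (𝒞 : (Fin M → Param d) → Fin M → Fin K)
    (θ : Fin M → Param d) : Set (Fin M → Param d) :=
  {lam | (∀ m, lam m ∈ Θ) ∧ ¬ ClusterEquiv (𝒞 θ) (𝒞 lam)}

/-! ### The lower-bound problem -/

/-- `∑_m w_m D_KL^{(m)}(θ_m, λ_m)`. -/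
def ArmFamily.weightedKL (F : ArmFamily M d 𝒳) (w : Fin M → ℝ) (θ lam : Fin M → Param d) : ℝ≥0∞ :=
  ∑ m, ENNReal.ofReal (w m) * F.kl m (θ m) (lam m)

/-- `ψ(w, θ) = inf_{λ ∈ Alt(θ)} ∑_m w_m D_KL^{(m)}(θ_m, λ_m)`. -/
def ArmFamily.psi (F : ArmFamily M d 𝒳) (Θ : Set (Param d))
    (𝒞 : (Fin M → Param d) → Fin M → Fin K) (w : Fin M → ℝ) (θ : Fin M → Param d) : ℝ≥0∞ :=
  ⨅ lam ∈ altSet Θ 𝒞 θ, F.weightedKL w θ lam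

/-- `𝓢*(θ)`, the set of maximizers of `ψ(·, θ)` over the probability simplex. -/
def ArmFamily.optimalWeights (F : ArmFamily M d 𝒳) (Θ : Set (Param d))
    (𝒞 : (Fin M → Param d) → Fin M → Fin K) (θ : Fin M → Param d) : Set (Fin M → ℝ) :=
  {w | w ∈ stdSimplex ℝ (Fin M) ∧
    ∀ v ∈ stdSimplex ℝ (Fin M), F.psi Θ 𝒞 v θ ≤ F.psi Θ 𝒞 w θ}

/-- `T*(θ) = [sup_w ψ(w, θ)]⁻¹`. -/
def ArmFamily.charTime (F : ArmFamily M d 𝒳) (Θ : Set (Param d))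
    (𝒞 : (Fin M → Param d) → Fin M → Fin K) (θ : Fin M → Param d) : ℝ≥0∞ :=
  (⨆ w ∈ stdSimplex ℝ (Fin M), F.psi Θ 𝒞 w θ)⁻¹

/-- `∑_i max{D_KL^{(m)}(ρ, ρ - ε e_i), D_KL^{(m)}(ρ, ρ + ε e_i)}`. -/
def ArmFamily.klPerturb (F : ArmFamily M d 𝒳) (ε : ℝ) (m : Fin M) (ρ : Param d) : ℝ≥0∞ :=
  ∑ i : Fin d, max (F.kl m ρ (ρ - ε • basisVec i)) (F.kl m ρ (ρ + ε • basisVec i))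

/-- `η(ε)`, the largest KL divergence to coordinate perturbations of size `ε`. -/
def ArmFamily.eta (F : ArmFamily M d 𝒳) (Θ : Set (Param d)) (ε : ℝ) : ℝ≥0∞ :=
  ⨆ ρ ∈ Θ, ⨆ m, F.klPerturb ε m ρ

/-- All coordinate perturbations of size `ε` of points of `Θ` are parameters of the family. -/
def ArmFamily.Admissible (F : ArmFamily M d 𝒳) (Θ : Set (Param d)) (ε : ℝ) : Prop :=
  0 < ε ∧ ∀ ρ ∈ Θ, ∀ i : Fin d, ρ - ε • basisVec i ∈ F.dom ∧ ρ + ε • basisVec i ∈ F.dom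

/-! ### Sampling -/

variable {Ω : Type*} {mΩ : MeasurableSpace Ω}

/-- The data sequences under the instance `θ`: `X m s` is the sample that arm `m` offers in round
`s + 1`. It has law `P_m(· ∣ θ_m)`, is independent of everything known after `s` rounds
(the σ-algebra `𝓕 s`), and is known after round `s + 1`. In particular every sequence
`X m 0, X m 1, …` is i.i.d. -/
structure IsSampling (F : ArmFamily M d 𝒳) (θ : Fin M → Param d) (μ : Measure Ω)
    (𝓕 : Filtration ℕ mΩ) (X : Fin M → ℕ → Ω → 𝒳) : Prop where
  measurable : ∀ m s, Measurable[𝓕 (s + 1)] (X m s)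
  law : ∀ m s, μ.map (X m s) = F.law m (θ m)
  indep : ∀ m s, Indep (MeasurableSpace.comap (X m s) inferInstance) (𝓕 s) μ

/-! ### The algorithm EBC -/

/-- The quantities that EBC computes. `arm t` is the arm `A_{t+1}` selected after `t` rounds;
`est t`, `near t`, `weight t` are `θ̂(t)`, `λ*` and `w(t)` at time `t`. -/
structure EBCProcess (M d : ℕ) (Ω : Type*) where
  arm : ℕ → Ω → Fin M
  est : ℕ → Ω → Fin M → Param d
  near : ℕ → Ω → Fin M → Param d
  weight : ℕ → Ω → Fin M → ℝ

/-- `N_m(t)`, the number of samples of arm `m` in the first `t` rounds. -/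
def EBCProcess.pulls (R : EBCProcess M d Ω) (t : ℕ) (ω : Ω) (m : Fin M) : ℕ :=
  ((Finset.range t).filter fun s => R.arm s ω = m).card

/-- The averaged weights `w̄(t) = (1/t) ∑_{s=1}^t w(s)`. -/
def EBCProcess.avgWeight (R : EBCProcess M d Ω) (t : ℕ) (ω : Ω) (m : Fin M) : ℝ :=
  (∑ s ∈ Finset.Icc 1 t, R.weight s ω m) / t

/-- The log-likelihood of `ρ` given the samples of arm `m` observed in the first `t` rounds. -/
def EBCProcess.armLogLik (R : EBCProcess M d Ω) (F : ArmFamily M d 𝒳) (X : Fin M → ℕ → Ω → 𝒳)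
    (t : ℕ) (ω : Ω) (m : Fin M) (ρ : Param d) : ℝ :=
  ∑ s ∈ (Finset.range t).filter fun s => R.arm s ω = m, F.logLik m (X m s ω) ρ

/-- `w` is the Euclidean projection of `v` to the probability simplex. -/
def IsSimplexProj (v w : Fin M → ℝ) : Prop :=
  w ∈ stdSimplex ℝ (Fin M) ∧
    ∀ u ∈ stdSimplex ℝ (Fin M), ∑ m, (w m - v m) ^ 2 ≤ ∑ m, (u m - v m) ^ 2

/-- `R` follows the sampling rule of EBC on the data `X`, with gradient step sizes `c / √t`.
Ties, and the choice of the starting weights, are arbitrary. -/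
structure IsEBC (F : ArmFamily M d 𝒳) (Θ : Set (Param d))
    (𝒞 : (Fin M → Param d) → Fin M → Fin K) (𝓕 : Filtration ℕ mΩ) (X : Fin M → ℕ → Ω → 𝒳)
    (c : ℝ) (R : EBCProcess M d Ω) : Prop where
  /-- The arm of round `t + 1` is chosen on the basis of the first `t` rounds. -/
  arm_measurable : ∀ t, Measurable[𝓕 t] (R.arm t)
  /-- The estimates are maximum likelihood estimates over `Θ`. -/
  est_mem : ∀ t ω m, R.est t ω m ∈ Θ
  est_max : ∀ t ω m, ∀ ρ ∈ Θ, R.armLogLik F X t ω m ρ ≤ R.armLogLik F X t ω m (R.est t ω m)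
  /-- The starting weights. -/
  weight_zero : ∀ ω, R.weight 0 ω ∈ stdSimplex ℝ (Fin M)
  /-- A closest alternative to the estimate, for the weights of the previous round. -/
  near_spec : ∀ t ω, (altSet Θ 𝒞 (R.est (t + 1) ω)).Nonempty →
    R.near (t + 1) ω ∈ closure (altSet Θ 𝒞 (R.est (t + 1) ω)) ∧
    F.weightedKL (R.weight t ω) (R.est (t + 1) ω) (R.near (t + 1) ω) =
      F.psi Θ 𝒞 (R.weight t ω) (R.est (t + 1) ω)
  /-- One projected gradient step. -/
  weight_succ : ∀ t ω, IsSimplexProj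
    (fun m => R.weight t ω m + c / √((t : ℝ) + 1) *
      (F.kl m (R.est (t + 1) ω m) (R.near (t + 1) ω m)).toReal)
    (R.weight (t + 1) ω)
  /-- Forced exploration. -/
  arm_forced : ∀ t ω, (∃ m, (R.pulls t ω m : ℝ) < √((t : ℝ) / M)) →
    ∀ m, R.pulls t ω (R.arm t ω) ≤ R.pulls t ω m
  /-- Tracking of the averaged weights. -/
  arm_track : ∀ t ω, (¬ ∃ m, (R.pulls t ω m : ℝ) < √((t : ℝ) / M)) →
    ∀ m, (R.pulls t ω (R.arm t ω) : ℝ) / t - R.avgWeight t ω (R.arm t ω) ≤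
      (R.pulls t ω m : ℝ) / t - R.avgWeight t ω m

/-- The test statistic `Z(t) = t ψ(N(t)/t, θ̂(t))`. -/
def EBCProcess.statZ (R : EBCProcess M d Ω) (F : ArmFamily M d 𝒳) (Θ : Set (Param d))
    (𝒞 : (Fin M → Param d) → Fin M → Fin K) (t : ℕ) (ω : Ω) : ℝ≥0∞ :=
  (t : ℝ≥0∞) * F.psi Θ 𝒞 (fun m => (R.pulls t ω m : ℝ) / t) (R.est t ω)

/-- `W_m^ε`, for `n` samples and the estimate `ρ`: the expectation of
`log(1 - 2 Q(ε √λ_max(V)))`, where `V = -∑_s ∇² log P_m(X_s ∣ ρ)` and `X_1, …, X_n` are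
independent with law `P_m(· ∣ ρ)`. -/
def ArmFamily.logCube (F : ArmFamily M d 𝒳) (ε : ℝ) (m : Fin M) (n : ℕ) (ρ : Param d) : ℝ :=
  ∫ x : Fin n → 𝒳,
    Real.log (1 - 2 * gaussQ (ε * √(lamMax (-∑ s, hessian (F.logLik m (x s)) ρ))))
    ∂(Measure.pi fun _ => F.law m ρ)

/-- The threshold `β(δ, t)`. -/
def EBCProcess.threshold (R : EBCProcess M d Ω) (F : ArmFamily M d 𝒳) (Θ : Set (Param d))
    (ε δ : ℝ) (t : ℕ) (ω : Ω) : EReal :=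
  (((d : ℝ) / 2 * ∑ m, Real.log (F.fisher m (R.est t ω m) * R.pulls t ω m)
      + Real.log (1 / δ)
      - d * ∑ m, F.logCube ε m (R.pulls t ω m) (R.est t ω m)
      + M * d * Real.log ((volume Θ).toReal ^ (1 / (d : ℝ)) / √(2 * Real.pi)) : ℝ) : EReal)
    + ((∑ m, (R.pulls t ω m : ℝ≥0∞) * F.klPerturb ε m (R.est t ω m) : ℝ≥0∞) : EReal)

/-- The stopping time `τ_δ`: the first time at which every arm has been sampled and the test
statistic exceeds the threshold (`⊤` if there is none). -/
def EBCProcess.stopTime (R : EBCProcess M d Ω) (F : ArmFamily M d 𝒳) (Θ : Set (Param d))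
    (𝒞 : (Fin M → Param d) → Fin M → Fin K) (ε δ : ℝ) (ω : Ω) : ℕ∞ :=
  ⨅ (t : ℕ) (_ : (∀ m, 1 ≤ R.pulls t ω m) ∧
    R.threshold F Θ ε δ t ω < (R.statZ F Θ 𝒞 t ω : EReal)), (t : ℕ∞)

/-- `limsup_{δ → 0} 𝔼[τ_δ] / log(1/δ)`. -/
def EBCProcess.slope (R : EBCProcess M d Ω) (F : ArmFamily M d 𝒳) (Θ : Set (Param d))
    (𝒞 : (Fin M → Param d) → Fin M → Fin K) (μ : Measure Ω) (ε : ℝ) : ℝ≥0∞ :=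
  limsup (fun δ : ℝ =>
    (∫⁻ ω, (R.stopTime F Θ 𝒞 ε δ ω : ℝ≥0∞) ∂μ) / ENNReal.ofReal (Real.log (1 / δ))) (𝓝[>] 0)

end BanditClustering

end

/-! EBC stops once the statistic `Z(t) = t ψ(N(t)/t, θ̂(t))` exceeds the threshold. The threshold is
at most `log(1/δ) + η(ε) t + O(√t)` on every sample path (`exists_threshold_le`). Once the estimates
are close to `θ`, the statistic is at least `t ψ(w, θ)` up to a small multiple of `t`, an `O(√t)`
term and a multiple of the time lost before (`IsEBC.le_statZ`). Hence `τ_δ` is at most `log(1/δ) /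
(ψ - η - 4κ)` plus a constant plus a multiple of the accuracy time, and only the first term survives
division by `log(1/δ)`, provided the accuracy time has a finite mean. Then `κ → 0`.

Growth of the statistic. As an infimum of linear functions, `ψ(·, θ̂)` is concave, and the
divergences to the closest alternative form a supergradient. Projected gradient ascent therefore has
regret `O(√t)` (`projected_gradient_regret`), and tracking keeps `N_m(t)` within `O(√t)` of the
summed weights. Near `θ` the alternatives do not change: `ψ(w, θ) > 0` and the uniform continuity of
the divergence keep them away from `θ`.

Accuracy time. Strong concavity bounds the error of a maximum likelihood estimate by the average
centered score (`norm_est_sub_le`). As `θ_m` may lie on the boundary of `Θ`, the mean score need not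
vanish, but it has a nonpositive product with every direction into `Θ`. Forced exploration yields
`n` samples of each arm within about `M n²` rounds, so a deviation in the block `2^l ≤ k < 2^(l+1)`
costs a time of order `4^l`. Truncation and Chernoff's bound give these deviations probabilities
that are summable against `4^l`, which is exactly what a third moment affords
(`tsum_four_pow_mul_measure_lt_top`). Adaptive selection is harmless because each sample is
independent of the past that selects it.

For the limit `ε → 0`, the divergence vanishes on the diagonal and is continuous, so `η(ε) → 0` by
compactness of `Θ`. -/

noncomputable section

namespace BanditClustering

/-! ### Deterministic properties of the sampling rule: exploration, tracking, regret -/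

section

variable {M d K : ℕ} {𝒳 : Type*} [MeasurableSpace 𝒳] {Ω : Type*} {mΩ : MeasurableSpace Ω}

/-! ### Numbers of samples -/

section Pulls

variable (R : EBCProcess M d Ω)

lemma EBCProcess.pulls_zero (ω : Ω) (m : Fin M) : R.pulls 0 ω m = 0 := by
  simp [EBCProcess.pulls]

lemma EBCProcess.pulls_succ (t : ℕ) (ω : Ω) (m : Fin M) :
    R.pulls (t + 1) ω m = R.pulls t ω m + if R.arm t ω = m then 1 else 0 := by
  unfold EBCProcess.pulls
  rw [Finset.range_add_one, Finset.filter_insert]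
  split_ifs with h
  · rw [Finset.card_insert_of_notMem (by simp)]
  · simp

lemma EBCProcess.pulls_mono (ω : Ω) (m : Fin M) : Monotone fun t => R.pulls t ω m :=
  monotone_nat_of_le_succ fun t => by rw [R.pulls_succ]; omega

lemma EBCProcess.sum_pulls (t : ℕ) (ω : Ω) : ∑ m, R.pulls t ω m = t := by
  induction t with
  | zero => simp [R.pulls_zero]
  | succ t ih => simp [R.pulls_succ, Finset.sum_add_distrib, ih]

lemma EBCProcess.pulls_le (t : ℕ) (ω : Ω) (m : Fin M) : R.pulls t ω m ≤ t := by
  calc R.pulls t ω m ≤ ∑ m, R.pulls t ω m :=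
        Finset.single_le_sum (f := fun m => R.pulls t ω m) (fun _ _ => Nat.zero_le _)
          (Finset.mem_univ m)
    _ = t := R.sum_pulls t ω

end Pulls

variable {F : ArmFamily M d 𝒳} {Θ : Set (Param d)} {𝒞 : (Fin M → Param d) → Fin M → Fin K}
  {𝓕 : Filtration ℕ mΩ} {X : Fin M → ℕ → Ω → 𝒳} {c : ℝ} {R : EBCProcess M d Ω}

/-- Forced exploration: after `M n ^ 2 + 1` rounds every arm has been sampled `n` times. -/
lemma IsEBC.le_pulls (hR : IsEBC F Θ 𝒞 𝓕 X c R) (ω : Ω) (n : ℕ) :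
    ∀ t, M * n ^ 2 + 1 ≤ t → ∀ m, n ≤ R.pulls t ω m := by
  induction n with
  | zero => intros; exact Nat.zero_le _
  | succ n ih =>
    intro t ht m
    have hM : 0 < M := Fin.pos m
    -- After `M n² + 1` rounds all arms have at least `n` samples, and exploration stays forced
    -- while some arm has exactly `n`. Each such round removes one arm from the set of laggards, so
    -- `M` further rounds suffice, and `M n² + 1 + M ≤ M (n + 1)² + 1`.
    have key : ∀ j, (Finset.univ.filter fun m => R.pulls (M * n ^ 2 + 1 + j) ω m ≤ n).card
        ≤ M - j := by
      intro j
      induction j with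
      | zero => exact (Finset.card_filter_le _ _).trans (by simp)
      | succ j ihj =>
        set s := M * n ^ 2 + 1 + j with hs
        have hsub : (Finset.univ.filter fun m => R.pulls (s + 1) ω m ≤ n) ⊆
            Finset.univ.filter fun m => R.pulls s ω m ≤ n := by
          intro m hm
          simp only [Finset.mem_filter, Finset.mem_univ, true_and] at hm ⊢
          exact (R.pulls_mono ω m (Nat.le_succ s)).trans hm
        rw [show M * n ^ 2 + 1 + (j + 1) = s + 1 by omega]
        by_cases hex : ∃ m, R.pulls s ω m ≤ n
        · obtain ⟨m₀, hm₀⟩ := hex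
          have hlt : (n : ℝ) < √((s : ℝ) / M) := by
            apply Real.lt_sqrt_of_sq_lt
            rw [lt_div_iff₀ (by exact_mod_cast hM)]
            have : n ^ 2 * M < s := by rw [hs]; nlinarith
            exact_mod_cast this
          have hf := hR.arm_forced s ω
            ⟨m₀, lt_of_le_of_lt (by exact_mod_cast hm₀) hlt⟩ m₀
          have hge := ih s (by omega) (R.arm s ω)
          have hss : (Finset.univ.filter fun m => R.pulls (s + 1) ω m ≤ n) ⊂
              Finset.univ.filter fun m => R.pulls s ω m ≤ n := by
            refine (Finset.ssubset_iff_of_subset hsub).2 ⟨R.arm s ω, ?_, ?_⟩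
            · simp only [Finset.mem_filter, Finset.mem_univ, true_and]; omega
            · simp only [Finset.mem_filter, Finset.mem_univ, true_and, R.pulls_succ, if_true]
              omega
          have := Finset.card_lt_card hss
          omega
        · have : (Finset.univ.filter fun m => R.pulls s ω m ≤ n) = ∅ := by
            rw [Finset.filter_eq_empty_iff]
            intro m _ hm
            exact hex ⟨m, hm⟩
          rw [this] at hsub
          rw [Finset.subset_empty.1 hsub]
          simp
    have h0 := key M
    rw [Nat.sub_self, Nat.le_zero, Finset.card_eq_zero, Finset.filter_eq_empty_iff] at h0
    have h1 := h0 (Finset.mem_univ m)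
    have h2 : M * n ^ 2 + 1 + M ≤ t := by nlinarith
    have := R.pulls_mono ω m h2
    simp only at this
    omega

lemma IsEBC.weight_mem (hR : IsEBC F Θ 𝒞 𝓕 X c R) (t : ℕ) (ω : Ω) :
    R.weight t ω ∈ stdSimplex ℝ (Fin M) := by
  cases t with
  | zero => exact hR.weight_zero ω
  | succ t => exact (hR.weight_succ t ω).1

/-- Tracking never samples an arm much more often than the weights demand. -/
lemma IsEBC.pulls_le_sum_weight (hR : IsEBC F Θ 𝒞 𝓕 X c R) (ω : Ω) (m : Fin M) (t : ℕ) :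
    (R.pulls t ω m : ℝ) ≤ ∑ s ∈ Finset.Icc 1 t, R.weight s ω m + √t + 1 := by
  have hw : ∀ s m, 0 ≤ R.weight s ω m := fun s m => (hR.weight_mem s ω).1 m
  have hM : (1 : ℝ) ≤ M := by exact_mod_cast (Fin.pos m)
  induction t with
  | zero => simp [R.pulls_zero]
  | succ t ih =>
    have hsq : √(t : ℝ) ≤ √((t + 1 : ℕ) : ℝ) := Real.sqrt_le_sqrt (by push_cast; linarith)
    have hsum : ∑ s ∈ Finset.Icc 1 (t + 1), R.weight s ω m =
        ∑ s ∈ Finset.Icc 1 t, R.weight s ω m + R.weight (t + 1) ω m :=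
      Finset.sum_Icc_succ_top (by omega) _
    have hw1 := hw (t + 1) m
    have hS : 0 ≤ ∑ s ∈ Finset.Icc 1 t, R.weight s ω m := Finset.sum_nonneg fun s _ => hw s m
    rw [R.pulls_succ]
    split_ifs with h
    · push_cast at hsq ⊢
      -- A forced arm has fewer than `√(t / M) ≤ √t` samples. A tracked arm has the least excess of
      -- samples over weights.
      by_cases hf : ∃ m, (R.pulls t ω m : ℝ) < √((t : ℝ) / M)
      · have h1 := hR.arm_forced t ω hf
        obtain ⟨m', hm'⟩ := hf
        have h2 : (R.pulls t ω m : ℝ) ≤ R.pulls t ω m' := by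
          have := h1 m'
          rw [h] at this
          exact_mod_cast this
        have h3 : √((t : ℝ) / M) ≤ √(t : ℝ) :=
          Real.sqrt_le_sqrt (div_le_self (by positivity) hM)
        rw [hsum]
        linarith
      · have h1 := hR.arm_track t ω hf
        rw [h] at h1
        rcases Nat.eq_zero_or_pos t with rfl | ht
        · rw [R.pulls_zero, hsum]
          have := Real.sqrt_nonneg ((0 : ℕ) + 1 : ℝ)
          push_cast at this ⊢
          linarith
        · have htp : (0 : ℝ) < t := by exact_mod_cast ht
          have h2 : ∀ m', (R.pulls t ω m : ℝ) - ∑ s ∈ Finset.Icc 1 t, R.weight s ω m ≤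
              R.pulls t ω m' - ∑ s ∈ Finset.Icc 1 t, R.weight s ω m' := by
            intro m'
            have := h1 m'
            unfold EBCProcess.avgWeight at this
            rw [← sub_div, ← sub_div] at this
            exact (div_le_div_iff_of_pos_right htp).1 this
          have h3 : ∑ _m' : Fin M, ((R.pulls t ω m : ℝ) - ∑ s ∈ Finset.Icc 1 t, R.weight s ω m) ≤
              ∑ m', ((R.pulls t ω m' : ℝ) - ∑ s ∈ Finset.Icc 1 t, R.weight s ω m') :=
            Finset.sum_le_sum fun m' _ => h2 m'
          -- Samples and weights both total `t`: the excesses sum to zero, so the least one is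
          -- nonpositive.
          have h4 : ∑ m', ((R.pulls t ω m' : ℝ) - ∑ s ∈ Finset.Icc 1 t, R.weight s ω m') = 0 := by
            rw [Finset.sum_sub_distrib, Finset.sum_comm]
            rw [Finset.sum_congr rfl fun s _ => (hR.weight_mem s ω).2]
            have := R.sum_pulls t ω
            rw [← Nat.cast_sum, this]
            simp
          rw [h4, Finset.sum_const, Finset.card_univ, Fintype.card_fin, nsmul_eq_mul] at h3
          have h5 : (R.pulls t ω m : ℝ) - ∑ s ∈ Finset.Icc 1 t, R.weight s ω m ≤ 0 := by
            by_contra hcon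
            push Not at hcon
            nlinarith
          have := Real.sqrt_nonneg ((t : ℝ) + 1)
          rw [hsum]
          linarith
    · rw [hsum]
      push_cast at hsq ⊢
      linarith

/-- Tracking samples every arm nearly as often as the weights demand. -/
lemma IsEBC.sum_weight_le_pulls (hR : IsEBC F Θ 𝒞 𝓕 X c R) (ω : Ω) (m : Fin M) (t : ℕ) :
    ∑ s ∈ Finset.Icc 1 t, R.weight s ω m ≤ R.pulls t ω m + M * (√t + 1) := by
  -- The excesses sum to zero, so the deficit of one arm is the total excess of the others, each at
  -- most `√t + 1`.
  have h4 : ∑ m', ((R.pulls t ω m' : ℝ) - ∑ s ∈ Finset.Icc 1 t, R.weight s ω m') = 0 := by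
    rw [Finset.sum_sub_distrib, Finset.sum_comm]
    rw [Finset.sum_congr rfl fun s _ => (hR.weight_mem s ω).2]
    rw [← Nat.cast_sum, R.sum_pulls t ω]
    simp
  rw [← Finset.add_sum_erase _ _ (Finset.mem_univ m)] at h4
  have h5 : ∑ m' ∈ Finset.univ.erase m,
      ((R.pulls t ω m' : ℝ) - ∑ s ∈ Finset.Icc 1 t, R.weight s ω m') ≤
      ∑ m' ∈ Finset.univ.erase m, (√t + 1) :=
    Finset.sum_le_sum fun m' _ => by linarith [hR.pulls_le_sum_weight ω m' t]
  have h6 : ∑ m' ∈ Finset.univ.erase m, (√(t : ℝ) + 1) ≤ M * (√t + 1) := by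
    have := Finset.sum_le_sum_of_subset_of_nonneg (Finset.erase_subset m Finset.univ)
      (f := fun _ => √(t : ℝ) + 1) (fun _ _ _ => by positivity)
    rwa [Finset.sum_const (s := Finset.univ), Finset.card_univ, Fintype.card_fin, nsmul_eq_mul] at this
  linarith

/-! ### Projected gradient steps -/

/-- Minimality along the segment from `w` to `u` gives `⟨w - v, u - w⟩ ≥ 0`: the angle at the
projection is obtuse, so projecting brings `v` no farther from any point of the simplex. -/
lemma IsSimplexProj.sum_sq_le {v w u : Fin M → ℝ} (h : IsSimplexProj v w)
    (hu : u ∈ stdSimplex ℝ (Fin M)) : ∑ m, (w m - u m) ^ 2 ≤ ∑ m, (v m - u m) ^ 2 := by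
  have key : ∀ s : ℝ, 0 < s → s ≤ 1 →
      0 ≤ 2 * ∑ m, (w m - v m) * (u m - w m) + s * ∑ m, (u m - w m) ^ 2 := by
    intro s hs hs1
    have hmem : (1 - s) • w + s • u ∈ stdSimplex ℝ (Fin M) :=
      convex_stdSimplex ℝ (Fin M) h.1 hu (by linarith) hs.le (by ring)
    have h1 := h.2 _ hmem
    have h2 : ∑ m, (((1 - s) • w + s • u) m - v m) ^ 2 = ∑ m, (w m - v m) ^ 2 +
        s * (2 * ∑ m, (w m - v m) * (u m - w m) + s * ∑ m, (u m - w m) ^ 2) := by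
      simp only [Finset.mul_sum, ← Finset.sum_add_distrib]
      refine Finset.sum_congr rfl fun m _ => ?_
      simp only [Pi.add_apply, Pi.smul_apply, smul_eq_mul]
      ring
    rw [h2] at h1
    have : 0 ≤ s * (2 * ∑ m, (w m - v m) * (u m - w m) + s * ∑ m, (u m - w m) ^ 2) := by
      linarith
    exact nonneg_of_mul_nonneg_right this hs
  have h0 : 0 ≤ 2 * ∑ m, (w m - v m) * (u m - w m) := by
    have ht : Tendsto (fun s : ℝ => 2 * ∑ m, (w m - v m) * (u m - w m) +
        s * ∑ m, (u m - w m) ^ 2) (𝓝[>] 0)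
        (𝓝 (2 * ∑ m, (w m - v m) * (u m - w m) + 0 * ∑ m, (u m - w m) ^ 2)) :=
      ((continuous_const.add (continuous_id.mul continuous_const)).tendsto 0).mono_left
        nhdsWithin_le_nhds
    have := ge_of_tendsto ht (b := 0) (by
      filter_upwards [Ioc_mem_nhdsGT (zero_lt_one' ℝ)] with s hs
      exact key s hs.1 hs.2)
    simpa using this
  have h2 : ∑ m, (v m - u m) ^ 2 = ∑ m, (w m - u m) ^ 2 +
      2 * ∑ m, (w m - v m) * (u m - w m) + ∑ m, (w m - v m) ^ 2 := by
    simp only [Finset.mul_sum, ← Finset.sum_add_distrib]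
    exact Finset.sum_congr rfl fun m _ => by ring
  have h3 : 0 ≤ ∑ m, (w m - v m) ^ 2 := Finset.sum_nonneg fun _ _ => sq_nonneg _
  linarith

lemma sum_sq_sub_le_of_mem_stdSimplex {u w : Fin M → ℝ} (hu : u ∈ stdSimplex ℝ (Fin M))
    (hw : w ∈ stdSimplex ℝ (Fin M)) : ∑ m, (w m - u m) ^ 2 ≤ 2 := by
  have h : ∀ m, (w m - u m) ^ 2 ≤ w m + u m := by
    intro m
    have h1 := hw.1 m
    have h2 := hu.1 m
    have h3 : w m ≤ 1 := by
      rw [← hw.2]; exact Finset.single_le_sum (fun i _ => hw.1 i) (Finset.mem_univ m)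
    have h4 : u m ≤ 1 := by
      rw [← hu.2]; exact Finset.single_le_sum (fun i _ => hu.1 i) (Finset.mem_univ m)
    nlinarith [mul_nonneg h1 h2]
  calc ∑ m, (w m - u m) ^ 2 ≤ ∑ m, (w m + u m) := Finset.sum_le_sum fun m _ => h m
    _ = 2 := by rw [Finset.sum_add_distrib, hw.2, hu.2]; norm_num

/-- The regret bound of projected gradient ascent with step sizes `c / √(t + 1)`, started in any
round. -/
lemma projected_gradient_regret {w g : ℕ → Fin M → ℝ} {c G : ℝ} (hc : 0 < c)
    {T₀ : ℕ} (hw0 : w T₀ ∈ stdSimplex ℝ (Fin M))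
    (hstep : ∀ t, IsSimplexProj (fun m => w t m + c / √((t : ℝ) + 1) * g t m) (w (t + 1)))
    (hG : ∀ t, T₀ ≤ t → ∑ m, g t m ^ 2 ≤ G) {u : Fin M → ℝ} (hu : u ∈ stdSimplex ℝ (Fin M))
    (n : ℕ) :
    ∑ t ∈ Finset.range n, ∑ m, g (T₀ + t) m * (u m - w (T₀ + t) m) ≤
      (1 / c + c * G) * √((T₀ + n : ℕ) : ℝ) := by
  have hG0 : 0 ≤ G := (Finset.sum_nonneg fun m _ => sq_nonneg (g T₀ m)).trans (hG T₀ le_rfl)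
  have hmem : ∀ t, w (T₀ + t) ∈ stdSimplex ℝ (Fin M) := by
    intro t
    cases t with
    | zero => exact hw0
    | succ t => exact (hstep (T₀ + t)).1
  set D : ℕ → ℝ := fun t => ∑ m, (w (T₀ + t) m - u m) ^ 2 with hD
  have hD0 : ∀ t, 0 ≤ D t := fun t => Finset.sum_nonneg fun _ _ => sq_nonneg _
  have hD2 : ∀ t, D t ≤ 2 := fun t => sum_sq_sub_le_of_mem_stdSimplex hu (hmem t)
  -- The projection inequality for a step `c / r` reads `D (t + 1) ≤ D t - 2 (c / r) ⟨g, u - w⟩ + (c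
  -- / r)² G`; solve it for the inner product.
  have hone : ∀ t, ∑ m, g (T₀ + t) m * (u m - w (T₀ + t) m) ≤
      (D t - D (t + 1)) * √((T₀ + t : ℕ) + 1 : ℝ) / (2 * c) + c * G / (2 * √((T₀ + t : ℕ) + 1 : ℝ)) := by
    intro t
    set r := √((T₀ + t : ℕ) + 1 : ℝ) with hr
    have hrp : 0 < r := Real.sqrt_pos.2 (by positivity)
    have h1 := (hstep (T₀ + t)).sum_sq_le hu
    have h2 : ∑ m, (w (T₀ + t) m + c / r * g (T₀ + t) m - u m) ^ 2 =
        D t - 2 * (c / r) * ∑ m, g (T₀ + t) m * (u m - w (T₀ + t) m) +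
          (c / r) ^ 2 * ∑ m, g (T₀ + t) m ^ 2 := by
      rw [hD]
      simp only [Finset.mul_sum, ← Finset.sum_add_distrib, ← Finset.sum_sub_distrib]
      exact Finset.sum_congr rfl fun m _ => by ring
    rw [h2] at h1
    have h3 : (c / r) ^ 2 * ∑ m, g (T₀ + t) m ^ 2 ≤ (c / r) ^ 2 * G :=
      mul_le_mul_of_nonneg_left (hG _ (by omega)) (by positivity)
    have h4 : D (t + 1) = ∑ m, (w (T₀ + t + 1) m - u m) ^ 2 := rfl
    rw [← h4] at h1
    have h5 : 2 * (c / r) * ∑ m, g (T₀ + t) m * (u m - w (T₀ + t) m) ≤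
        D t - D (t + 1) + (c / r) ^ 2 * G := by linarith
    have h6 : (D t - D (t + 1)) * r / (2 * c) + c * G / (2 * r) =
        (D t - D (t + 1) + (c / r) ^ 2 * G) / (2 * (c / r)) := by
      field_simp
    rw [h6, le_div_iff₀ (by positivity)]
    linarith
  -- Carrying `2 - D n ≥ 0` through the induction does the work of a summation by parts against the
  -- growing factor `√(t + 1)`. The second term telescopes because `1 / (2 r) ≤ r - q` when `r² = q²
  -- + 1`.
  have key : ∀ n, ∑ t ∈ Finset.range n, ∑ m, g (T₀ + t) m * (u m - w (T₀ + t) m) ≤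
      (2 - D n) * √((T₀ + n : ℕ) : ℝ) / (2 * c) + c * G * √((T₀ + n : ℕ) : ℝ) := by
    intro n
    induction n with
    | zero =>
      have := hD2 0
      rw [Finset.sum_range_zero]
      have : 0 ≤ 2 - D 0 := by linarith
      positivity
    | succ n ih =>
      rw [Finset.sum_range_succ]
      set r := √((T₀ + n : ℕ) + 1 : ℝ) with hr
      set q := √((T₀ + n : ℕ) : ℝ) with hq
      have hrp : 0 < r := Real.sqrt_pos.2 (by positivity)
      have hq0 : 0 ≤ q := Real.sqrt_nonneg _
      have hqr : q ≤ r := Real.sqrt_le_sqrt (by linarith)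
      have hr' : √((T₀ + (n + 1) : ℕ) : ℝ) = r := by rw [hr]; push_cast; ring_nf
      rw [hr']
      have hsq : r ^ 2 = q ^ 2 + 1 := by
        rw [hr, hq, Real.sq_sqrt (by positivity), Real.sq_sqrt (by positivity)]
      have h1 : 1 / (2 * r) ≤ r - q := by
        rw [div_le_iff₀ (by positivity)]
        nlinarith
      have h2 := hone n
      rw [← hr] at h2
      have h3 : c * G / (2 * r) ≤ c * G * (r - q) := by
        rw [show c * G / (2 * r) = c * G * (1 / (2 * r)) by ring]
        exact mul_le_mul_of_nonneg_left h1 (by positivity)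
      have h4 : (2 - D n) * q / (2 * c) ≤ (2 - D n) * r / (2 * c) := by
        have := hD2 n
        have h2D : 0 ≤ 2 - D n := by linarith
        gcongr
      have h5 : (2 - D (n + 1)) * r / (2 * c) =
          (2 - D n) * r / (2 * c) + (D n - D (n + 1)) * r / (2 * c) := by ring
      linarith
  refine (key n).trans ?_
  have hs := Real.sqrt_nonneg ((T₀ + n : ℕ) : ℝ)
  have h1 : (2 - D n) * √((T₀ + n : ℕ) : ℝ) / (2 * c) ≤ 2 * √((T₀ + n : ℕ) : ℝ) / (2 * c) := by
    have := hD0 n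
    gcongr
    linarith
  have h2 : 2 * √((T₀ + n : ℕ) : ℝ) / (2 * c) = 1 / c * √((T₀ + n : ℕ) : ℝ) := by
    field_simp
  rw [add_mul]
  linarith

end

/-! ### Continuity of `ψ` in the instance and growth of the test statistic -/

section

variable {M d K : ℕ} {𝒳 : Type*} [MeasurableSpace 𝒳] {Ω : Type*} {mΩ : MeasurableSpace Ω}
  {F : ArmFamily M d 𝒳} {Θ : Set (Param d)} {𝒞 : (Fin M → Param d) → Fin M → Fin K}

/-! ### Kullback-Leibler divergences of the arms -/

lemma ArmFamily.isProbabilityMeasure_law (F : ArmFamily M d 𝒳) (m : Fin M) {ρ : Param d}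
    (hρ : ρ ∈ F.dom) : IsProbabilityMeasure (F.law m ρ) :=
  ⟨by rw [ArmFamily.law, withDensity_apply _ MeasurableSet.univ, setLIntegral_univ,
    F.lintegral_dens m ρ hρ]⟩

lemma ArmFamily.kl_self (F : ArmFamily M d 𝒳) (m : Fin M) {ρ : Param d} (hρ : ρ ∈ F.dom) :
    F.kl m ρ ρ = 0 := by
  have := F.isProbabilityMeasure_law m hρ
  exact InformationTheory.klDiv_self _

/-- The real-valued KL divergence. -/
def ArmFamily.klReal (F : ArmFamily M d 𝒳) (m : Fin M) (ρ₁ ρ₂ : Param d) : ℝ :=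
  (F.kl m ρ₁ ρ₂).toReal

lemma ArmFamily.klReal_nonneg (F : ArmFamily M d 𝒳) (m : Fin M) (ρ₁ ρ₂ : Param d) :
    0 ≤ F.klReal m ρ₁ ρ₂ := ENNReal.toReal_nonneg

section Regular

variable {θ : Fin M → Param d}

lemma ArmFamily.Regular.klReal_self (hF : F.Regular Θ θ) (m : Fin M) {ρ : Param d} (hρ : ρ ∈ Θ) :
    F.klReal m ρ ρ = 0 := by
  rw [ArmFamily.klReal, F.kl_self m (hF.subset_dom hρ), ENNReal.toReal_zero]

lemma ArmFamily.Regular.exists_klReal_le (hF : F.Regular Θ θ) :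
    ∃ B : ℝ, 0 ≤ B ∧ ∀ m, ∀ ρ₁ ∈ Θ, ∀ ρ₂ ∈ Θ, F.klReal m ρ₁ ρ₂ ≤ B := by
  have h : ∀ m, ∃ B : ℝ, ∀ q ∈ Θ ×ˢ Θ, (F.kl m q.1 q.2).toReal ≤ B := by
    intro m
    obtain ⟨B, hB⟩ := (hF.isCompact.prod hF.isCompact).bddAbove_image
      (hF.kl_uniformContinuous m).continuousOn
    exact ⟨B, fun q hq => hB ⟨q, hq, rfl⟩⟩
  choose B hB using h
  refine ⟨∑ m, |B m|, Finset.sum_nonneg fun _ _ => abs_nonneg _, fun m ρ₁ h₁ ρ₂ h₂ => ?_⟩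
  calc F.klReal m ρ₁ ρ₂ ≤ B m := hB m (ρ₁, ρ₂) ⟨h₁, h₂⟩
    _ ≤ |B m| := le_abs_self _
    _ ≤ ∑ m, |B m| :=
        Finset.single_le_sum (f := fun m => |B m|) (fun _ _ => abs_nonneg _) (Finset.mem_univ m)

/-- `D_KL` is uniformly continuous, simultaneously for all arms. -/
lemma ArmFamily.Regular.exists_klReal_close (hF : F.Regular Θ θ) {κ : ℝ} (hκ : 0 < κ) :
    ∃ ξ : ℝ, 0 < ξ ∧ ∀ m, ∀ ρ₁ ∈ Θ, ∀ ρ₁' ∈ Θ, ∀ ρ₂ ∈ Θ, ∀ ρ₂' ∈ Θ, dist ρ₁ ρ₁' < ξ →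
      dist ρ₂ ρ₂' < ξ → |F.klReal m ρ₁ ρ₂ - F.klReal m ρ₁' ρ₂'| < κ := by
  have h : ∀ m, ∃ ξ : ℝ, 0 < ξ ∧ ∀ ρ₁ ∈ Θ, ∀ ρ₁' ∈ Θ, ∀ ρ₂ ∈ Θ, ∀ ρ₂' ∈ Θ, dist ρ₁ ρ₁' < ξ →
      dist ρ₂ ρ₂' < ξ → |F.klReal m ρ₁ ρ₂ - F.klReal m ρ₁' ρ₂'| < κ := by
    intro m
    obtain ⟨ξ, hξ, h⟩ := Metric.uniformContinuousOn_iff.1 (hF.kl_uniformContinuous m) κ hκ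
    refine ⟨ξ, hξ, fun ρ₁ h₁ ρ₁' h₁' ρ₂ h₂ ρ₂' h₂' hd₁ hd₂ => ?_⟩
    exact h (ρ₁, ρ₂) ⟨h₁, h₂⟩ (ρ₁', ρ₂') ⟨h₁', h₂'⟩ (max_lt hd₁ hd₂)
  choose ξ hξ h using h
  rcases isEmpty_or_nonempty (Fin M) with hM | hM
  · exact ⟨1, one_pos, fun m => hM.elim m⟩
  · obtain ⟨m₀, hm₀⟩ := Finite.exists_min ξ
    exact ⟨ξ m₀, hξ m₀, fun m ρ₁ h₁ ρ₁' h₁' ρ₂ h₂ ρ₂' h₂' hd₁ hd₂ =>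
      h m ρ₁ h₁ ρ₁' h₁' ρ₂ h₂ ρ₂' h₂' (hd₁.trans_le (hm₀ m)) (hd₂.trans_le (hm₀ m))⟩

lemma ArmFamily.Regular.weightedKL_eq (hF : F.Regular Θ θ) {w : Fin M → ℝ} (hw : ∀ m, 0 ≤ w m)
    {ρ lam : Fin M → Param d} (hρ : ∀ m, ρ m ∈ Θ) (hlam : ∀ m, lam m ∈ Θ) :
    F.weightedKL w ρ lam = ENNReal.ofReal (∑ m, w m * F.klReal m (ρ m) (lam m)) := by
  rw [ArmFamily.weightedKL, ENNReal.ofReal_sum_of_nonneg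
    fun m _ => mul_nonneg (hw m) (F.klReal_nonneg m _ _)]
  refine Finset.sum_congr rfl fun m _ => ?_
  rw [ENNReal.ofReal_mul (hw m), ArmFamily.klReal,
    ENNReal.ofReal_toReal (hF.kl_ne_top m _ (hρ m) _ (hlam m))]

lemma ArmFamily.Regular.psi_le (hF : F.Regular Θ θ) {w : Fin M → ℝ} (hw : ∀ m, 0 ≤ w m)
    {ρ lam : Fin M → Param d} (hρ : ∀ m, ρ m ∈ Θ) (hlam : lam ∈ altSet Θ 𝒞 ρ) :
    F.psi Θ 𝒞 w ρ ≤ ENNReal.ofReal (∑ m, w m * F.klReal m (ρ m) (lam m)) := by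
  rw [← hF.weightedKL_eq hw hρ hlam.1]
  exact iInf₂_le lam hlam

lemma ArmFamily.Regular.psi_ne_top (hF : F.Regular Θ θ) {w : Fin M → ℝ} (hw : ∀ m, 0 ≤ w m)
    {ρ : Fin M → Param d} (hρ : ∀ m, ρ m ∈ Θ) (h : (altSet Θ 𝒞 ρ).Nonempty) :
    F.psi Θ 𝒞 w ρ ≠ ∞ := by
  obtain ⟨lam, hlam⟩ := h
  exact ((hF.psi_le hw hρ hlam).trans_lt ENNReal.ofReal_lt_top).ne

lemma ArmFamily.Regular.mem_of_mem_closure_altSet (hF : F.Regular Θ θ) {ρ lam : Fin M → Param d}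
    (h : lam ∈ closure (altSet Θ 𝒞 ρ)) : ∀ m, lam m ∈ Θ := by
  intro m
  have hcl : IsClosed {lam : Fin M → Param d | lam m ∈ Θ} :=
    hF.isCompact.isClosed.preimage (continuous_apply m)
  exact closure_minimal (fun l hl => hl.1 m) hcl h

/-- The infimum defining `ψ` bounds the weighted divergence also on the closure of the
alternatives. -/
lemma ArmFamily.Regular.psi_toReal_le (hF : F.Regular Θ θ) {w : Fin M → ℝ} (hw : ∀ m, 0 ≤ w m)
    {ρ lam : Fin M → Param d} (hρ : ∀ m, ρ m ∈ Θ) (hlam : lam ∈ closure (altSet Θ 𝒞 ρ)) :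
    (F.psi Θ 𝒞 w ρ).toReal ≤ ∑ m, w m * F.klReal m (ρ m) (lam m) := by
  have hΘ := hF.mem_of_mem_closure_altSet hlam
  obtain ⟨l, hl, hlim⟩ := mem_closure_iff_seq_limit.1 hlam
  have hkl : ∀ m, Tendsto (fun n => F.klReal m (ρ m) (l n m)) atTop
      (𝓝 (F.klReal m (ρ m) (lam m))) := by
    intro m
    have h1 : Tendsto (fun n => ((ρ m, l n m) : Param d × Param d)) atTop
        (𝓝[Θ ×ˢ Θ] (ρ m, lam m)) := by
      refine tendsto_nhdsWithin_iff.2 ⟨?_, Eventually.of_forall fun n => ⟨hρ m, (hl n).1 m⟩⟩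
      exact tendsto_const_nhds.prodMk_nhds ((tendsto_pi_nhds.1 hlim) m)
    have h2 := Tendsto.comp
      ((hF.kl_uniformContinuous m).continuousOn (ρ m, lam m) ⟨hρ m, hΘ m⟩) h1
    exact h2
  have hsum : Tendsto (fun n => ∑ m, w m * F.klReal m (ρ m) (l n m)) atTop
      (𝓝 (∑ m, w m * F.klReal m (ρ m) (lam m))) :=
    tendsto_finsetSum _ fun m _ => (hkl m).const_mul (w m)
  refine ge_of_tendsto' hsum fun n => ?_
  exact ENNReal.toReal_le_of_le_ofReal
    (Finset.sum_nonneg fun m _ => mul_nonneg (hw m) (F.klReal_nonneg m _ _))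
    (hF.psi_le hw hρ (hl n))

/-! ### The alternative space near an instance -/

lemma ClusterEquiv.symm {c₁ c₂ : Fin M → Fin K} (h : ClusterEquiv c₁ c₂) : ClusterEquiv c₂ c₁ := by
  obtain ⟨σ, rfl⟩ := h
  exact ⟨σ⁻¹, by ext; simp⟩

lemma ClusterEquiv.trans {c₁ c₂ c₃ : Fin M → Fin K} (h : ClusterEquiv c₁ c₂)
    (h' : ClusterEquiv c₂ c₃) : ClusterEquiv c₁ c₃ := by
  obtain ⟨σ, rfl⟩ := h
  obtain ⟨σ', rfl⟩ := h'
  exact ⟨σ * σ', by ext; simp⟩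

/-- Lets `ψ` at the estimate and at the instance be compared as infima over the same set. -/
lemma altSet_congr {ρ ρ' : Fin M → Param d} (h : ClusterEquiv (𝒞 ρ) (𝒞 ρ')) :
    altSet Θ 𝒞 ρ = altSet Θ 𝒞 ρ' := by
  ext lam
  exact and_congr_right fun _ => not_congr ⟨fun h' => h.symm.trans h', fun h' => h.trans h'⟩

/-- If every weighted divergence to the alternatives is bounded below, then the clustering does
not change near `θ`. -/
lemma ArmFamily.Regular.exists_clusterEquiv (hF : F.Regular Θ θ) {w : Fin M → ℝ}
    (hw : w ∈ stdSimplex ℝ (Fin M)) (hpos : 0 < F.psi Θ 𝒞 w θ) :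
    ∃ ξ : ℝ, 0 < ξ ∧ ∀ ρ : Fin M → Param d, (∀ m, ρ m ∈ Θ) → (∀ m, dist (ρ m) (θ m) < ξ) →
      ClusterEquiv (𝒞 θ) (𝒞 ρ) := by
  obtain ⟨κ, hκ, hκ'⟩ : ∃ κ : ℝ, 0 < κ ∧ ENNReal.ofReal κ < F.psi Θ 𝒞 w θ := by
    obtain ⟨r, hr0, hr⟩ := ENNReal.lt_iff_exists_real_btwn.1 hpos
    exact ⟨r, ENNReal.ofReal_pos.1 hr.1, hr.2⟩
  obtain ⟨ξ, hξ, h⟩ := hF.exists_klReal_close hκ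
  refine ⟨ξ, hξ, fun ρ hρ hd => ?_⟩
  -- If the clustering differed, `ρ` would itself be an alternative, of cost at most `κ < ψ(w, θ)`.
  by_contra hcon
  have h1 := hF.psi_le hw.1 hF.instance_mem (𝒞 := 𝒞) (lam := ρ) ⟨hρ, hcon⟩
  have h2 : ∑ m, w m * F.klReal m (θ m) (ρ m) ≤ κ := by
    calc ∑ m, w m * F.klReal m (θ m) (ρ m) ≤ ∑ m, w m * κ := by
          refine Finset.sum_le_sum fun m _ => mul_le_mul_of_nonneg_left ?_ (hw.1 m)
          have := h m (θ m) (hF.instance_mem m) (θ m) (hF.instance_mem m) (ρ m) (hρ m) (θ m)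
            (hF.instance_mem m) (by simpa using hξ) (hd m)
          rw [hF.klReal_self m (hF.instance_mem m), sub_zero] at this
          exact (le_abs_self _).trans this.le
      _ = κ := by rw [← Finset.sum_mul, hw.2, one_mul]
  exact absurd (h1.trans (ENNReal.ofReal_le_ofReal h2)) (not_le.2 hκ')

/-- Both sides are infima over the same set, and the objectives differ by at most `κ` since the
weights sum to one. Nonemptiness makes `ψ` finite, so that `toReal` does not collapse `∞` to `0`. -/
lemma ArmFamily.Regular.psi_toReal_le_add (hF : F.Regular Θ θ) {w : Fin M → ℝ}
    (hw : w ∈ stdSimplex ℝ (Fin M)) {ρ₁ ρ₂ : Fin M → Param d} (h₁ : ∀ m, ρ₁ m ∈ Θ)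
    (h₂ : ∀ m, ρ₂ m ∈ Θ) (halt : altSet Θ 𝒞 ρ₁ = altSet Θ 𝒞 ρ₂)
    (hne : (altSet Θ 𝒞 ρ₁).Nonempty) {κ : ℝ}
    (hκ : ∀ m, ∀ lam ∈ Θ, F.klReal m (ρ₁ m) lam ≤ F.klReal m (ρ₂ m) lam + κ) :
    (F.psi Θ 𝒞 w ρ₁).toReal ≤ (F.psi Θ 𝒞 w ρ₂).toReal + κ := by
  rw [← sub_le_iff_le_add]
  have hne2 := hF.psi_ne_top (𝒞 := 𝒞) hw.1 h₂ (halt ▸ hne)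
  rw [← ENNReal.ofReal_le_iff_le_toReal hne2]
  refine le_iInf₂ fun lam hlam => ?_
  rw [hF.weightedKL_eq hw.1 h₂ hlam.1]
  refine ENNReal.ofReal_le_ofReal ?_
  rw [sub_le_iff_le_add]
  refine (hF.psi_toReal_le hw.1 h₁ (subset_closure (halt ▸ hlam))).trans ?_
  calc ∑ m, w m * F.klReal m (ρ₁ m) (lam m)
      ≤ ∑ m, w m * (F.klReal m (ρ₂ m) (lam m) + κ) :=
        Finset.sum_le_sum fun m _ => mul_le_mul_of_nonneg_left (hκ m _ (hlam.1 m)) (hw.1 m)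
    _ = ∑ m, w m * F.klReal m (ρ₂ m) (lam m) + κ := by
        simp only [mul_add, Finset.sum_add_distrib, ← Finset.sum_mul, hw.2, one_mul]

end Regular

/-! ### The test statistic -/

/-- Once the estimates stay close to the instance, the test statistic grows at the rate
`ψ(w, θ)`, up to an error of order `√T`. -/
lemma IsEBC.le_statZ {θ : Fin M → Param d} (hF : F.Regular Θ θ) {𝓕 : Filtration ℕ mΩ}
    {X : Fin M → ℕ → Ω → 𝒳} {c : ℝ} (hc : 0 < c) {R : EBCProcess M d Ω}
    (hR : IsEBC F Θ 𝒞 𝓕 X c R) {w : Fin M → ℝ} (hw : w ∈ stdSimplex ℝ (Fin M))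
    (hne : (altSet Θ 𝒞 θ).Nonempty) {B : ℝ}
    (hB : ∀ m, ∀ ρ₁ ∈ Θ, ∀ ρ₂ ∈ Θ, F.klReal m ρ₁ ρ₂ ≤ B) {κ : ℝ} {ω : Ω} {T₀ T : ℕ}
    (hT₀ : 1 ≤ T₀) (hT : T₀ ≤ T)
    (halt : ∀ t, T₀ ≤ t → altSet Θ 𝒞 (R.est t ω) = altSet Θ 𝒞 θ)
    (hκ : ∀ t, T₀ ≤ t → ∀ m, ∀ lam ∈ Θ,
      |F.klReal m (R.est t ω m) lam - F.klReal m (θ m) lam| ≤ κ) :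
    ENNReal.ofReal ((T - T₀) * ((F.psi Θ 𝒞 w θ).toReal - 2 * κ) - T * κ
      - (1 / c + c * (M * B ^ 2)) * √T - M * (M * (√T + 1)) * B) ≤ R.statZ F Θ 𝒞 T ω := by
  have hTpos : (0 : ℝ) < T := by exact_mod_cast (hT₀.trans hT)
  have hwt : ∀ t, R.weight t ω ∈ stdSimplex ℝ (Fin M) := fun t => hR.weight_mem t ω
  set g : ℕ → Fin M → ℝ := fun t m => F.klReal m (R.est (t + 1) ω m) (R.near (t + 1) ω m) with hg
  have hnear : ∀ t, T₀ ≤ t → R.near (t + 1) ω ∈ closure (altSet Θ 𝒞 (R.est (t + 1) ω)) ∧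
      F.weightedKL (R.weight t ω) (R.est (t + 1) ω) (R.near (t + 1) ω) =
        F.psi Θ 𝒞 (R.weight t ω) (R.est (t + 1) ω) := fun t ht =>
    hR.near_spec t ω (by rw [halt (t + 1) (by omega)]; exact hne)
  have hnearΘ : ∀ t, T₀ ≤ t → ∀ m, R.near (t + 1) ω m ∈ Θ := fun t ht =>
    hF.mem_of_mem_closure_altSet (hnear t ht).1
  have hGb : ∀ t, T₀ ≤ t → ∑ m, g t m ^ 2 ≤ M * B ^ 2 := by
    intro t ht
    calc ∑ m, g t m ^ 2 ≤ ∑ _m : Fin M, B ^ 2 := Finset.sum_le_sum fun m _ =>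
          pow_le_pow_left₀ (F.klReal_nonneg _ _ _)
            (hB m _ (hR.est_mem _ _ _) _ (hnearΘ t ht m)) 2
      _ = M * B ^ 2 := by simp
  -- The supergradient inequality: `near` attains `ψ` at the current weight and is merely a
  -- competitor for `w`. One `κ` pays for passing from `θ` to the estimate, the other for passing
  -- back.
  have hstep : ∀ t ≥ T₀, (F.psi Θ 𝒞 w θ).toReal - 2 * κ - ∑ m, g t m * (w m - R.weight t ω m) ≤
      (F.psi Θ 𝒞 (R.weight t ω) θ).toReal := by
    intro t ht
    have ha := halt (t + 1) (by omega)
    have h1 := hF.psi_toReal_le_add hw hF.instance_mem (hR.est_mem (t + 1) ω) ha.symm hne (κ := κ)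
      fun m lam hlam => by
        have := abs_le.1 (hκ (t + 1) (by omega) m lam hlam)
        linarith [this.1]
    have h2 := hF.psi_toReal_le_add (hwt t) (hR.est_mem (t + 1) ω) hF.instance_mem ha (ha ▸ hne)
      (κ := κ) fun m lam hlam => by
        have := abs_le.1 (hκ (t + 1) (by omega) m lam hlam)
        linarith [this.2]
    have h3 := hF.psi_toReal_le hw.1 (hR.est_mem (t + 1) ω) (hnear t ht).1
    have h4 : (F.psi Θ 𝒞 (R.weight t ω) (R.est (t + 1) ω)).toReal =
        ∑ m, R.weight t ω m * g t m := by
      rw [← (hnear t ht).2, hF.weightedKL_eq (hwt t).1 (hR.est_mem (t + 1) ω) (hnearΘ t ht),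
        ENNReal.toReal_ofReal (Finset.sum_nonneg fun m _ =>
          mul_nonneg ((hwt t).1 m) (F.klReal_nonneg m _ _))]
    have h5 : ∑ m, g t m * (w m - R.weight t ω m) =
        ∑ m, w m * g t m - ∑ m, R.weight t ω m * g t m := by
      rw [← Finset.sum_sub_distrib]
      exact Finset.sum_congr rfl fun m _ => by ring
    rw [h5]
    linarith
  have hreg := projected_gradient_regret (w := fun t => R.weight t ω) (g := g) hc (hwt T₀)
    (fun t => hR.weight_succ t ω) hGb hw (T - T₀)
  rw [Nat.add_sub_cancel' hT] at hreg
  have hsumψ : (T - T₀) * ((F.psi Θ 𝒞 w θ).toReal - 2 * κ) - (1 / c + c * (M * B ^ 2)) * √T ≤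
      ∑ t ∈ Finset.range (T - T₀), (F.psi Θ 𝒞 (R.weight (T₀ + t) ω) θ).toReal := by
    have h1 := Finset.sum_le_sum (s := Finset.range (T - T₀)) fun t _ => hstep (T₀ + t) (by omega)
    rw [Finset.sum_sub_distrib, Finset.sum_const, Finset.card_range, nsmul_eq_mul,
      Nat.cast_sub hT] at h1
    linarith
  have hmain : ∀ lam ∈ altSet Θ 𝒞 θ, (T - T₀) * ((F.psi Θ 𝒞 w θ).toReal - 2 * κ) - T * κ
      - (1 / c + c * (M * B ^ 2)) * √T - M * (M * (√T + 1)) * B ≤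
      ∑ m, (R.pulls T ω m : ℝ) * F.klReal m (R.est T ω m) (lam m) := by
    intro lam hlam
    have h1 : ∑ m, (R.pulls T ω m : ℝ) * F.klReal m (θ m) (lam m) - T * κ ≤
        ∑ m, (R.pulls T ω m : ℝ) * F.klReal m (R.est T ω m) (lam m) := by
      have hs : (T : ℝ) * κ = ∑ m, (R.pulls T ω m : ℝ) * κ := by
        rw [← Finset.sum_mul, ← Nat.cast_sum, R.sum_pulls]
      rw [hs, ← Finset.sum_sub_distrib]
      refine Finset.sum_le_sum fun m _ => ?_
      rw [← mul_sub]
      refine mul_le_mul_of_nonneg_left ?_ (Nat.cast_nonneg _)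
      linarith [(abs_le.1 (hκ T hT m (lam m) (hlam.1 m))).1]
    have h2 : ∑ m, (∑ s ∈ Finset.Icc 1 T, R.weight s ω m) * F.klReal m (θ m) (lam m) -
        M * (M * (√T + 1)) * B ≤ ∑ m, (R.pulls T ω m : ℝ) * F.klReal m (θ m) (lam m) := by
      have hs : (M : ℝ) * (M * (√T + 1)) * B = ∑ _m : Fin M, M * (√(T : ℝ) + 1) * B := by
        simp only [Finset.sum_const, Finset.card_univ, Fintype.card_fin, nsmul_eq_mul]; ring
      rw [hs, ← Finset.sum_sub_distrib]
      refine Finset.sum_le_sum fun m _ => ?_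
      have ha := hR.sum_weight_le_pulls ω m T
      have hb := hB m _ (hF.instance_mem m) _ (hlam.1 m)
      have hc := F.klReal_nonneg m (θ m) (lam m)
      have hd : 0 ≤ (M : ℝ) * (√(T : ℝ) + 1) := by positivity
      have he := mul_le_mul_of_nonneg_right ha hc
      have hf := mul_le_mul_of_nonneg_left hb hd
      linarith
    -- Each `ψ(w(s), θ)` is at most the cost of this one alternative, and the rounds outside `[T₀,
    -- T)` contribute nonnegative terms; `T₀ ≥ 1` places the interval inside `[1, T]`.
    have h3 : ∑ t ∈ Finset.range (T - T₀), (F.psi Θ 𝒞 (R.weight (T₀ + t) ω) θ).toReal ≤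
        ∑ m, (∑ s ∈ Finset.Icc 1 T, R.weight s ω m) * F.klReal m (θ m) (lam m) := by
      have ha : ∑ t ∈ Finset.range (T - T₀), (F.psi Θ 𝒞 (R.weight (T₀ + t) ω) θ).toReal =
          ∑ s ∈ Finset.Ico T₀ T, (F.psi Θ 𝒞 (R.weight s ω) θ).toReal :=
        (Finset.sum_Ico_eq_sum_range
          (fun s => (F.psi Θ 𝒞 (R.weight s ω) θ).toReal) T₀ T).symm
      rw [ha]
      simp only [Finset.sum_mul]
      rw [Finset.sum_comm]
      have hb : ∀ s, 0 ≤ ∑ m, R.weight s ω m * F.klReal m (θ m) (lam m) := fun s =>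
        Finset.sum_nonneg fun m _ => mul_nonneg ((hwt s).1 m) (F.klReal_nonneg m _ _)
      refine (Finset.sum_le_sum fun s _ =>
        hF.psi_toReal_le (hwt s).1 hF.instance_mem (subset_closure hlam)).trans ?_
      refine Finset.sum_le_sum_of_subset_of_nonneg (fun s hs => ?_) fun s _ _ => hb s
      rw [Finset.mem_Ico] at hs
      rw [Finset.mem_Icc]
      omega
    linarith
  set A := (T - T₀) * ((F.psi Θ 𝒞 w θ).toReal - 2 * κ) - T * κ
      - (1 / c + c * (M * B ^ 2)) * √T - M * (M * (√T + 1)) * B with hA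
  have hAT : ENNReal.ofReal (A / T) ≤
      F.psi Θ 𝒞 (fun m => (R.pulls T ω m : ℝ) / T) (R.est T ω) := by
    refine le_iInf₂ fun lam hlam => ?_
    rw [hF.weightedKL_eq (fun m => by positivity) (hR.est_mem T ω) hlam.1]
    refine ENNReal.ofReal_le_ofReal ?_
    rw [div_le_iff₀ hTpos, Finset.sum_mul]
    refine (hmain lam (halt T hT ▸ hlam)).trans_eq (Finset.sum_congr rfl fun m _ => ?_)
    field_simp
  calc ENNReal.ofReal A = (T : ℝ≥0∞) * ENNReal.ofReal (A / T) := by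
        rw [← ENNReal.ofReal_natCast, ← ENNReal.ofReal_mul hTpos.le, mul_div_cancel₀ _ hTpos.ne']
    _ ≤ R.statZ F Θ 𝒞 T ω := by
        unfold EBCProcess.statZ
        gcongr

end

/-! ### Strong concavity and the deterministic upper bound on the threshold -/

section

variable {M d K : ℕ} {𝒳 : Type*} [MeasurableSpace 𝒳] {Ω : Type*} {mΩ : MeasurableSpace Ω}
  {F : ArmFamily M d 𝒳} {Θ : Set (Param d)} {𝒞 : (Fin M → Param d) → Fin M → Fin K}

/-! ### Extreme eigenvalues -/

/-- Eigenvalue bounds are traded for the Loewner order, which adds over samples and can be tested on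
vectors. -/
lemma posSemidef_sub_of_le_lamMin {A : Matrix (Fin d) (Fin d) ℝ} (hA : A.IsHermitian) {s : ℝ}
    (hs : s ≤ lamMin A) : (A - algebraMap ℝ _ s).PosSemidef := by
  refine Matrix.posSemidef_iff_isHermitian_and_spectrum_nonneg.2 ⟨?_, ?_⟩
  · refine hA.sub ?_
    rw [Matrix.algebraMap_eq_diagonal]
    exact Matrix.isHermitian_diagonal _
  · intro x hx
    rw [← spectrum.sub_singleton_eq] at hx
    obtain ⟨y, hy, z, hz, rfl⟩ := hx
    rw [Set.mem_singleton_iff] at hz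
    subst hz
    have : lamMin A ≤ y := csInf_le (Matrix.finite_real_spectrum).bddBelow hy
    simp only [Set.mem_ofPred_eq]
    linarith

/-- Positive dimension supplies an eigenvalue; otherwise the spectrum is empty and `lamMax` is `sSup
∅ = 0`. -/
lemma le_lamMax_of_posSemidef_sub {A : Matrix (Fin d) (Fin d) ℝ} (hd : 0 < d) {s : ℝ}
    (hA : (A - algebraMap ℝ _ s).PosSemidef) : s ≤ lamMax A := by
  have h := Matrix.posSemidef_iff_isHermitian_and_spectrum_nonneg.1 hA
  obtain ⟨x, hx⟩ : ∃ x, x ∈ spectrum ℝ (A - algebraMap ℝ _ s) :=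
    ⟨_, h.1.eigenvalues_mem_spectrum_real ⟨0, hd⟩⟩
  have h0 := h.2 hx
  rw [← spectrum.sub_singleton_eq] at hx
  obtain ⟨y, hy, z, hz, hyz⟩ := hx
  rw [Set.mem_singleton_iff] at hz
  subst hz
  have : y ≤ lamMax A := le_csSup (Matrix.finite_real_spectrum).bddAbove hy
  simp only [Set.mem_ofPred_eq] at h0 hyz
  linarith

lemma hessian_isHermitian {f : Param d → ℝ} {ρ : Param d} (h : TwiceDifferentiableAt f ρ) :
    (hessian f ρ).IsHermitian := by
  ext i j
  simp only [Matrix.conjTranspose_apply, hessian, Matrix.of_apply, star_trivial]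
  exact second_derivative_symmetric_of_eventually
    (h.1.mono fun y hy => hy.hasFDerivAt) h.2.hasFDerivAt _ _

lemma fderiv_fderiv_apply_self (f : Param d → ℝ) (ρ u : Param d) :
    fderiv ℝ (fderiv ℝ f) ρ u u = u.ofLp ⬝ᵥ (hessian f ρ).mulVec u.ofLp := by
  have hu : u = ∑ i, u.ofLp i • basisVec i := by
    ext j
    simp [basisVec, Finset.sum_apply, Pi.single_apply]
  conv_lhs => rw [hu]
  simp only [map_sum, map_smul, _root_.sum_apply, _root_.smul_apply,
    smul_eq_mul, dotProduct, Matrix.mulVec, hessian, Matrix.of_apply, Finset.mul_sum]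
  rw [Finset.sum_comm]
  refine Finset.sum_congr rfl fun i _ => Finset.sum_congr rfl fun j _ => by ring

lemma fderiv_fderiv_apply_self_le {f : Param d → ℝ} {ρ : Param d} (h : TwiceDifferentiableAt f ρ)
    {s : ℝ} (hs : s ≤ lamMin (-hessian f ρ)) (u : Param d) :
    fderiv ℝ (fderiv ℝ f) ρ u u ≤ -s * ‖u‖ ^ 2 := by
  have hp := (posSemidef_sub_of_le_lamMin (hessian_isHermitian h).neg hs).dotProduct_mulVec_nonneg
    u.ofLp
  rw [star_trivial, Matrix.sub_mulVec, Matrix.neg_mulVec, dotProduct_sub, dotProduct_neg,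
    ← fderiv_fderiv_apply_self, Algebra.algebraMap_eq_smul_one, Matrix.smul_mulVec,
    Matrix.one_mulVec, dotProduct_smul, smul_eq_mul] at hp
  have : u.ofLp ⬝ᵥ u.ofLp = ‖u‖ ^ 2 := by
    rw [EuclideanSpace.norm_sq_eq]
    simp [dotProduct, sq]
  rw [this] at hp
  linarith

/-- The quadratic upper bound on a strongly concave function. -/
lemma le_of_le_lamMin_hessian {f : Param d → ℝ} (hΘ : Convex ℝ Θ)
    (hf : ∀ ρ ∈ Θ, TwiceDifferentiableAt f ρ) {s : ℝ}
    (hs : ∀ ρ ∈ Θ, s ≤ lamMin (-hessian f ρ)) {x y : Param d} (hx : x ∈ Θ) (hy : y ∈ Θ) :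
    f y ≤ f x + fderiv ℝ f x (y - x) - s / 2 * ‖y - x‖ ^ 2 := by
  set u := y - x with hu
  have hline : ∀ r : ℝ, HasDerivAt (fun r : ℝ => x + r • u) u r := fun r => by
    simpa using ((hasDerivAt_id r).smul_const u).const_add x
  have hmem : ∀ r ∈ Set.Icc (0 : ℝ) 1, x + r • u ∈ Θ := fun r hr =>
    hΘ.add_smul_sub_mem hx hy hr
  have h1 : ∀ r ∈ Set.Icc (0 : ℝ) 1, HasDerivAt (fun r : ℝ => f (x + r • u))
      (fderiv ℝ f (x + r • u) u) r := fun r hr =>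
    ((hf _ (hmem r hr)).1.self_of_nhds.hasFDerivAt).comp_hasDerivAt r (hline r)
  have h2 : ∀ r ∈ Set.Icc (0 : ℝ) 1, HasDerivAt (fun r : ℝ => fderiv ℝ f (x + r • u) u)
      (fderiv ℝ (fderiv ℝ f) (x + r • u) u u) r := fun r hr => by
    have := ((hf _ (hmem r hr)).2.hasFDerivAt).comp_hasDerivAt r (hline r)
    exact this.clm_apply (hasDerivAt_const r u) |>.congr_deriv (by simp)
  set L := ‖u‖ ^ 2
  -- With `φ r = f (x + r u)`, the bound `φ'' ≤ -s L` is integrated twice. Monotonicity takes the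
  -- place of the integrals, so `φ''` need not be continuous.
  have h3 : AntitoneOn (fun r : ℝ => fderiv ℝ f (x + r • u) u + s * L * r) (Set.Icc 0 1) := by
    have hd : ∀ r ∈ Set.Icc (0 : ℝ) 1, HasDerivAt
        (fun r : ℝ => fderiv ℝ f (x + r • u) u + s * L * r)
        (fderiv ℝ (fderiv ℝ f) (x + r • u) u u + s * L) r := fun r hr =>
      (h2 r hr).add (by simpa using (hasDerivAt_id r).const_mul (s * L))
    refine antitoneOn_of_deriv_nonpos (convex_Icc 0 1)
      (fun r hr => (hd r hr).continuousAt.continuousWithinAt)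
      (fun r hr => (hd r (interior_subset hr)).differentiableAt.differentiableWithinAt)
      fun r hr => ?_
    rw [(hd r (interior_subset hr)).deriv]
    have := fderiv_fderiv_apply_self_le (hf _ (hmem r (interior_subset hr)))
      (hs _ (hmem r (interior_subset hr))) u
    linarith
  have h4 : AntitoneOn (fun r : ℝ => f (x + r • u) - r * fderiv ℝ f x u + s * L / 2 * r ^ 2)
      (Set.Icc 0 1) := by
    have hd : ∀ r ∈ Set.Icc (0 : ℝ) 1, HasDerivAt
        (fun r : ℝ => f (x + r • u) - r * fderiv ℝ f x u + s * L / 2 * r ^ 2)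
        (fderiv ℝ f (x + r • u) u - fderiv ℝ f x u + s * L * r) r := fun r hr => by
      have ha := ((hasDerivAt_id r).mul_const (fderiv ℝ f x u))
      have hb := ((hasDerivAt_id r).pow 2).const_mul (s * L / 2)
      refine (((h1 r hr).sub ha).add hb).congr_deriv ?_
      simp
      ring
    refine antitoneOn_of_deriv_nonpos (convex_Icc 0 1)
      (fun r hr => (hd r hr).continuousAt.continuousWithinAt)
      (fun r hr => (hd r (interior_subset hr)).differentiableAt.differentiableWithinAt)
      fun r hr => ?_
    rw [(hd r (interior_subset hr)).deriv]
    have hr' := interior_subset hr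
    have := h3 ⟨le_rfl, zero_le_one⟩ hr' hr'.1
    simp only [zero_smul, add_zero, mul_zero] at this
    linarith
  have h5 := h4 ⟨le_rfl, zero_le_one⟩ ⟨zero_le_one, le_rfl⟩ zero_le_one
  simp only [zero_smul, add_zero, one_smul, zero_mul, one_mul] at h5
  have h6 : x + u = y := by rw [hu]; abel
  rw [h6] at h5
  have h7 : s / 2 * L = s * L / 2 := by ring
  rw [h7]
  linarith

/-! ### The Gaussian tail -/

lemma gaussQ_antitone : Antitone gaussQ := fun _ _ h =>
  measureReal_mono (Set.Ioi_subset_Ioi h)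

lemma gaussQ_nonneg (x : ℝ) : 0 ≤ gaussQ x := measureReal_nonneg

/-- By symmetry both tails have mass `Q(x)`, and the interval between them has positive mass. This
keeps the argument of the logarithm in `logCube` positive. -/
lemma two_mul_gaussQ_lt_one {x : ℝ} (hx : 0 < x) : 2 * gaussQ x < 1 := by
  set γ := gaussianReal 0 1 with hγ
  have hneg : γ.real (Set.Iio (-x)) = gaussQ x := by
    have h1 : γ.map (fun y => -y) = γ := by rw [hγ, gaussianReal_map_neg, neg_zero]
    have h2 : (fun y : ℝ => -y) ⁻¹' Set.Iio (-x) = Set.Ioi x := by ext; simp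
    rw [gaussQ, ← hγ, ← h2, ← map_measureReal_apply measurable_neg measurableSet_Iio, h1]
  have hpos : 0 < γ.real (Set.Icc (-x) x) := by
    rw [measureReal_def, ENNReal.toReal_pos_iff]
    refine ⟨pos_iff_ne_zero.2 fun h0 => ?_, measure_lt_top _ _⟩
    have := gaussianReal_absolutelyContinuous' 0 (one_ne_zero) h0
    rw [Real.volume_Icc, ENNReal.ofReal_eq_zero] at this
    linarith
  have h1 : γ.real (Set.Iio (-x)) + γ.real (Set.Icc (-x) x) + γ.real (Set.Ioi x) ≤ 1 := by
    rw [← measureReal_union _ measurableSet_Icc, ← measureReal_union _ measurableSet_Ioi]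
    · exact measureReal_le_one
    · rw [Set.disjoint_left]
      rintro y (hy | hy) hy'
      · simp only [Set.mem_Iio, Set.mem_Ioi] at hy hy'; linarith
      · exact absurd hy.2 (not_le.2 hy')
    · rw [Set.disjoint_left]
      intro y hy hy'
      exact absurd hy'.1 (not_le.2 hy)
  rw [hneg] at h1
  have : γ.real (Set.Ioi x) = gaussQ x := rfl
  linarith

/-! ### The threshold -/

section Threshold

variable {θ : Fin M → Param d}

lemma ArmFamily.Regular.nonempty_sample (hF : F.Regular Θ θ) (m : Fin M) : Nonempty 𝒳 := by
  have := F.isProbabilityMeasure_law m (hF.subset_dom (hF.instance_mem m))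
  exact nonempty_of_isProbabilityMeasure (F.law m (θ m))

/-- In dimension zero the spectrum is empty and `lamMin` is `sInf ∅ = 0`, which is below `σ ^ 2`. -/
lemma ArmFamily.Regular.dim_pos (hF : F.Regular Θ θ) (m : Fin M) : 0 < d := by
  obtain ⟨x⟩ := hF.nonempty_sample m
  obtain ⟨σ, hσ, h⟩ := hF.strongly_concave
  have h1 := h m x (θ m) (hF.instance_mem m)
  rw [Nat.pos_iff_ne_zero]
  rintro rfl
  rw [lamMin, spectrum.of_subsingleton, Real.sInf_empty] at h1
  nlinarith

lemma ArmFamily.Regular.le_lamMax_sum (hF : F.Regular Θ θ) {σ : ℝ}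
    (hσ : ∀ m x, ∀ ρ ∈ Θ, σ ^ 2 ≤ lamMin (-hessian (F.logLik m x) ρ)) (m : Fin M) {n : ℕ}
    (x : Fin n → 𝒳) {ρ : Param d} (hρ : ρ ∈ Θ) :
    n * σ ^ 2 ≤ lamMax (-∑ s, hessian (F.logLik m (x s)) ρ) := by
  refine le_lamMax_of_posSemidef_sub (hF.dim_pos m) ?_
  have h : (-∑ s, hessian (F.logLik m (x s)) ρ) - algebraMap ℝ _ ((n : ℝ) * σ ^ 2) =
      ∑ s, (-hessian (F.logLik m (x s)) ρ - algebraMap ℝ _ (σ ^ 2)) := by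
    rw [Finset.sum_sub_distrib, Finset.sum_neg_distrib, Finset.sum_const, Finset.card_univ,
      Fintype.card_fin, map_mul, map_natCast, nsmul_eq_mul]
  rw [h]
  exact Matrix.posSemidef_sum _ fun s _ => posSemidef_sub_of_le_lamMin
    (hessian_isHermitian (hF.twiceDiff m (x s) ρ hρ)).neg (hσ m (x s) ρ hρ)

lemma ArmFamily.Regular.le_fisher (hF : F.Regular Θ θ) {σ : ℝ}
    (hσ : ∀ m x, ∀ ρ ∈ Θ, σ ^ 2 ≤ lamMin (-hessian (F.logLik m x) ρ)) (m : Fin M)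
    {ρ : Param d} (hρ : ρ ∈ Θ) : σ ^ 2 ≤ F.fisher m ρ := by
  have := F.isProbabilityMeasure_law m (hF.subset_dom hρ)
  have h := integral_mono (integrable_const (σ ^ 2)) (hF.fisher_integrable m ρ hρ) fun x =>
    le_lamMax_of_posSemidef_sub (hF.dim_pos m) (posSemidef_sub_of_le_lamMin
      (hessian_isHermitian (hF.twiceDiff m x ρ hρ)).neg (hσ m x ρ hρ))
  rw [ArmFamily.fisher]
  simpa using h

/-- The largest eigenvalue is at least `n σ² ≥ σ²`, so the integrand is bounded below by a constant
free of `n`; thus the correction raises the threshold by a bounded amount only. -/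
lemma ArmFamily.Regular.le_logCube (hF : F.Regular Θ θ) {σ : ℝ} (hσ0 : 0 < σ)
    (hσ : ∀ m x, ∀ ρ ∈ Θ, σ ^ 2 ≤ lamMin (-hessian (F.logLik m x) ρ)) {ε : ℝ} (hε : 0 < ε)
    (m : Fin M) {n : ℕ} (hn : 1 ≤ n) {ρ : Param d} (hρ : ρ ∈ Θ) :
    Real.log (1 - 2 * gaussQ (ε * σ)) ≤ F.logCube ε m n ρ := by
  have := F.isProbabilityMeasure_law m (hF.subset_dom hρ)
  have hq := two_mul_gaussQ_lt_one (mul_pos hε hσ0)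
  have hq0 := gaussQ_nonneg (ε * σ)
  rw [ArmFamily.logCube]
  set f : (Fin n → 𝒳) → ℝ := fun x => Real.log (1 - 2 * gaussQ (ε *
    √(lamMax (-∑ s, hessian (F.logLik m (x s)) ρ)))) with hf
  have hle : ∀ x, Real.log (1 - 2 * gaussQ (ε * σ)) ≤ f x := by
    intro x
    refine Real.log_le_log (by linarith) ?_
    have h1 : σ ≤ √(lamMax (-∑ s, hessian (F.logLik m (x s)) ρ)) := by
      refine Real.le_sqrt_of_sq_le (le_trans ?_ (hF.le_lamMax_sum hσ m x hρ))
      have : (1 : ℝ) ≤ n := by exact_mod_cast hn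
      nlinarith [sq_nonneg σ]
    have := gaussQ_antitone (mul_le_mul_of_nonneg_left h1 hε.le)
    linarith
  by_cases hint : Integrable f (Measure.pi fun _ => F.law m ρ)
  · have := integral_mono (integrable_const _) hint hle
    simpa using this
  -- The integral of a nonintegrable function is `0`, which still exceeds the nonpositive bound.
  · rw [integral_undef hint]
    exact Real.log_nonpos (by linarith) (by linarith)

lemma EBCProcess.sum_pulls_mul_klPerturb_le (R : EBCProcess M d Ω) {ε : ℝ} {t : ℕ} {ω : Ω}
    (hest : ∀ m, R.est t ω m ∈ Θ) :
    ∑ m, (R.pulls t ω m : ℝ≥0∞) * F.klPerturb ε m (R.est t ω m) ≤ t * F.eta Θ ε := by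
  calc ∑ m, (R.pulls t ω m : ℝ≥0∞) * F.klPerturb ε m (R.est t ω m)
      ≤ ∑ m, (R.pulls t ω m : ℝ≥0∞) * F.eta Θ ε := by
        refine Finset.sum_le_sum fun m _ => ?_
        gcongr
        exact le_iSup₂_of_le (R.est t ω m) (hest m)
          (le_iSup (fun m => F.klPerturb ε m _) m)
    _ = t * F.eta Θ ε := by
        rw [← Finset.sum_mul, ← Nat.cast_sum, R.sum_pulls]

/-- The crude bound `log t = 2 log √t ≤ 2 √t` suffices, as the regret is of order `√t` anyway. -/
lemma log_mul_natCast_le {a C : ℝ} (ha : 0 < a) (haC : a ≤ C) {n t : ℕ} (hn : 1 ≤ n)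
    (hnt : n ≤ t) : Real.log (a * n) ≤ |Real.log C| + 2 * √t := by
  have hn' : (0 : ℝ) < n := by exact_mod_cast hn
  have ht' : (0 : ℝ) < t := by exact_mod_cast (hn.trans hnt)
  have hC : 0 < C := ha.trans_le haC
  have h1 : Real.log (a * n) ≤ Real.log (C * t) := by
    refine Real.log_le_log (mul_pos ha hn') ?_
    have : (n : ℝ) ≤ t := by exact_mod_cast hnt
    gcongr
  have h2 : Real.log (t : ℝ) = 2 * Real.log √t := by
    rw [Real.log_sqrt ht'.le]; ring
  have h3 := Real.log_le_sub_one_of_pos (Real.sqrt_pos.2 ht')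
  rw [Real.log_mul hC.ne' ht'.ne'] at h1
  linarith [le_abs_self (Real.log C)]

/-- The threshold is at most `log (1 / δ) + η(ε) t + O(√t)`. -/
lemma ArmFamily.Regular.exists_threshold_le (hF : F.Regular Θ θ) {ε : ℝ} (hε : 0 < ε)
    (hη : F.eta Θ ε ≠ ∞) : ∃ C : ℝ, 0 ≤ C ∧ ∀ (R : EBCProcess M d Ω) (δ : ℝ) (t : ℕ) (ω : Ω),
      (∀ m, R.est t ω m ∈ Θ) → (∀ m, 1 ≤ R.pulls t ω m) →
      R.threshold F Θ ε δ t ω ≤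
        ((Real.log (1 / δ) + C * (√t + 1) + t * (F.eta Θ ε).toReal : ℝ) : EReal) := by
  obtain ⟨σ, hσ0, hσ⟩ := hF.strongly_concave
  obtain ⟨I, hI⟩ := hF.fisher_bounded
  set V := (M : ℝ) * d * Real.log ((volume Θ).toReal ^ (1 / (d : ℝ)) / √(2 * Real.pi)) with hV
  set q := Real.log (1 - 2 * gaussQ (ε * σ)) with hq
  refine ⟨d / 2 * (M * (|Real.log I| + 2)) + d * (M * |q|) + |V|, by positivity,
    fun R δ t ω hest hpulls => ?_⟩
  have h1 : ∑ m, Real.log (F.fisher m (R.est t ω m) * R.pulls t ω m) ≤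
      M * (|Real.log I| + 2) * (√t + 1) := by
    calc ∑ m, Real.log (F.fisher m (R.est t ω m) * R.pulls t ω m)
        ≤ ∑ _m : Fin M, (|Real.log I| + 2 * √t) := Finset.sum_le_sum fun m _ =>
          log_mul_natCast_le ((by positivity : 0 < σ ^ 2).trans_le (hF.le_fisher hσ m (hest m)))
            (hI m _ (hest m)) (hpulls m) (R.pulls_le t ω m)
      _ = M * (|Real.log I| + 2 * √t) := by simp [mul_add]
      _ ≤ M * ((|Real.log I| + 2) * (√t + 1)) := by
          refine mul_le_mul_of_nonneg_left ?_ (Nat.cast_nonneg M)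
          nlinarith [Real.sqrt_nonneg (t : ℝ), abs_nonneg (Real.log I),
            mul_nonneg (abs_nonneg (Real.log I)) (Real.sqrt_nonneg (t : ℝ))]
      _ = M * (|Real.log I| + 2) * (√t + 1) := by ring
  have h2 : -(M * |q|) ≤ ∑ m, F.logCube ε m (R.pulls t ω m) (R.est t ω m) := by
    calc -(M * |q|) = ∑ _m : Fin M, -|q| := by simp
      _ ≤ _ := Finset.sum_le_sum fun m _ =>
          (neg_abs_le q).trans (hF.le_logCube hσ0 hσ hε m (hpulls m) (hest m))
  have h3 : ((∑ m, (R.pulls t ω m : ℝ≥0∞) * F.klPerturb ε m (R.est t ω m) : ℝ≥0∞) : EReal) ≤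
      ((t * (F.eta Θ ε).toReal : ℝ) : EReal) := by
    have h := R.sum_pulls_mul_klPerturb_le (F := F) (ε := ε) hest
    have h' : (t : ℝ≥0∞) * F.eta Θ ε = ENNReal.ofReal (t * (F.eta Θ ε).toReal) := by
      rw [ENNReal.ofReal_mul (Nat.cast_nonneg t), ENNReal.ofReal_natCast, ENNReal.ofReal_toReal hη]
    rw [h'] at h
    refine (EReal.coe_ennreal_le_coe_ennreal_iff.2 h).trans_eq ?_
    rw [EReal.coe_ennreal_ofReal, max_eq_left (by positivity)]
  unfold EBCProcess.threshold
  refine (add_le_add le_rfl h3).trans ?_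
  rw [← EReal.coe_add, EReal.coe_le_coe_iff]
  have h4 := mul_le_mul_of_nonneg_left h1 (by positivity : (0 : ℝ) ≤ d / 2)
  have h5 := mul_le_mul_of_nonneg_left h2 (Nat.cast_nonneg d : (0 : ℝ) ≤ d)
  have h6 : (0 : ℝ) ≤ √t := Real.sqrt_nonneg _
  have h7 : d * (M * |q|) + |V| ≤ (d * (M * |q|) + |V|) * (√t + 1) :=
    le_mul_of_one_le_right (by positivity) (by linarith)
  have h8 := le_abs_self V
  rw [add_assoc, add_mul]
  nlinarith
end Threshold

end

/-! ### The score function and the error of maximum likelihood estimates -/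

section

variable {M d K : ℕ} {𝒳 : Type*} [MeasurableSpace 𝒳] {Ω : Type*} {mΩ : MeasurableSpace Ω}
  {F : ArmFamily M d 𝒳} {Θ : Set (Param d)} {𝒞 : (Fin M → Param d) → Fin M → Fin K}

/-! ### The score -/

lemma ArmFamily.measurable_ofReal_dens (F : ArmFamily M d 𝒳) (m : Fin M) {ρ : Param d}
    (hρ : ρ ∈ F.dom) : Measurable fun x => ENNReal.ofReal (F.dens m ρ x) :=
  (F.measurable_dens m ρ hρ).ennreal_ofReal

lemma ArmFamily.measurable_logLik (F : ArmFamily M d 𝒳) (m : Fin M) {ρ : Param d}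
    (hρ : ρ ∈ F.dom) : Measurable fun x => F.logLik m x ρ :=
  (F.measurable_dens m ρ hρ).log

lemma ArmFamily.law_eq_withDensity (F : ArmFamily M d 𝒳) (m : Fin M) {ρ₁ ρ₂ : Param d}
    (h₁ : ρ₁ ∈ F.dom) (h₂ : ρ₂ ∈ F.dom) :
    F.law m ρ₁ = (F.law m ρ₂).withDensity
      fun x => ENNReal.ofReal (F.dens m ρ₁ x / F.dens m ρ₂ x) := by
  have hmeas : Measurable fun x => ENNReal.ofReal (F.dens m ρ₁ x / F.dens m ρ₂ x) :=
    ((F.measurable_dens m ρ₁ h₁).div (F.measurable_dens m ρ₂ h₂)).ennreal_ofReal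
  rw [ArmFamily.law, ArmFamily.law, ← withDensity_mul _ (F.measurable_ofReal_dens m h₂) hmeas]
  congr 1
  ext x
  rw [Pi.mul_apply, ← ENNReal.ofReal_mul (F.dens_pos m ρ₂ h₂ x).le,
    mul_div_cancel₀ _ (F.dens_pos m ρ₂ h₂ x).ne']

/-- Turns finiteness of the divergence into integrability of log-likelihood differences. -/
lemma ArmFamily.llr_ae_eq (F : ArmFamily M d 𝒳) (m : Fin M) {ρ₁ ρ₂ : Param d}
    (h₁ : ρ₁ ∈ F.dom) (h₂ : ρ₂ ∈ F.dom) :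
    llr (F.law m ρ₁) (F.law m ρ₂) =ᵐ[F.law m ρ₁] fun x => F.logLik m x ρ₁ - F.logLik m x ρ₂ := by
  have := F.isProbabilityMeasure_law m h₂
  have heq := F.law_eq_withDensity m h₁ h₂
  have hac : F.law m ρ₁ ≪ F.law m ρ₂ := by
    rw [heq]; exact withDensity_absolutelyContinuous _ _
  have h := Measure.rnDeriv_withDensity (F.law m ρ₂)
    ((F.measurable_dens m ρ₁ h₁).div (F.measurable_dens m ρ₂ h₂)).ennreal_ofReal
  simp only [Pi.div_apply] at h
  rw [← heq] at h
  filter_upwards [hac.ae_le h] with x hx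
  have hp₁ := F.dens_pos m ρ₁ h₁ x
  have hp₂ := F.dens_pos m ρ₂ h₂ x
  rw [llr, hx, ENNReal.toReal_ofReal (div_pos hp₁ hp₂).le, Real.log_div hp₁.ne' hp₂.ne']
  rfl

/-- The mean log-likelihood ratio is nonpositive. -/
lemma ArmFamily.integral_logLik_sub_nonpos (F : ArmFamily M d 𝒳) (m : Fin M) {ρ₁ ρ₂ : Param d}
    (h₁ : ρ₁ ∈ F.dom) (h₂ : ρ₂ ∈ F.dom)
    (hint : Integrable (fun x => F.logLik m x ρ₂ - F.logLik m x ρ₁) (F.law m ρ₁)) :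
    ∫ x, (F.logLik m x ρ₂ - F.logLik m x ρ₁) ∂(F.law m ρ₁) ≤ 0 := by
  have hP₁ := F.isProbabilityMeasure_law m h₁
  have hP₂ := F.isProbabilityMeasure_law m h₂
  have hpos : ∀ x, 0 < F.dens m ρ₂ x / F.dens m ρ₁ x := fun x =>
    div_pos (F.dens_pos m ρ₂ h₂ x) (F.dens_pos m ρ₁ h₁ x)
  have hmeas := (F.measurable_dens m ρ₂ h₂).div (F.measurable_dens m ρ₁ h₁)
  -- Gibbs' inequality: the likelihood ratio has mean one, and `log y ≤ y - 1`.
  have hl : ∫⁻ x, ENNReal.ofReal (F.dens m ρ₂ x / F.dens m ρ₁ x) ∂(F.law m ρ₁) = 1 := by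
    rw [← setLIntegral_univ, ← withDensity_apply _ MeasurableSet.univ,
      ← F.law_eq_withDensity m h₂ h₁, measure_univ]
  have hi : Integrable (fun x => F.dens m ρ₂ x / F.dens m ρ₁ x) (F.law m ρ₁) := by
    refine ⟨hmeas.aestronglyMeasurable, ?_⟩
    rw [hasFiniteIntegral_iff_ofReal (ae_of_all _ fun x => (hpos x).le), hl]
    exact ENNReal.one_lt_top
  have hone : ∫ x, F.dens m ρ₂ x / F.dens m ρ₁ x ∂(F.law m ρ₁) = 1 := by
    rw [integral_eq_lintegral_of_nonneg_ae (ae_of_all _ fun x => (hpos x).le)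
      hmeas.aestronglyMeasurable, hl, ENNReal.toReal_one]
  calc ∫ x, (F.logLik m x ρ₂ - F.logLik m x ρ₁) ∂(F.law m ρ₁)
      ≤ ∫ x, (F.dens m ρ₂ x / F.dens m ρ₁ x - 1) ∂(F.law m ρ₁) := by
        refine integral_mono hint (hi.sub (integrable_const 1)) fun x => ?_
        have := Real.log_le_sub_one_of_pos (hpos x)
        rwa [Real.log_div (F.dens_pos m ρ₂ h₂ x).ne' (F.dens_pos m ρ₁ h₁ x).ne'] at this
    _ = 0 := by
        rw [integral_sub hi (integrable_const 1), hone]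
        simp

/-- The derivative of the log-likelihood at `ρ` in direction `u`. -/
def ArmFamily.score (F : ArmFamily M d 𝒳) (m : Fin M) (ρ u : Param d) (x : 𝒳) : ℝ :=
  fderiv ℝ (F.logLik m x) ρ u

section Regular

variable {θ : Fin M → Param d}

lemma ArmFamily.Regular.tendsto_score (hF : F.Regular Θ θ) (m : Fin M) {ρ : Param d} (hρ : ρ ∈ Θ)
    (u : Param d) (x : 𝒳) :
    Tendsto (fun n : ℕ => (n : ℝ) * (F.logLik m x (ρ + (n : ℝ)⁻¹ • u) - F.logLik m x ρ)) atTop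
      (𝓝 (F.score m ρ u x)) := by
  have h := (hF.twiceDiff m x ρ hρ).1.self_of_nhds.hasFDerivAt.lim u
    (c := fun n : ℕ => (n : ℝ)) (l := atTop) (by
      simpa using tendsto_natCast_atTop_atTop (R := ℝ))
  simpa [ArmFamily.score] using h

/-- The score is a pointwise limit of difference quotients of functions measurable in `x`. Openness
of `dom` makes the quotients with step `1 / n` available from some `N` on. -/
lemma ArmFamily.Regular.measurable_score (hF : F.Regular Θ θ) (m : Fin M) {ρ : Param d}
    (hρ : ρ ∈ Θ) (u : Param d) : Measurable (F.score m ρ u) := by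
  have hdom : ∀ᶠ n : ℕ in atTop, ρ + (n : ℝ)⁻¹ • u ∈ F.dom := by
    have h : Tendsto (fun n : ℕ => ρ + (n : ℝ)⁻¹ • u) atTop (𝓝 (ρ + (0 : ℝ) • u)) :=
      (tendsto_inv_atTop_nhds_zero_nat.smul_const u).const_add ρ
    rw [zero_smul, add_zero] at h
    exact h (F.isOpen_dom.mem_nhds (hF.subset_dom hρ))
  obtain ⟨N, hN⟩ := eventually_atTop.1 hdom
  refine measurable_of_tendsto_metrizable (f := fun n x => ((n + N : ℕ) : ℝ) *
    (F.logLik m x (ρ + ((n + N : ℕ) : ℝ)⁻¹ • u) - F.logLik m x ρ)) (fun n => ?_) ?_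
  · exact ((F.measurable_logLik m (hN (n + N) (by omega))).sub
      (F.measurable_logLik m (hF.subset_dom hρ))).const_mul _
  · rw [tendsto_pi_nhds]
    intro x
    exact (hF.tendsto_score m hρ u x).comp (tendsto_add_atTop_nat N)

lemma ArmFamily.Regular.integrable_abs_score_pow_three (hF : F.Regular Θ θ) (m : Fin M)
    (u : Param d) : Integrable (fun x => |F.score m (θ m) u x| ^ 3) (F.law m (θ m)) := by
  refine ((hF.score_moment m).mul_const (‖u‖ ^ 3)).mono'
    ((hF.measurable_score m (hF.instance_mem m) u).abs.pow_const 3).aestronglyMeasurable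
    (ae_of_all _ fun x => ?_)
  rw [Real.norm_eq_abs, abs_pow, abs_abs, ← mul_pow]
  refine pow_le_pow_left₀ (abs_nonneg _) ?_ 3
  have h := (fderiv ℝ (F.logLik m x) (θ m)).le_opNorm u
  have h2 : ‖gradient (F.logLik m x) (θ m)‖ = ‖fderiv ℝ (F.logLik m x) (θ m)‖ := by
    rw [gradient, LinearIsometryEquiv.norm_map]
  rw [h2]
  exact h

lemma integrable_of_integrable_abs_pow_three {α : Type*} {mα : MeasurableSpace α} {ν : Measure α}
    [IsFiniteMeasure ν] {f : α → ℝ} (hf : Measurable f)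
    (h : Integrable (fun x => |f x| ^ 3) ν) : Integrable f ν := by
  refine (h.add (integrable_const 1)).mono' hf.aestronglyMeasurable (ae_of_all _ fun x => ?_)
  rw [Real.norm_eq_abs, Pi.add_apply]
  have h0 := abs_nonneg (f x)
  nlinarith [sq_nonneg (|f x| - 1), mul_nonneg h0 (sq_nonneg (|f x| - 1))]

lemma ArmFamily.Regular.integrable_score (hF : F.Regular Θ θ) (m : Fin M)
    (u : Param d) : Integrable (F.score m (θ m) u) (F.law m (θ m)) := by
  have := F.isProbabilityMeasure_law m (hF.subset_dom (hF.instance_mem m))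
  exact integrable_of_integrable_abs_pow_three (hF.measurable_score m (hF.instance_mem m) u)
    (hF.integrable_abs_score_pow_three m u)

/-- The mean score points out of the parameter space. -/
lemma ArmFamily.Regular.integral_score_nonpos (hF : F.Regular Θ θ) (m : Fin M) {ρ : Param d}
    (hρ : ρ ∈ Θ) : ∫ x, F.score m (θ m) (ρ - θ m) x ∂(F.law m (θ m)) ≤ 0 := by
  have hθ := hF.instance_mem m
  set u := ρ - θ m with hu
  have hconv : Convex ℝ Θ := by
    obtain ⟨x⟩ := hF.nonempty_sample m
    exact (hF.concave m x).1
  obtain ⟨σ, hσ0, hσ⟩ := hF.strongly_concave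
  set ν := F.law m (θ m) with hν
  have hinv : ∀ n : ℕ, ((n : ℝ) + 1)⁻¹ ∈ Set.Icc (0 : ℝ) 1 := fun n =>
    ⟨by positivity, inv_le_one_of_one_le₀ (by linarith [(Nat.cast_nonneg n : (0 : ℝ) ≤ n)])⟩
  have hmem : ∀ n : ℕ, θ m + ((n : ℝ) + 1)⁻¹ • u ∈ Θ := fun n =>
    hconv.add_smul_sub_mem hθ hρ (hinv n)
  -- By concavity these difference quotients lie between the full difference `log P(x ∣ ρ) - log P(x
  -- ∣ θ_m)` and the score. Both ends are integrable, so dominated convergence applies, and every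
  -- quotient has a nonpositive mean by Gibbs' inequality.
  set h : ℕ → 𝒳 → ℝ := fun n x => ((n : ℝ) + 1) *
    (F.logLik m x (θ m + ((n : ℝ) + 1)⁻¹ • u) - F.logLik m x (θ m)) with hh
  have hmeas : ∀ n, Measurable (h n) := fun n =>
    ((F.measurable_logLik m (hF.subset_dom (hmem n))).sub
      (F.measurable_logLik m (hF.subset_dom hθ))).const_mul _
  have hub : ∀ n x, h n x ≤ F.score m (θ m) u x := by
    intro n x
    have h1 := le_of_le_lamMin_hessian hconv (hF.twiceDiff m x) (hσ m x) hθ (hmem n)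
    rw [add_sub_cancel_left, map_smul, smul_eq_mul] at h1
    have h2 : 0 ≤ σ ^ 2 / 2 * ‖((n : ℝ) + 1)⁻¹ • u‖ ^ 2 := by positivity
    have hn : (0 : ℝ) < n + 1 := by positivity
    have h3 : F.logLik m x (θ m + ((n : ℝ) + 1)⁻¹ • u) - F.logLik m x (θ m) ≤
        ((n : ℝ) + 1)⁻¹ * F.score m (θ m) u x := by
      rw [ArmFamily.score]; linarith
    calc h n x ≤ ((n : ℝ) + 1) * (((n : ℝ) + 1)⁻¹ * F.score m (θ m) u x) :=
          mul_le_mul_of_nonneg_left h3 hn.le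
      _ = F.score m (θ m) u x := by rw [mul_inv_cancel_left₀ hn.ne']
  have hlb : ∀ n x, F.logLik m x ρ - F.logLik m x (θ m) ≤ h n x := by
    intro n x
    have hn : (0 : ℝ) < n + 1 := by positivity
    have ha : 0 ≤ 1 - ((n : ℝ) + 1)⁻¹ := by linarith [(hinv n).2]
    have h1 := (hF.concave m x).2 hθ hρ ha (hinv n).1 (by ring)
    have h2 : (1 - ((n : ℝ) + 1)⁻¹) • θ m + ((n : ℝ) + 1)⁻¹ • ρ =
        θ m + ((n : ℝ) + 1)⁻¹ • u := by
      rw [hu, sub_smul, smul_sub, one_smul]; abel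
    rw [h2, smul_eq_mul, smul_eq_mul] at h1
    have h3 : ((n : ℝ) + 1)⁻¹ * (F.logLik m x ρ - F.logLik m x (θ m)) ≤
        F.logLik m x (θ m + ((n : ℝ) + 1)⁻¹ • u) - F.logLik m x (θ m) := by linarith
    calc F.logLik m x ρ - F.logLik m x (θ m)
        = ((n : ℝ) + 1) * (((n : ℝ) + 1)⁻¹ * (F.logLik m x ρ - F.logLik m x (θ m))) := by
          rw [mul_inv_cancel_left₀ hn.ne']
      _ ≤ h n x := mul_le_mul_of_nonneg_left h3 hn.le
  have hint0 : Integrable (fun x => F.logLik m x ρ - F.logLik m x (θ m)) ν := by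
    have h1 := (InformationTheory.klDiv_ne_top_iff.1 (hF.kl_ne_top m _ hθ _ hρ)).2
    have h2 := (h1.congr (F.llr_ae_eq m (hF.subset_dom hθ) (hF.subset_dom hρ))).neg
    refine h2.congr (ae_of_all _ fun x => ?_)
    simp
  have hbound : Integrable (fun x => |F.logLik m x ρ - F.logLik m x (θ m)| +
      |F.score m (θ m) u x|) ν := hint0.abs.add (hF.integrable_score m u).abs
  have hle : ∀ n x, ‖h n x‖ ≤ |F.logLik m x ρ - F.logLik m x (θ m)| + |F.score m (θ m) u x| := by
    intro n x
    rw [Real.norm_eq_abs, abs_le]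
    have h1 := hlb n x
    have h2 := hub n x
    have h3 := neg_abs_le (F.logLik m x ρ - F.logLik m x (θ m))
    have h4 := le_abs_self (F.score m (θ m) u x)
    have h5 := abs_nonneg (F.logLik m x ρ - F.logLik m x (θ m))
    have h6 := abs_nonneg (F.score m (θ m) u x)
    constructor <;> linarith
  have hint : ∀ n, Integrable (h n) ν := fun n =>
    hbound.mono' (hmeas n).aestronglyMeasurable (ae_of_all _ (hle n))
  have hlim := tendsto_integral_of_dominated_convergence _
    (fun n => (hmeas n).aestronglyMeasurable) hbound (fun n => ae_of_all _ (hle n))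
    (ae_of_all _ fun x => by
      have := (hF.tendsto_score m hθ u x).comp (tendsto_add_atTop_nat 1)
      simpa [Function.comp_def] using this)
  refine le_of_tendsto' hlim fun n => ?_
  have hn : (0 : ℝ) < n + 1 := by positivity
  have hi : Integrable (fun x => F.logLik m x (θ m + ((n : ℝ) + 1)⁻¹ • u) -
      F.logLik m x (θ m)) ν := by
    refine ((hint n).const_mul ((n : ℝ) + 1)⁻¹).congr (ae_of_all _ fun x => ?_)
    simp only [hh]
    rw [inv_mul_cancel_left₀ hn.ne']
  simp only [hh]
  rw [integral_const_mul]
  exact mul_nonpos_of_nonneg_of_nonpos hn.le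
    (F.integral_logLik_sub_nonpos m (hF.subset_dom hθ) (hF.subset_dom (hmem n)) hi)

/-- The mean of the `i`-th coordinate of the score. -/
def ArmFamily.scoreMean (F : ArmFamily M d 𝒳) (m : Fin M) (ρ : Param d) (i : Fin d) : ℝ :=
  ∫ x, F.score m ρ (basisVec i) x ∂(F.law m ρ)

lemma ArmFamily.score_eq_sum (F : ArmFamily M d 𝒳) (m : Fin M) (ρ u : Param d) (x : 𝒳) :
    F.score m ρ u x = ∑ i, u i * F.score m ρ (basisVec i) x := by
  have hu : u = ∑ i, u i • basisVec i := by
    ext j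
    simp [basisVec, Finset.sum_apply, Pi.single_apply]
  conv_lhs => rw [hu]
  simp [ArmFamily.score]

/-- If the centered score sums of an arm are small, then its estimate is accurate. -/
lemma IsEBC.norm_est_sub_le (hF : F.Regular Θ θ) {𝓕 : Filtration ℕ mΩ}
    {X : Fin M → ℕ → Ω → 𝒳} {c : ℝ} {R : EBCProcess M d Ω} (hR : IsEBC F Θ 𝒞 𝓕 X c R)
    {σ : ℝ} (hσ0 : 0 < σ) (hσ : ∀ m x, ∀ ρ ∈ Θ, σ ^ 2 ≤ lamMin (-hessian (F.logLik m x) ρ))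
    {κ : ℝ} (hκ : 0 ≤ κ) {t : ℕ} {ω : Ω} {m : Fin M} (hN : 1 ≤ R.pulls t ω m)
    (h : ∀ i, |∑ s ∈ (Finset.range t).filter fun s => R.arm s ω = m,
      (F.score m (θ m) (basisVec i) (X m s ω) - F.scoreMean m (θ m) i)| ≤ κ * R.pulls t ω m) :
    ‖R.est t ω m - θ m‖ ≤ 2 * d * κ / σ ^ 2 := by
  have hθ := hF.instance_mem m
  have hest := hR.est_mem t ω m
  have hconv : Convex ℝ Θ := by
    obtain ⟨x⟩ := hF.nonempty_sample m
    exact (hF.concave m x).1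
  set u := R.est t ω m - θ m with hu
  set S := (Finset.range t).filter fun s => R.arm s ω = m with hS
  have hcard : (S.card : ℝ) = R.pulls t ω m := rfl
  have hNpos : (0 : ℝ) < R.pulls t ω m := by exact_mod_cast hN
  -- The quadratic bound at `θ_m`, summed over the samples. Since the estimate is at least as likely
  -- as `θ_m`, the quadratic term is at most the score sum in direction `u`, whose mean part is
  -- nonpositive; what remains is the centered sum, and one factor `‖u‖` cancels.
  have h1 : R.armLogLik F X t ω m (R.est t ω m) ≤ R.armLogLik F X t ω m (θ m) +
      ∑ s ∈ S, F.score m (θ m) u (X m s ω) - R.pulls t ω m * (σ ^ 2 / 2 * ‖u‖ ^ 2) := by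
    rw [← hcard, ← nsmul_eq_mul, ← Finset.sum_const]
    unfold EBCProcess.armLogLik
    rw [← Finset.sum_add_distrib, ← Finset.sum_sub_distrib]
    exact Finset.sum_le_sum fun s _ => le_of_le_lamMin_hessian hconv (hF.twiceDiff m _)
      (hσ m _) hθ hest
  have h2 := hR.est_max t ω m _ hθ
  have h3 : ∑ s ∈ S, F.score m (θ m) u (X m s ω) =
      ∑ i, u i * ∑ s ∈ S, (F.score m (θ m) (basisVec i) (X m s ω) - F.scoreMean m (θ m) i) +
        R.pulls t ω m * ∑ i, u i * F.scoreMean m (θ m) i := by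
    simp only [Finset.sum_sub_distrib, Finset.sum_const, nsmul_eq_mul, hcard, mul_sub]
    rw [Finset.sum_congr rfl fun s _ => F.score_eq_sum m (θ m) u (X m s ω), Finset.sum_comm,
      Finset.mul_sum]
    simp only [Finset.mul_sum]
    rw [sub_add_eq_add_sub, eq_sub_iff_add_eq]
    congr 1
    exact Finset.sum_congr rfl fun i _ => by ring
  have h4 : ∑ i, u i * F.scoreMean m (θ m) i ≤ 0 := by
    refine le_of_eq_of_le ?_ (hF.integral_score_nonpos m hest)
    rw [← hu]
    simp only [ArmFamily.scoreMean, F.score_eq_sum m (θ m) u]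
    rw [integral_finsetSum _ fun i _ => (hF.integrable_score m _).const_mul _]
    simp only [integral_const_mul]
  have h5 : ∑ i, u i * ∑ s ∈ S, (F.score m (θ m) (basisVec i) (X m s ω) -
      F.scoreMean m (θ m) i) ≤ d * (‖u‖ * (κ * R.pulls t ω m)) := by
    calc _ ≤ ∑ _i : Fin d, ‖u‖ * (κ * R.pulls t ω m) := by
          refine Finset.sum_le_sum fun i _ => (le_abs_self _).trans ?_
          rw [abs_mul]
          exact mul_le_mul (PiLp.norm_apply_le u i) (h i) (abs_nonneg _) (norm_nonneg _)
      _ = d * (‖u‖ * (κ * R.pulls t ω m)) := by simp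
  have h6 : R.pulls t ω m * ∑ i, u i * F.scoreMean m (θ m) i ≤ 0 :=
    mul_nonpos_of_nonneg_of_nonpos hNpos.le h4
  have h7 : R.pulls t ω m * (‖u‖ * (σ ^ 2 / 2 * ‖u‖)) ≤ R.pulls t ω m * (‖u‖ * (d * κ)) := by
    nlinarith
  have h8 := le_of_mul_le_mul_left h7 hNpos
  have hσ2 : 0 < σ ^ 2 := by positivity
  rw [le_div_iff₀ hσ2]
  rcases (norm_nonneg u).eq_or_lt with h0 | h0
  · rw [← h0, zero_mul]; positivity
  · have := le_of_mul_le_mul_left h8 h0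
    linarith

end Regular

end

/-! ### Concentration for adaptively selected samples -/

section

variable {M d K : ℕ} {𝒳 : Type*} [MeasurableSpace 𝒳] {Ω : Type*} {mΩ : MeasurableSpace Ω}

/-! ### Predictably selected samples -/

/-- The exponential supermartingale of predictably selected factors. -/
lemma lintegral_prod_selected_le_one {μ : Measure Ω} [IsProbabilityMeasure μ]
    {𝓕 : Filtration ℕ mΩ} {G : ℕ → MeasurableSpace Ω} {E : ℕ → Set Ω} {f : ℕ → Ω → ℝ≥0∞}
    (hG : ∀ s, G s ≤ mΩ) (hE : ∀ s, MeasurableSet[𝓕 s] (E s)) (hf : ∀ s, Measurable[G s] (f s))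
    (hf' : ∀ s, Measurable[𝓕 (s + 1)] (f s)) (hind : ∀ s, Indep (G s) (𝓕 s) μ)
    (hle : ∀ s, ∫⁻ ω, f s ω ∂μ ≤ 1) (t : ℕ) :
    Measurable[𝓕 t] (fun ω => ∏ s ∈ Finset.range t, (E s).mulIndicator (f s) ω) ∧
      ∫⁻ ω, ∏ s ∈ Finset.range t, (E s).mulIndicator (f s) ω ∂μ ≤ 1 := by
  classical
  induction t with
  | zero => simp
  | succ t ih =>
    obtain ⟨ihm, ihl⟩ := ih
    set P : Ω → ℝ≥0∞ := fun ω => ∏ s ∈ Finset.range t, (E s).mulIndicator (f s) ω with hP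
    have hle𝓕 : 𝓕 t ≤ 𝓕 (t + 1) := 𝓕.mono (Nat.le_succ t)
    -- Off `E t` the new factor is one. On `E t` it is `f t`, independent of `𝓕 t`, which determines
    -- both `E t` and the product so far.
    have hsplit : ∀ ω, ∏ s ∈ Finset.range (t + 1), (E s).mulIndicator (f s) ω =
        (E t)ᶜ.indicator P ω + (E t).indicator P ω * f t ω := by
      intro ω
      rw [Finset.prod_range_succ]
      by_cases h : ω ∈ E t
      · simp [h, hP]
      · simp [h, hP]
    simp only [hsplit]
    have hPE : Measurable[𝓕 t] ((E t).indicator P) := ihm.indicator (hE t)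
    have hPEc : Measurable[𝓕 t] ((E t)ᶜ.indicator P) := ihm.indicator (hE t).compl
    refine ⟨(hPEc.mono hle𝓕 le_rfl).add ((hPE.mono hle𝓕 le_rfl).mul (hf' t)), ?_⟩
    rw [lintegral_add_left (hPEc.mono (𝓕.le t) le_rfl),
      lintegral_mul_eq_lintegral_mul_lintegral_of_independent_measurableSpace (𝓕.le t) (hG t)
        (hind t).symm hPE (hf t)]
    calc ∫⁻ ω, (E t)ᶜ.indicator P ω ∂μ + (∫⁻ ω, (E t).indicator P ω ∂μ) * ∫⁻ ω, f t ω ∂μ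
        ≤ ∫⁻ ω, (E t)ᶜ.indicator P ω ∂μ + (∫⁻ ω, (E t).indicator P ω ∂μ) * 1 := by
          gcongr; exact hle t
      _ = ∫⁻ ω, P ω ∂μ := by
          rw [mul_one, ← lintegral_add_left (hPEc.mono (𝓕.le t) le_rfl)]
          refine lintegral_congr fun ω => ?_
          by_cases h : ω ∈ E t <;> simp [h]
      _ ≤ 1 := ihl

/-- The rounds before `t` in which one of the first `k` samples of arm `m` is drawn. -/
def EBCProcess.firstRounds (R : EBCProcess M d Ω) (m : Fin M) (k t : ℕ) (ω : Ω) : Finset ℕ :=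
  (Finset.range t).filter fun s => R.arm s ω = m ∧ R.pulls s ω m < k

lemma EBCProcess.card_firstRounds_le (R : EBCProcess M d Ω) (m : Fin M) (k t : ℕ) (ω : Ω) :
    (R.firstRounds m k t ω).card ≤ k := by
  -- The induction needs the second bound: a round is added only while `pulls < k`, so the
  -- cardinality is then below `k` too.
  suffices h : (R.firstRounds m k t ω).card ≤ k ∧ (R.firstRounds m k t ω).card ≤ R.pulls t ω m
    from h.1
  induction t with
  | zero => simp [EBCProcess.firstRounds]
  | succ t ih =>
    unfold EBCProcess.firstRounds at ih ⊢
    rw [Finset.range_add_one, Finset.filter_insert, R.pulls_succ]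
    split_ifs with h h' h'
    · rw [Finset.card_insert_of_notMem (by simp)]; omega
    · exact absurd h.1 h'
    · omega
    · omega

/-- If arm `m` has been sampled exactly `k` times before `t`, then the rounds of its first `k`
samples are those before `t`, at any later time. -/
lemma EBCProcess.firstRounds_eq (R : EBCProcess M d Ω) {m : Fin M} {t t' : ℕ} {ω : Ω}
    (h : t ≤ t') : R.firstRounds m (R.pulls t ω m) t' ω =
      (Finset.range t).filter fun s => R.arm s ω = m := by
  ext s
  simp only [EBCProcess.firstRounds, Finset.mem_filter, Finset.mem_range]
  constructor
  · rintro ⟨-, hs, hlt⟩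
    refine ⟨?_, hs⟩
    by_contra hcon
    exact absurd (R.pulls_mono ω m (not_lt.1 hcon)) (not_le.2 hlt)
  · rintro ⟨hst, hs⟩
    refine ⟨hst.trans_le h, hs, ?_⟩
    have h1 := R.pulls_mono ω m (Nat.succ_le_of_lt hst)
    simp only [Nat.succ_eq_add_one, R.pulls_succ, if_pos hs] at h1
    omega

lemma IsSampling.measurable' {F : ArmFamily M d 𝒳} {θ : Fin M → Param d} {μ : Measure Ω}
    {𝓕 : Filtration ℕ mΩ} {X : Fin M → ℕ → Ω → 𝒳} (hX : IsSampling F θ μ 𝓕 X) (m : Fin M)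
    (s : ℕ) : Measurable (X m s) := (hX.measurable m s).mono (𝓕.le _) le_rfl

section Sampling

variable {F : ArmFamily M d 𝒳} {θ : Fin M → Param d} {μ : Measure Ω} [IsProbabilityMeasure μ]
  {𝓕 : Filtration ℕ mΩ} {X : Fin M → ℕ → Ω → 𝒳} {R : EBCProcess M d Ω}

lemma EBCProcess.measurable_pulls (hR : ∀ t, Measurable[𝓕 t] (R.arm t)) (m : Fin M) (t : ℕ) :
    Measurable[𝓕 t] fun ω => R.pulls t ω m := by
  induction t with
  | zero => simp only [R.pulls_zero]; exact measurable_const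
  | succ t ih =>
    simp only [R.pulls_succ]
    have hset : MeasurableSet[𝓕 t] {ω | R.arm t ω = m} := hR t (measurableSet_singleton m)
    have h1 : Measurable[𝓕 t] fun ω => if R.arm t ω = m then 1 else 0 :=
      Measurable.ite hset measurable_const measurable_const
    exact (ih.add h1).mono (𝓕.mono (Nat.le_succ t)) le_rfl

lemma EBCProcess.measurableSet_mem_firstRounds (hR : ∀ t, Measurable[𝓕 t] (R.arm t))
    (m : Fin M) (k s : ℕ) : MeasurableSet[𝓕 s] {ω | R.arm s ω = m ∧ R.pulls s ω m < k} :=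
  MeasurableSet.inter (hR s (measurableSet_singleton m))
    (R.measurable_pulls hR m s (measurableSet_Iio (a := k)))

/-- Chernoff's bound for the sum over the first `k` samples of an arm. -/
lemma IsSampling.measure_le_sum_firstRounds_le (hX : IsSampling F θ μ 𝓕 X)
    (hR : ∀ t, Measurable[𝓕 t] (R.arm t)) (m : Fin M) {h : 𝒳 → ℝ} (hh : Measurable h) {r b : ℝ}
    (hr : 0 ≤ r) (hb : 0 ≤ b)
    (hmgf : ∫⁻ x, ENNReal.ofReal (Real.exp (r * h x)) ∂(F.law m (θ m)) ≤
      ENNReal.ofReal (Real.exp b)) (k t : ℕ) (a : ℝ) :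
    μ {ω | a ≤ ∑ s ∈ R.firstRounds m k t ω, h (X m s ω)} ≤
      ENNReal.ofReal (Real.exp (b * k - r * a)) := by
  classical
  set E : ℕ → Set Ω := fun s => {ω | R.arm s ω = m ∧ R.pulls s ω m < k} with hE
  set f : ℕ → Ω → ℝ≥0∞ := fun s ω => ENNReal.ofReal (Real.exp (r * h (X m s ω) - b)) with hf
  have hmeas : Measurable fun x => ENNReal.ofReal (Real.exp (r * h x - b)) :=
    (((hh.const_mul r).sub_const b).exp).ennreal_ofReal
  have hle : ∀ s, ∫⁻ ω, f s ω ∂μ ≤ 1 := by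
    intro s
    have h1 : ∫⁻ ω, f s ω ∂μ = ∫⁻ x, ENNReal.ofReal (Real.exp (r * h x - b)) ∂(F.law m (θ m)) := by
      rw [← hX.law m s, lintegral_map hmeas (hX.measurable' m s)]
    have h2 : ∀ x, ENNReal.ofReal (Real.exp (r * h x - b)) =
        ENNReal.ofReal (Real.exp (r * h x)) * ENNReal.ofReal (Real.exp (-b)) := fun x => by
      rw [← ENNReal.ofReal_mul (Real.exp_nonneg _), ← Real.exp_add, sub_eq_add_neg]
    rw [h1, lintegral_congr h2, lintegral_mul_const' _ _ ENNReal.ofReal_ne_top]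
    calc _ ≤ ENNReal.ofReal (Real.exp b) * ENNReal.ofReal (Real.exp (-b)) := by gcongr
      _ = 1 := by
        rw [← ENNReal.ofReal_mul (Real.exp_nonneg _), ← Real.exp_add]
        simp
  obtain ⟨hPm, hPl⟩ := lintegral_prod_selected_le_one (μ := μ) (𝓕 := 𝓕)
    (G := fun s => MeasurableSpace.comap (X m s) inferInstance) (E := E) (f := f)
    (fun s => (hX.measurable' m s).comap_le)
    (fun s => R.measurableSet_mem_firstRounds hR m k s)
    (fun s => hmeas.comp (comap_measurable (X m s)))
    (fun s => hmeas.comp (hX.measurable m s)) (hX.indep m) hle t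
  have hprod : ∀ ω, ∏ s ∈ Finset.range t, (E s).mulIndicator (f s) ω =
      ENNReal.ofReal (Real.exp (r * ∑ s ∈ R.firstRounds m k t ω, h (X m s ω) -
        b * (R.firstRounds m k t ω).card)) := by
    intro ω
    have h1 : r * ∑ s ∈ R.firstRounds m k t ω, h (X m s ω) -
        b * (R.firstRounds m k t ω).card =
        ∑ s ∈ R.firstRounds m k t ω, (r * h (X m s ω) - b) := by
      rw [Finset.sum_sub_distrib, Finset.mul_sum, Finset.sum_const, nsmul_eq_mul, mul_comm b]
    rw [h1, Real.exp_sum, ENNReal.ofReal_prod_of_nonneg fun _ _ => Real.exp_nonneg _]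
    unfold EBCProcess.firstRounds
    rw [Finset.prod_filter]
    refine Finset.prod_congr rfl fun s _ => ?_
    rw [Set.mulIndicator_apply]
    rfl
  -- Fewer than `k` samples may have been drawn; as `b ≥ 0`, the compensator can still be replaced
  -- by `b * k`. Markov's inequality does the rest.
  have hsub : {ω | a ≤ ∑ s ∈ R.firstRounds m k t ω, h (X m s ω)} ⊆
      {ω | ENNReal.ofReal (Real.exp (r * a - b * k)) ≤
        ∏ s ∈ Finset.range t, (E s).mulIndicator (f s) ω} := by
    intro ω hω
    simp only [Set.mem_ofPred_eq] at hω ⊢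
    rw [hprod]
    refine ENNReal.ofReal_le_ofReal (Real.exp_le_exp.2 ?_)
    have h1 := mul_le_mul_of_nonneg_left hω hr
    have h2 : ((R.firstRounds m k t ω).card : ℝ) ≤ k := by
      exact_mod_cast R.card_firstRounds_le m k t ω
    have h3 := mul_le_mul_of_nonneg_left h2 hb
    linarith
  have hM := mul_meas_ge_le_lintegral (μ := μ) (hPm.mono (𝓕.le t) le_rfl)
    (ENNReal.ofReal (Real.exp (r * a - b * k)))
  have hM' := (mul_le_mul_right (measure_mono hsub) _).trans (hM.trans hPl)
  calc μ {ω | a ≤ ∑ s ∈ R.firstRounds m k t ω, h (X m s ω)}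
      = ENNReal.ofReal (Real.exp (b * k - r * a)) * (ENNReal.ofReal (Real.exp (r * a - b * k)) *
        μ {ω | a ≤ ∑ s ∈ R.firstRounds m k t ω, h (X m s ω)}) := by
        rw [← mul_assoc, ← ENNReal.ofReal_mul (Real.exp_nonneg _), ← Real.exp_add]
        simp
    _ ≤ ENNReal.ofReal (Real.exp (b * k - r * a)) * 1 := by gcongr
    _ = _ := mul_one _

/-- A union bound over the first `k` samples of an arm. -/
lemma IsSampling.measure_exists_firstRounds_le (hX : IsSampling F θ μ 𝓕 X)
    (hR : ∀ t, Measurable[𝓕 t] (R.arm t)) (m : Fin M) {S : Set 𝒳} (hS : MeasurableSet S)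
    (k t : ℕ) :
    μ {ω | ∃ s ∈ R.firstRounds m k t ω, X m s ω ∈ S} ≤ k * F.law m (θ m) S := by
  classical
  set E : ℕ → Set Ω := fun s => {ω | R.arm s ω = m ∧ R.pulls s ω m < k} with hE
  have hEm : ∀ s, MeasurableSet[𝓕 s] (E s) := fun s => R.measurableSet_mem_firstRounds hR m k s
  have hEm' : ∀ s, MeasurableSet (E s) := fun s => 𝓕.le s _ (hEm s)
  have hsub : {ω | ∃ s ∈ R.firstRounds m k t ω, X m s ω ∈ S} ⊆
      ⋃ s ∈ Finset.range t, X m s ⁻¹' S ∩ E s := by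
    rintro ω ⟨s, hs, hsS⟩
    simp only [EBCProcess.firstRounds, Finset.mem_filter] at hs
    exact Set.mem_biUnion hs.1 ⟨hsS, hs.2⟩
  have hone : ∀ s, μ (X m s ⁻¹' S ∩ E s) = F.law m (θ m) S * μ (E s) := by
    intro s
    rw [(Indep_iff _ _ μ).1 (hX.indep m s) _ _ ⟨S, hS, rfl⟩ (hEm s), ← hX.law m s,
      Measure.map_apply (hX.measurable' m s) hS]
  -- At most `k` rounds are selected on every path, so the union bound costs a factor `k` whatever
  -- the horizon `t`.
  have hcount : ∑ s ∈ Finset.range t, μ (E s) ≤ k := by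
    calc ∑ s ∈ Finset.range t, μ (E s)
        = ∫⁻ ω, ∑ s ∈ Finset.range t, (E s).indicator 1 ω ∂μ := by
          rw [lintegral_finsetSum _ fun s _ => measurable_one.indicator (hEm' s)]
          exact Finset.sum_congr rfl fun s _ => (lintegral_indicator_one (hEm' s)).symm
      _ ≤ ∫⁻ _ω, (k : ℝ≥0∞) ∂μ := by
          refine lintegral_mono fun ω => ?_
          have h1 : ∑ s ∈ Finset.range t, (E s).indicator (1 : Ω → ℝ≥0∞) ω =
              (R.firstRounds m k t ω).card := by
            rw [EBCProcess.firstRounds, Finset.card_filter, Nat.cast_sum]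
            refine Finset.sum_congr rfl fun s _ => ?_
            rw [Set.indicator_apply]
            simp only [hE, Set.mem_ofPred_eq]
            split_ifs <;> simp
          simp only
          rw [h1]
          exact_mod_cast R.card_firstRounds_le m k t ω
      _ = k := by simp
  calc μ {ω | ∃ s ∈ R.firstRounds m k t ω, X m s ω ∈ S}
      ≤ ∑ s ∈ Finset.range t, μ (X m s ⁻¹' S ∩ E s) :=
        (measure_mono hsub).trans (measure_biUnion_finset_le _ _)
    _ = (∑ s ∈ Finset.range t, μ (E s)) * F.law m (θ m) S := by
        rw [Finset.sum_mul]
        exact Finset.sum_congr rfl fun s _ => by rw [hone, mul_comm]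
    _ ≤ k * F.law m (θ m) S := by gcongr

end Sampling

/-! ### Deviations of sums with finite third moments -/

/-- A second-order bound whose remainder only needs an upper bound on `y`, as suits truncation from
above. -/
lemma exp_le_one_add_add_sq_mul (y : ℝ) :
    Real.exp y ≤ 1 + y + y ^ 2 * Real.exp (max y 0) := by
  have h1 : Real.exp y - 1 ≤ y * Real.exp y := by
    have h := Real.add_one_le_exp (-y)
    have h2 : Real.exp (-y) * Real.exp y = 1 := by rw [← Real.exp_add]; simp
    nlinarith [Real.exp_pos y]
  have h2 := Real.add_one_le_exp y
  rcases le_total 0 y with hy | hy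
  · rw [max_eq_left hy]
    nlinarith
  · rw [max_eq_right hy, Real.exp_zero]
    nlinarith

/-- The moment generating function of a variable truncated from above. -/
lemma lintegral_exp_min_le {α : Type*} {mα : MeasurableSpace α} {ν : Measure α}
    [IsProbabilityMeasure ν] {h : α → ℝ} (hint : Integrable h ν)
    (hmean : ∫ x, h x ∂ν ≤ 0) (hsq : Integrable (fun x => h x ^ 2) ν) {a r : ℝ} (ha : 0 ≤ a)
    (hr : 0 ≤ r) :
    ∫⁻ x, ENNReal.ofReal (Real.exp (r * min (h x) a)) ∂ν ≤
      ENNReal.ofReal (Real.exp (r ^ 2 * (∫ x, h x ^ 2 ∂ν) * Real.exp (r * a))) := by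
  have hpt : ∀ x, Real.exp (r * min (h x) a) ≤ 1 + r * h x + r ^ 2 * Real.exp (r * a) * h x ^ 2 := by
    intro x
    set y := min (h x) a with hy
    have h1 := exp_le_one_add_add_sq_mul (r * y)
    have h2 : r * y ≤ r * h x := mul_le_mul_of_nonneg_left (min_le_left _ _) hr
    have h3 : max (r * y) 0 ≤ r * a :=
      max_le (mul_le_mul_of_nonneg_left (min_le_right _ _) hr) (by positivity)
    have h4 : y ^ 2 ≤ h x ^ 2 := by
      rcases le_total (h x) a with hle | hle
      · rw [hy, min_eq_left hle]
      · rw [hy, min_eq_right hle]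
        exact pow_le_pow_left₀ ha hle 2
    have h5 : (r * y) ^ 2 * Real.exp (max (r * y) 0) ≤ r ^ 2 * Real.exp (r * a) * h x ^ 2 := by
      rw [mul_pow]
      calc r ^ 2 * y ^ 2 * Real.exp (max (r * y) 0) ≤ r ^ 2 * h x ^ 2 * Real.exp (r * a) := by
            gcongr
        _ = _ := by ring
    linarith
  have hi : Integrable (fun x => 1 + r * h x + r ^ 2 * Real.exp (r * a) * h x ^ 2) ν :=
    ((integrable_const 1).add (hint.const_mul r)).add (hsq.const_mul _)
  have hnn : ∀ x, 0 ≤ 1 + r * h x + r ^ 2 * Real.exp (r * a) * h x ^ 2 := fun x =>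
    (Real.exp_nonneg _).trans (hpt x)
  calc ∫⁻ x, ENNReal.ofReal (Real.exp (r * min (h x) a)) ∂ν
      ≤ ∫⁻ x, ENNReal.ofReal (1 + r * h x + r ^ 2 * Real.exp (r * a) * h x ^ 2) ∂ν :=
        lintegral_mono fun x => ENNReal.ofReal_le_ofReal (hpt x)
    _ = ENNReal.ofReal (∫ x, (1 + r * h x + r ^ 2 * Real.exp (r * a) * h x ^ 2) ∂ν) :=
        (ofReal_integral_eq_lintegral_ofReal hi (ae_of_all _ hnn)).symm
    _ ≤ _ := by
        refine ENNReal.ofReal_le_ofReal ?_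
        have h0 : Integrable (fun x => 1 + r * h x) ν :=
          (integrable_const 1).add (hint.const_mul r)
        rw [integral_add h0 (hsq.const_mul _),
          integral_add (integrable_const 1) (hint.const_mul r), integral_const_mul,
          integral_const_mul]
        simp only [integral_const, probReal_univ, smul_eq_mul, mul_one]
        have h1 := Real.add_one_le_exp (r ^ 2 * (∫ x, h x ^ 2 ∂ν) * Real.exp (r * a))
        have h2 : r * ∫ x, h x ∂ν ≤ 0 := mul_nonpos_of_nonneg_of_nonpos hr hmean
        linarith

/-- The terms grow geometrically, so the sum is at most twice its last nonzero term `8 ^ l = (2 ^ l)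
^ 3 < |y| ^ 3`. -/
lemma sum_eight_pow_le (y : ℝ) (n : ℕ) :
    ∑ l ∈ Finset.range n, (if (2 : ℝ) ^ l < y then (8 : ℝ) ^ l else 0) ≤ 2 * |y| ^ 3 := by
  induction n with
  | zero => simp
  | succ n ih =>
    rw [Finset.sum_range_succ]
    split_ifs with h
    · have h1 : ∑ l ∈ Finset.range n, (if (2 : ℝ) ^ l < y then (8 : ℝ) ^ l else 0) ≤
          ∑ l ∈ Finset.range n, (8 : ℝ) ^ l :=
        Finset.sum_le_sum fun l _ => by split_ifs <;> [exact le_rfl; positivity]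
      have h2 : ∑ l ∈ Finset.range n, (8 : ℝ) ^ l ≤ 8 ^ n := by
        rw [geom_sum_eq (by norm_num)]
        rw [div_le_iff₀ (by norm_num)]
        have : (0 : ℝ) < 8 ^ n := by positivity
        linarith
      have h3 : (8 : ℝ) ^ n ≤ |y| ^ 3 := by
        have : (8 : ℝ) ^ n = (2 ^ n) ^ 3 := by
          rw [← pow_mul, mul_comm, pow_mul]; norm_num
        rw [this]
        exact pow_le_pow_left₀ (by positivity) (h.le.trans (le_abs_self y)) 3
      linarith
    · linarith

/-- A variable with a finite third moment has a summable dyadic tail of the third order. -/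
lemma tsum_eight_pow_mul_measure_lt_top {α : Type*} {mα : MeasurableSpace α} {ν : Measure α}
    {h : α → ℝ} (hm : Measurable h) (h3 : Integrable (fun x => |h x| ^ 3) ν) {a : ℝ}
    (ha : 0 < a) : ∑' l : ℕ, (8 : ℝ≥0∞) ^ l * ν {x | a * 2 ^ l < h x} ≠ ∞ := by
  classical
  have hset : ∀ l : ℕ, MeasurableSet {x | a * 2 ^ l < h x} := fun l =>
    measurableSet_lt measurable_const hm
  have h1 : ∑' l : ℕ, (8 : ℝ≥0∞) ^ l * ν {x | a * 2 ^ l < h x} =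
      ∫⁻ x, ∑' l : ℕ, {x | a * 2 ^ l < h x}.indicator (fun _ => (8 : ℝ≥0∞) ^ l) x ∂ν := by
    rw [lintegral_tsum fun l => (measurable_const.indicator (hset l)).aemeasurable]
    exact tsum_congr fun l => (lintegral_indicator_const (hset l) _).symm
  have h2 : ∀ x, ∑' l : ℕ, {x | a * 2 ^ l < h x}.indicator (fun _ => (8 : ℝ≥0∞) ^ l) x ≤
      ENNReal.ofReal (2 * (1 / a) ^ 3 * |h x| ^ 3) := by
    intro x
    refine ENNReal.tsum_le_of_sum_range_le fun n => ?_
    have h4 : ∑ l ∈ Finset.range n, {x | a * 2 ^ l < h x}.indicator (fun _ => (8 : ℝ≥0∞) ^ l) x =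
        ENNReal.ofReal (∑ l ∈ Finset.range n,
          (if (2 : ℝ) ^ l < h x / a then (8 : ℝ) ^ l else 0)) := by
      rw [ENNReal.ofReal_sum_of_nonneg fun l _ => by split_ifs <;> positivity]
      refine Finset.sum_congr rfl fun l _ => ?_
      rw [Set.indicator_apply]
      simp only [Set.mem_ofPred_eq, lt_div_iff₀ ha, mul_comm a]
      split_ifs
      · rw [ENNReal.ofReal_pow (by norm_num)]; norm_num
      · simp
    rw [h4]
    refine ENNReal.ofReal_le_ofReal ((sum_eight_pow_le _ _).trans_eq ?_)
    rw [abs_div, abs_of_pos ha]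
    ring
  rw [h1]
  refine ((lintegral_mono h2).trans_lt ?_).ne
  exact (h3.const_mul _).lintegral_lt_top

lemma integrable_sq_of_integrable_abs_pow_three {α : Type*} {mα : MeasurableSpace α}
    {ν : Measure α} [IsFiniteMeasure ν] {f : α → ℝ} (hf : Measurable f)
    (h : Integrable (fun x => |f x| ^ 3) ν) : Integrable (fun x => f x ^ 2) ν := by
  refine (h.add (integrable_const 1)).mono' (hf.pow_const 2).aestronglyMeasurable
    (ae_of_all _ fun x => ?_)
  rw [Real.norm_eq_abs, abs_of_nonneg (sq_nonneg _), Pi.add_apply, ← sq_abs]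
  have h0 := abs_nonneg (f x)
  nlinarith [sq_nonneg (|f x| - 1), mul_nonneg h0 (sq_nonneg (|f x| - 1))]

lemma exists_sq_mul_pow_le {q : ℝ} (hq0 : 0 ≤ q) (hq1 : q < 1) :
    ∃ B : ℝ, ∀ l : ℕ, (l : ℝ) ^ 2 * q ^ l ≤ B := by
  have h := tendsto_pow_const_mul_const_pow_of_lt_one 2 hq0 hq1
  obtain ⟨B, hB⟩ := h.bddAbove_range
  exact ⟨B, fun l => hB ⟨l, rfl⟩⟩

/-- Deviations of order `k` of the sum of the first `k` samples of an arm, for some `k` in a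
dyadic block, have probabilities summable against the squared block lengths, provided the
summands have finite third moments. -/
lemma IsSampling.tsum_four_pow_mul_measure_lt_top {F : ArmFamily M d 𝒳} {θ : Fin M → Param d}
    {μ : Measure Ω} [IsProbabilityMeasure μ] {𝓕 : Filtration ℕ mΩ} {X : Fin M → ℕ → Ω → 𝒳}
    {R : EBCProcess M d Ω} (hX : IsSampling F θ μ 𝓕 X)
    (hR : ∀ t, Measurable[𝓕 t] (R.arm t)) (m : Fin M) [IsProbabilityMeasure (F.law m (θ m))]
    {h : 𝒳 → ℝ} (hh : Measurable h) (h3 : Integrable (fun x => |h x| ^ 3) (F.law m (θ m)))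
    (hmean : ∫ x, h x ∂(F.law m (θ m)) ≤ 0) {κ : ℝ} (hκ : 0 < κ) (T : ℕ → ℕ) :
    ∑' l : ℕ, (4 : ℝ≥0∞) ^ l * μ {ω | ∃ k ∈ Finset.Ico (2 ^ l) (2 ^ (l + 1)),
      κ * k < ∑ s ∈ R.firstRounds m k (T l) ω, h (X m s ω)} ≠ ∞ := by
  set ν := F.law m (θ m) with hν
  have hint := integrable_of_integrable_abs_pow_three hh h3
  have hsq := integrable_sq_of_integrable_abs_pow_three hh h3
  set V := ∫ x, h x ^ 2 ∂ν with hV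
  have hV0 : 0 ≤ V := integral_nonneg fun x => sq_nonneg _
  -- For block length `n = 2 ^ l`, Chernoff's parameter is `r = C l / n`. Then `r κ n = 3 l`, and
  -- the factor `exp (-3 l)` beats `4 ^ l * 2 ^ l = 8 ^ l` because `e³ > 8`. Truncating at `α n`
  -- gives `exp (r α n) = exp (l / 2)`, and the variance term stays bounded because `√e < 2`.
  set C : ℝ := 3 / κ with hC
  have hC0 : 0 < C := by positivity
  set α : ℝ := 1 / (2 * C) with hα
  have hα0 : 0 < α := by positivity
  have hexp : Real.exp (1 / 2) / 2 < 1 := by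
    rw [div_lt_one two_pos]
    have h1 : Real.exp (1 / 2) ^ 2 = Real.exp 1 := by
      rw [← Real.exp_nat_mul]; norm_num
    have h2 := Real.exp_one_lt_d9
    nlinarith [Real.exp_pos (1 / 2)]
  obtain ⟨B, hB⟩ := exists_sq_mul_pow_le (by positivity : 0 ≤ Real.exp (1 / 2) / 2) hexp
  have hblock : ∀ l : ℕ, μ {ω | ∃ k ∈ Finset.Ico (2 ^ l) (2 ^ (l + 1)),
      κ * k < ∑ s ∈ R.firstRounds m k (T l) ω, h (X m s ω)} ≤
      2 * 2 ^ l * ν {x | α * 2 ^ l < h x} +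
        2 ^ l * ENNReal.ofReal (Real.exp (2 * C ^ 2 * V * B - 3 * l)) := by
    intro l
    set n : ℝ := 2 ^ l with hn
    have hn0 : 0 < n := by positivity
    set r : ℝ := C * l / n with hr
    have hr0 : 0 ≤ r := by positivity
    have hra : r * (α * n) = l * (1 / 2) := by
      rw [hr, hα]; field_simp
    set b : ℝ := r ^ 2 * V * Real.exp (r * (α * n)) with hb
    have hb0 : 0 ≤ b := by positivity
    have hbn : b * (2 * n) ≤ 2 * C ^ 2 * V * B := by
      have h1 : b * (2 * n) = 2 * C ^ 2 * V * ((l : ℝ) ^ 2 * (Real.exp (1 / 2) / 2) ^ l) := by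
        rw [hb, hra, Real.exp_nat_mul, hr, div_pow (Real.exp (1 / 2)), ← hn]
        field_simp
      rw [h1]
      exact mul_le_mul_of_nonneg_left (hB l) (by positivity)
    set h' : 𝒳 → ℝ := fun x => min (h x) (α * n) with hh'
    have hh'm : Measurable h' := hh.min measurable_const
    have hmgf := lintegral_exp_min_le hint hmean hsq (by positivity : 0 ≤ α * n) hr0
    -- Either one of the first `2 ^ (l + 1)` samples exceeds the truncation level, or truncation
    -- leaves the sum unchanged.
    have hsub : {ω | ∃ k ∈ Finset.Ico (2 ^ l) (2 ^ (l + 1)),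
        κ * k < ∑ s ∈ R.firstRounds m k (T l) ω, h (X m s ω)} ⊆
        {ω | ∃ s ∈ R.firstRounds m (2 ^ (l + 1)) (T l) ω, X m s ω ∈ {x | α * n < h x}} ∪
        ⋃ k ∈ Finset.Ico (2 ^ l) (2 ^ (l + 1)),
          {ω | κ * n ≤ ∑ s ∈ R.firstRounds m k (T l) ω, h' (X m s ω)} := by
      rintro ω ⟨k, hk, hlt⟩
      by_cases hex : ∃ s ∈ R.firstRounds m (2 ^ (l + 1)) (T l) ω, X m s ω ∈ {x | α * n < h x}
      · exact Or.inl hex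
      · refine Or.inr (Set.mem_biUnion hk ?_)
        push Not at hex
        have hk' := Finset.mem_Ico.1 hk
        have hkn : n ≤ k := by rw [hn]; exact_mod_cast hk'.1
        have heq : ∑ s ∈ R.firstRounds m k (T l) ω, h' (X m s ω) =
            ∑ s ∈ R.firstRounds m k (T l) ω, h (X m s ω) := by
          refine Finset.sum_congr rfl fun s hs => min_eq_left ?_
          have hs' : s ∈ R.firstRounds m (2 ^ (l + 1)) (T l) ω := by
            simp only [EBCProcess.firstRounds, Finset.mem_filter] at hs ⊢
            exact ⟨hs.1, hs.2.1, hs.2.2.trans hk'.2⟩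
          have := hex s hs'
          simpa using this
        simp only [Set.mem_ofPred_eq]
        rw [heq]
        nlinarith
    refine (measure_mono hsub).trans ((measure_union_le _ _).trans (add_le_add ?_ ?_))
    · have := hX.measure_exists_firstRounds_le hR m (measurableSet_lt measurable_const hh)
        (2 ^ (l + 1)) (T l) (S := {x | α * n < h x})
      refine this.trans_eq ?_
      push_cast
      rw [pow_succ, mul_comm ((2 : ℝ≥0∞) ^ l)]
    · refine (measure_biUnion_finset_le _ _).trans ?_
      have hk : ∀ k ∈ Finset.Ico (2 ^ l) (2 ^ (l + 1)),
          μ {ω | κ * n ≤ ∑ s ∈ R.firstRounds m k (T l) ω, h' (X m s ω)} ≤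
          ENNReal.ofReal (Real.exp (2 * C ^ 2 * V * B - 3 * l)) := by
        intro k hk
        refine (hX.measure_le_sum_firstRounds_le hR m hh'm hr0 hb0 hmgf k (T l) (κ * n)).trans
          (ENNReal.ofReal_le_ofReal (Real.exp_le_exp.2 ?_))
        have h1 : r * (κ * n) = 3 * l := by rw [hr, hC]; field_simp
        have h2 : (k : ℝ) ≤ 2 * n := by
          have := (Finset.mem_Ico.1 hk).2.le
          rw [hn, mul_comm, ← pow_succ]
          exact_mod_cast this
        have h3 := mul_le_mul_of_nonneg_left h2 hb0
        linarith
      refine (Finset.sum_le_sum hk).trans_eq ?_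
      rw [Finset.sum_const, Nat.card_Ico, pow_succ, mul_two, Nat.add_sub_cancel, nsmul_eq_mul]
      push_cast
      rfl
  set A := ENNReal.ofReal (Real.exp (2 * C ^ 2 * V * B)) with hA
  have hq : ENNReal.ofReal (Real.exp (-3)) * 8 < 1 := by
    have h1 : Real.exp 1 ^ 3 = Real.exp 3 := by rw [← Real.exp_nat_mul]; norm_num
    have h2 := Real.exp_one_gt_d9
    have h3 : 8 < Real.exp 3 := by
      rw [← h1]
      have := pow_lt_pow_left₀ (by linarith : (2 : ℝ) < Real.exp 1) (by norm_num) three_ne_zero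
      norm_num at this ⊢
      exact this
    have h4 : Real.exp (-3) * 8 < 1 := by
      rw [Real.exp_neg, inv_mul_lt_iff₀ (Real.exp_pos _), mul_one]
      exact h3
    have h5 : ENNReal.ofReal (Real.exp (-3)) * 8 = ENNReal.ofReal (Real.exp (-3) * 8) := by
      rw [ENNReal.ofReal_mul (Real.exp_nonneg _)]; norm_num
    rw [h5, ENNReal.ofReal_lt_one]
    exact h4
  set q := ENNReal.ofReal (Real.exp (-3)) * 8 with hqdef
  -- The weight `4 ^ l` times the block length `2 ^ l` is `8 ^ l`, the dyadic weight that a third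
  -- moment can bear.
  have hterm : ∀ l : ℕ, (4 : ℝ≥0∞) ^ l * μ {ω | ∃ k ∈ Finset.Ico (2 ^ l) (2 ^ (l + 1)),
      κ * k < ∑ s ∈ R.firstRounds m k (T l) ω, h (X m s ω)} ≤
      2 * (8 ^ l * ν {x | α * 2 ^ l < h x}) + A * q ^ l := by
    intro l
    have h8 : (8 : ℝ≥0∞) ^ l = 4 ^ l * 2 ^ l := by rw [← mul_pow]; norm_num
    have hexp3 : ENNReal.ofReal (Real.exp (2 * C ^ 2 * V * B - 3 * l)) =
        A * ENNReal.ofReal (Real.exp (-3)) ^ l := by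
      rw [hA, ← ENNReal.ofReal_pow (Real.exp_nonneg _), ← ENNReal.ofReal_mul (Real.exp_nonneg _),
        ← Real.exp_nat_mul, ← Real.exp_add]
      congr 2
      ring
    calc _ ≤ (4 : ℝ≥0∞) ^ l * (2 * 2 ^ l * ν {x | α * 2 ^ l < h x} +
        2 ^ l * ENNReal.ofReal (Real.exp (2 * C ^ 2 * V * B - 3 * l))) := by
          gcongr; exact hblock l
      _ = 2 * (8 ^ l * ν {x | α * 2 ^ l < h x}) + A * q ^ l := by
          rw [hexp3, hqdef, mul_pow, h8]; ring
  refine ne_top_of_le_ne_top ?_ (ENNReal.tsum_le_tsum hterm)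
  rw [ENNReal.tsum_add, ENNReal.tsum_mul_left, ENNReal.tsum_mul_left]
  refine ENNReal.add_ne_top.2 ⟨ENNReal.mul_ne_top (by norm_num)
    (tsum_eight_pow_mul_measure_lt_top hh h3 hα0), ENNReal.mul_ne_top ENNReal.ofReal_ne_top ?_⟩
  rw [ENNReal.tsum_geometric]
  exact ENNReal.inv_ne_top.2 (tsub_pos_of_lt hq).ne'

end

/-! ### Accuracy time, stopping time and vanishing perturbations -/

section

variable {M d K : ℕ} {𝒳 : Type*} [MeasurableSpace 𝒳] {Ω : Type*} {mΩ : MeasurableSpace Ω}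
  {F : ArmFamily M d 𝒳} {Θ : Set (Param d)} {θ : Fin M → Param d}

/-! ### Accuracy of the estimates -/

/-- The score in a coordinate direction, centered, and with its sign changed if `b` is false. -/
def ArmFamily.signedScore (F : ArmFamily M d 𝒳) (m : Fin M) (ρ : Param d) (i : Fin d) (b : Bool)
    (x : 𝒳) : ℝ :=
  (if b then 1 else -1) * (F.score m ρ (basisVec i) x - F.scoreMean m ρ i)

lemma ArmFamily.Regular.measurable_signedScore (hF : F.Regular Θ θ) (m : Fin M) (i : Fin d)
    (b : Bool) : Measurable (F.signedScore m (θ m) i b) :=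
  ((hF.measurable_score m (hF.instance_mem m) _).sub_const _).const_mul _

lemma ArmFamily.abs_signedScore (F : ArmFamily M d 𝒳) (m : Fin M) (ρ : Param d) (i : Fin d)
    (b : Bool) (x : 𝒳) :
    |F.signedScore m ρ i b x| = |F.score m ρ (basisVec i) x - F.scoreMean m ρ i| := by
  rw [ArmFamily.signedScore, abs_mul]
  cases b <;> simp

lemma ArmFamily.Regular.integrable_abs_signedScore_pow_three (hF : F.Regular Θ θ) (m : Fin M)
    (i : Fin d) (b : Bool) :
    Integrable (fun x => |F.signedScore m (θ m) i b x| ^ 3) (F.law m (θ m)) := by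
  have := F.isProbabilityMeasure_law m (hF.subset_dom (hF.instance_mem m))
  refine (((hF.integrable_abs_score_pow_three m (basisVec i)).add
    (integrable_const (|F.scoreMean m (θ m) i| ^ 3))).const_mul 4).mono'
    ((hF.measurable_signedScore m i b).abs.pow_const 3).aestronglyMeasurable
    (ae_of_all _ fun x => ?_)
  rw [Real.norm_eq_abs, abs_pow, abs_abs, F.abs_signedScore, Pi.add_apply]
  have h := abs_sub (F.score m (θ m) (basisVec i) x) (F.scoreMean m (θ m) i)
  have ha := abs_nonneg (F.score m (θ m) (basisVec i) x)
  have hb := abs_nonneg (F.scoreMean m (θ m) i)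
  refine (pow_le_pow_left₀ (abs_nonneg _) h 3).trans ?_
  set p := |F.score m (θ m) (basisVec i) x|
  set q := |F.scoreMean m (θ m) i|
  nlinarith [mul_nonneg (add_nonneg ha hb) (sq_nonneg (p - q))]

lemma ArmFamily.Regular.integral_signedScore (hF : F.Regular Θ θ) (m : Fin M) (i : Fin d)
    (b : Bool) : ∫ x, F.signedScore m (θ m) i b x ∂(F.law m (θ m)) = 0 := by
  have := F.isProbabilityMeasure_law m (hF.subset_dom (hF.instance_mem m))
  simp only [ArmFamily.signedScore]
  rw [integral_const_mul, integral_sub (hF.integrable_score m _) (integrable_const _)]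
  simp [ArmFamily.scoreMean]

section EBC

variable {𝒞 : (Fin M → Param d) → Fin M → Fin K} {μ : Measure Ω} [IsProbabilityMeasure μ]
  {𝓕 : Filtration ℕ mΩ} {X : Fin M → ℕ → Ω → 𝒳} {c : ℝ} {R : EBCProcess M d Ω}

/-- The time after which all estimates are accurate has a finite mean. -/
lemma IsEBC.exists_accuracy_time (hF : F.Regular Θ θ) (hX : IsSampling F θ μ 𝓕 X)
    (hR : IsEBC F Θ 𝒞 𝓕 X c R) {ξ : ℝ} (hξ : 0 < ξ) :
    ∃ H : Ω → ℝ≥0∞, ∫⁻ ω, H ω ∂μ ≠ ∞ ∧ ∀ ω, ∀ t : ℕ, H ω ≤ t →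
      M + 1 ≤ t ∧ ∀ m, dist (R.est t ω m) (θ m) < ξ := by
  obtain ⟨σ, hσ0, hσ⟩ := hF.strongly_concave
  -- Makes the error bound `2 d κ / σ²` equal to `ξ d / (d + 1) < ξ`.
  set κ : ℝ := ξ * σ ^ 2 / (2 * (d + 1)) with hκ
  have hκ0 : 0 < κ := by positivity
  have hκξ : 2 * d * κ / σ ^ 2 < ξ := by
    have h1 : 2 * d * κ / σ ^ 2 = ξ * (d / (d + 1)) := by
      rw [hκ]; field_simp
    have h2 : (d : ℝ) / (d + 1) < 1 := by
      rw [div_lt_one (by positivity)]; linarith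
    rw [h1]
    exact mul_lt_of_lt_one_right hξ h2
  -- By the horizon `M (2 ^ (l + 1))² + 1` forced exploration has drawn `2 ^ (l + 1)` samples of
  -- every arm, so the sums run over the complete first `k` samples and no longer depend on time.
  set B : Fin M × Fin d × Bool → ℕ → Set Ω := fun j l =>
    {ω | ∃ k ∈ Finset.Ico (2 ^ l) (2 ^ (l + 1)),
      κ * k < ∑ s ∈ R.firstRounds j.1 k (M * (2 ^ (l + 1)) ^ 2 + 1) ω,
        F.signedScore j.1 (θ j.1) j.2.1 j.2.2 (X j.1 s ω)} with hB
  have hsum : ∀ j, ∑' l : ℕ, (4 : ℝ≥0∞) ^ l * μ (B j l) ≠ ∞ := by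
    intro j
    have := F.isProbabilityMeasure_law j.1 (hF.subset_dom (hF.instance_mem j.1))
    exact hX.tsum_four_pow_mul_measure_lt_top hR.arm_measurable j.1
      (hF.measurable_signedScore j.1 j.2.1 j.2.2)
      (hF.integrable_abs_signedScore_pow_three j.1 j.2.1 j.2.2)
      (hF.integral_signedScore j.1 j.2.1 j.2.2).le hκ0 fun l => M * (2 ^ (l + 1)) ^ 2 + 1
  -- Each bad block contributes `4 M 4 ^ l`, its horizon minus one; the missing one comes from the
  -- constant `M + 1`. The measurable hull has the same measure.
  set D : Fin M × Fin d × Bool → ℕ → Ω → ℝ≥0∞ := fun j l =>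
    (toMeasurable μ (B j l)).indicator fun _ => (4 * M : ℝ≥0∞) * 4 ^ l with hD
  have hDm : ∀ j l, Measurable (D j l) := fun j l =>
    measurable_const.indicator (measurableSet_toMeasurable _ _)
  refine ⟨fun ω => (M + 1 : ℝ≥0∞) + ∑ j, ∑' l, D j l ω, ?_, ?_⟩
  · rw [lintegral_add_left measurable_const,
      lintegral_finsetSum _ fun j _ => Measurable.tsum fun l => hDm j l]
    refine ENNReal.add_ne_top.2 ⟨?_, ENNReal.sum_ne_top.2 fun j _ => ?_⟩
    · rw [lintegral_const, measure_univ, mul_one]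
      exact ENNReal.add_ne_top.2 ⟨ENNReal.natCast_ne_top M, ENNReal.one_ne_top⟩
    · rw [lintegral_tsum fun l => (hDm j l).aemeasurable]
      have h1 : ∀ l, ∫⁻ ω, D j l ω ∂μ = (4 * M : ℝ≥0∞) * (4 ^ l * μ (B j l)) := fun l => by
        simp only [hD]
        rw [lintegral_indicator_const (measurableSet_toMeasurable _ _), measure_toMeasurable,
          mul_assoc]
      rw [tsum_congr h1, ENNReal.tsum_mul_left]
      exact ENNReal.mul_ne_top (ENNReal.mul_ne_top (by norm_num) (ENNReal.natCast_ne_top M))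
        (hsum j)
  · intro ω t ht
    have hMt : M + 1 ≤ t := by
      have : (M + 1 : ℝ≥0∞) ≤ t := le_self_add.trans ht
      exact_mod_cast this
    refine ⟨hMt, fun m => ?_⟩
    have hpull : 1 ≤ R.pulls t ω m := hR.le_pulls ω 1 t (by simpa using hMt) m
    rw [dist_eq_norm]
    refine (hR.norm_est_sub_le hF hσ0 hσ hκ0.le hpull fun i => ?_).trans_lt hκξ
    -- An inaccurate score sum after `k` samples makes the block of `k` bad, so `t` is past its
    -- horizon `T`. But then forced exploration would have given more than `k` samples.
    by_contra hcon
    push Not at hcon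
    set k := R.pulls t ω m with hk
    set S := ∑ s ∈ (Finset.range t).filter fun s => R.arm s ω = m,
      (F.score m (θ m) (basisVec i) (X m s ω) - F.scoreMean m (θ m) i) with hS
    obtain ⟨b, hb⟩ : ∃ b : Bool, κ * k < (if b then 1 else -1) * S := by
      rcases lt_abs.1 hcon with h | h
      · exact ⟨true, by simpa using h⟩
      · exact ⟨false, by simpa using h⟩
    set l := Nat.log 2 k with hl
    have hl1 : 2 ^ l ≤ k := Nat.pow_log_le_self 2 (by omega)
    have hl2 : k < 2 ^ (l + 1) := Nat.lt_pow_succ_log_self one_lt_two k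
    set T := M * (2 ^ (l + 1)) ^ 2 + 1 with hT
    have htT : t < T := by
      by_contra hge
      have := hR.le_pulls ω (2 ^ (l + 1)) t (not_lt.1 hge) m
      omega
    have hmem : ω ∈ B (m, i, b) l := by
      refine ⟨k, Finset.mem_Ico.2 ⟨hl1, hl2⟩, ?_⟩
      simp only [ArmFamily.signedScore]
      rw [hk, R.firstRounds_eq htT.le, ← Finset.mul_sum]
      exact hb
    have hDval : D (m, i, b) l ω = (4 * M : ℝ≥0∞) * 4 ^ l := by
      simp only [hD]
      exact Set.indicator_of_mem (subset_toMeasurable _ _ hmem) _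
    have hle : (1 : ℝ≥0∞) + (4 * M : ℝ≥0∞) * 4 ^ l ≤ t := by
      refine le_trans (add_le_add le_add_self ?_) ht
      rw [← hDval]
      exact (ENNReal.le_tsum l).trans (Finset.single_le_sum
        (f := fun j => ∑' l, D j l ω) (fun _ _ => zero_le) (Finset.mem_univ (m, i, b)))
    have hTt : T ≤ t := by
      have h1 : ((1 + 4 * M * 4 ^ l : ℕ) : ℝ≥0∞) ≤ (t : ℝ≥0∞) := by push_cast; exact hle
      have h2 : 1 + 4 * M * 4 ^ l ≤ t := by exact_mod_cast h1
      have h3 : (2 ^ (l + 1)) ^ 2 = 4 * 4 ^ l := by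
        rw [← pow_mul, mul_comm, pow_mul, pow_succ]; norm_num; ring
      rw [hT, h3]
      nlinarith
    omega

/-! ### The stopping time -/

lemma EBCProcess.stopTime_le {ε δ : ℝ} {ω : Ω} {T : ℕ} (hpull : ∀ m, 1 ≤ R.pulls T ω m)
    (h : R.threshold F Θ ε δ T ω < (R.statZ F Θ 𝒞 T ω : EReal)) :
    (R.stopTime F Θ 𝒞 ε δ ω : ℝ≥0∞) ≤ T := by
  have h1 : R.stopTime F Θ 𝒞 ε δ ω ≤ (T : ℕ∞) := iInf₂_le T ⟨hpull, h⟩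
  have h2 := ENat.toENNReal_le.2 h1
  simpa using h2

lemma tendsto_log_one_div_nhdsGT_zero :
    Tendsto (fun δ : ℝ => ENNReal.ofReal (Real.log (1 / δ))) (𝓝[>] 0) (𝓝 ∞) := by
  refine ENNReal.tendsto_ofReal_nhds_top.2 ?_
  have h : (fun δ : ℝ => Real.log (1 / δ)) = fun δ => -Real.log δ := by
    ext δ; rw [one_div, Real.log_inv]
  rw [h]
  exact tendsto_neg_atBot_atTop.comp Real.tendsto_log_nhdsGT_zero

omit [IsProbabilityMeasure μ] in
-- A finite additive constant independent of `δ` vanishes on division by `log (1 / δ) → ∞`.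
lemma EBCProcess.slope_le {ε a : ℝ} {C : ℝ≥0∞} (ha : 0 ≤ a) (hC : C ≠ ∞)
    (h : ∀ δ : ℝ, 0 < δ → δ < 1 → ∫⁻ ω, (R.stopTime F Θ 𝒞 ε δ ω : ℝ≥0∞) ∂μ ≤
      ENNReal.ofReal (a * Real.log (1 / δ)) + C) :
    R.slope F Θ 𝒞 μ ε ≤ ENNReal.ofReal a := by
  have hlim : Tendsto (fun δ : ℝ => ENNReal.ofReal a + C / ENNReal.ofReal (Real.log (1 / δ)))
      (𝓝[>] 0) (𝓝 (ENNReal.ofReal a + C / ∞)) :=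
    tendsto_const_nhds.add (ENNReal.Tendsto.const_div tendsto_log_one_div_nhdsGT_zero
      (Or.inr hC))
  rw [ENNReal.div_top, add_zero] at hlim
  rw [← hlim.limsup_eq]
  refine limsup_le_limsup ?_
  filter_upwards [Ioo_mem_nhdsGT (zero_lt_one' ℝ)] with δ hδ
  have hlog : 0 < Real.log (1 / δ) := Real.log_pos (by
    rw [lt_div_iff₀ hδ.1, one_mul]; exact hδ.2)
  have h0 : ENNReal.ofReal (Real.log (1 / δ)) ≠ 0 := (ENNReal.ofReal_pos.2 hlog).ne'
  calc (∫⁻ ω, (R.stopTime F Θ 𝒞 ε δ ω : ℝ≥0∞) ∂μ) / ENNReal.ofReal (Real.log (1 / δ))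
      ≤ (ENNReal.ofReal (a * Real.log (1 / δ)) + C) / ENNReal.ofReal (Real.log (1 / δ)) := by
        gcongr; exact h δ hδ.1 hδ.2
    _ = ENNReal.ofReal a + C / ENNReal.ofReal (Real.log (1 / δ)) := by
        rw [ENNReal.add_div, ENNReal.ofReal_mul ha,
          ENNReal.mul_div_cancel_right h0 ENNReal.ofReal_ne_top]

/-- If there is no alternative, then EBC stops as soon as every arm has been sampled. -/
lemma IsEBC.slope_eq_zero (hF : F.Regular Θ θ) (hR : IsEBC F Θ 𝒞 𝓕 X c R)
    (hemp : ¬ (altSet Θ 𝒞 θ).Nonempty) {ε : ℝ} (hε : 0 < ε) (hη : F.eta Θ ε ≠ ∞) :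
    R.slope F Θ 𝒞 μ ε = 0 := by
  have hequiv : ∀ lam : Fin M → Param d, (∀ m, lam m ∈ Θ) → ClusterEquiv (𝒞 θ) (𝒞 lam) := by
    intro lam hlam
    by_contra hcon
    exact hemp ⟨lam, hlam, hcon⟩
  obtain ⟨C, hC0, hC⟩ := hF.exists_threshold_le (Ω := Ω) hε hη
  have h := EBCProcess.slope_le (R := R) (F := F) (Θ := Θ) (𝒞 := 𝒞) (μ := μ) (ε := ε)
    (C := ((M + 1 : ℕ) : ℝ≥0∞)) le_rfl (ENNReal.natCast_ne_top _) fun δ _ _ => by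
      rw [zero_mul, ENNReal.ofReal_zero, zero_add]
      calc ∫⁻ ω, (R.stopTime F Θ 𝒞 ε δ ω : ℝ≥0∞) ∂μ ≤ ∫⁻ _ω, ((M + 1 : ℕ) : ℝ≥0∞) ∂μ := by
            refine lintegral_mono fun ω => ?_
            have hpull : ∀ m, 1 ≤ R.pulls (M + 1) ω m := hR.le_pulls ω 1 (M + 1) (by simp)
            refine EBCProcess.stopTime_le hpull
              ((hC R δ (M + 1) ω (hR.est_mem _ ω) hpull).trans_lt ?_)
            -- An infimum over no alternatives is `∞`, so the statistic exceeds the finite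
            -- threshold.
            have hpsi : F.psi Θ 𝒞 (fun m => (R.pulls (M + 1) ω m : ℝ) / (M + 1 : ℕ))
                (R.est (M + 1) ω) = ∞ := by
              refine iInf₂_eq_top.2 fun lam hlam => absurd ?_ hlam.2
              exact (hequiv _ (hR.est_mem _ ω)).symm.trans (hequiv _ hlam.1)
            have hZ : R.statZ F Θ 𝒞 (M + 1) ω = ∞ := by
              unfold EBCProcess.statZ
              rw [hpsi, ENNReal.mul_top]
              exact_mod_cast Nat.succ_ne_zero M
            rw [hZ, EReal.coe_ennreal_top]
            exact EReal.coe_lt_top _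
        _ = ((M + 1 : ℕ) : ℝ≥0∞) := by simp
  simpa using h

/-- The main estimate, with a margin `κ`. -/
lemma IsEBC.slope_le_of_margin (hF : F.Regular Θ θ) (hX : IsSampling F θ μ 𝓕 X) (hc : 0 < c)
    (hR : IsEBC F Θ 𝒞 𝓕 X c R) {w : Fin M → ℝ} (hw : w ∈ stdSimplex ℝ (Fin M))
    (hne : (altSet Θ 𝒞 θ).Nonempty) {ε : ℝ} (hε : 0 < ε) (hη : F.eta Θ ε ≠ ∞) {κ : ℝ}
    (hκ : 0 < κ) (hΔ : 0 < (F.psi Θ 𝒞 w θ).toReal - (F.eta Θ ε).toReal - 4 * κ) :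
    R.slope F Θ 𝒞 μ ε ≤
      ENNReal.ofReal ((F.psi Θ 𝒞 w θ).toReal - (F.eta Θ ε).toReal - 4 * κ)⁻¹ := by
  set p := (F.psi Θ 𝒞 w θ).toReal with hp
  set e := (F.eta Θ ε).toReal with he
  set Δ := p - e - 4 * κ with hΔdef
  have he0 : 0 ≤ e := ENNReal.toReal_nonneg
  have hp0 : 0 < p := by linarith
  have hpos : 0 < F.psi Θ 𝒞 w θ := (ENNReal.toReal_pos_iff.1 hp0).1
  obtain ⟨B, hB0, hB⟩ := hF.exists_klReal_le
  obtain ⟨C₀, hC₀, hthr⟩ := hF.exists_threshold_le (Ω := Ω) hε hη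
  obtain ⟨ξ₁, hξ₁, hclus⟩ := hF.exists_clusterEquiv (𝒞 := 𝒞) hw hpos
  obtain ⟨ξ₂, hξ₂, hclose⟩ := hF.exists_klReal_close hκ
  obtain ⟨H, hHint, hH⟩ := hR.exists_accuracy_time hF hX (lt_min hξ₁ hξ₂)
  set C₁ := (1 / c + c * (M * B ^ 2)) + M * M * B + C₀ with hC₁
  have hC₁0 : 0 ≤ C₁ := by positivity
  -- From `C₁ √T ≤ κ T + C₁² / (4 κ)`: all terms of order `√T` are absorbed at the price of one `κ`.
  -- The other three come from `le_statZ`.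
  set C₂ := C₁ ^ 2 / (4 * κ) + C₁ with hC₂
  have hC₂0 : 0 ≤ C₂ := by positivity
  have hsqrt : ∀ T : ℕ, C₁ * (√(T : ℝ) + 1) ≤ κ * T + C₂ := by
    intro T
    have hs : √(T : ℝ) ^ 2 = T := Real.sq_sqrt (Nat.cast_nonneg T)
    set y := √(T : ℝ)
    have h1 : C₁ * y ≤ κ * T + C₁ ^ 2 / (4 * κ) := by
      have h2 : κ * T + C₁ ^ 2 / (4 * κ) - C₁ * y =
          (2 * κ * y - C₁) ^ 2 / (4 * κ) := by
        rw [← hs]; field_simp; ring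
      have h3 : 0 ≤ (2 * κ * y - C₁) ^ 2 / (4 * κ) := by positivity
      linarith
    rw [hC₂]
    linarith
  have hτ_le : ∀ (δ : ℝ) (ω : Ω) (T₀ T : ℕ), H ω ≤ T₀ → T₀ ≤ T →
      Real.log (1 / δ) + T₀ * p + C₂ < T * Δ →
      (R.stopTime F Θ 𝒞 ε δ ω : ℝ≥0∞) ≤ T := by
    intro δ ω T₀ T hT₀ hT hlt
    have hgood : ∀ t, T₀ ≤ t → M + 1 ≤ t ∧ ∀ m, dist (R.est t ω m) (θ m) < min ξ₁ ξ₂ :=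
      fun t ht => hH ω t (hT₀.trans (by exact_mod_cast ht))
    have hpull : ∀ m, 1 ≤ R.pulls T ω m :=
      hR.le_pulls ω 1 T (by simpa using (hgood T hT).1)
    refine EBCProcess.stopTime_le hpull ((hthr R δ T ω (hR.est_mem T ω) hpull).trans_lt ?_)
    have hZ := hR.le_statZ hF hc hw hne hB (κ := κ) (ω := ω) (T₀ := T₀) (T := T)
      (by have := (hgood T₀ le_rfl).1; omega) hT
      (fun t ht => (altSet_congr (hclus _ (hR.est_mem t ω)
        fun m => ((hgood t ht).2 m).trans_le (min_le_left _ _))).symm)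
      (fun t ht m lam hlam => (hclose m _ (hR.est_mem t ω m) _ (hF.instance_mem m) lam hlam lam
        hlam (((hgood t ht).2 m).trans_le (min_le_right _ _)) (by simpa using hξ₂)).le)
    have hZ' : ((ENNReal.ofReal ((T - T₀) * (p - 2 * κ) - T * κ
      - (1 / c + c * (M * B ^ 2)) * √T - M * (M * (√T + 1)) * B) : ℝ≥0∞) : EReal) ≤
        (R.statZ F Θ 𝒞 T ω : EReal) := EReal.coe_ennreal_le_coe_ennreal_iff.2 hZ
    refine lt_of_lt_of_le ?_ hZ'
    rw [EReal.coe_ennreal_ofReal, EReal.coe_lt_coe_iff]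
    refine lt_max_of_lt_left ?_
    have h1 := hsqrt T
    have h2 : (0 : ℝ) ≤ T₀ * κ := by positivity
    have h3 : 0 ≤ 1 / c + c * (M * B ^ 2) := by positivity
    have hs0 := Real.sqrt_nonneg (T : ℝ)
    rw [hC₁] at h1
    rw [hΔdef] at hlt
    nlinarith
  set E := ∫⁻ ω, H ω ∂μ with hE
  refine EBCProcess.slope_le (C := ENNReal.ofReal ((p / Δ + 1)) * (E + 1) +
    ENNReal.ofReal (C₂ / Δ + 1)) (by positivity) ?_ ?_
  · refine ENNReal.add_ne_top.2 ⟨ENNReal.mul_ne_top ENNReal.ofReal_ne_top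
      (ENNReal.add_ne_top.2 ⟨hHint, ENNReal.one_ne_top⟩), ENNReal.ofReal_ne_top⟩
  intro δ hδ0 hδ1
  have hlog : 0 < Real.log (1 / δ) := Real.log_pos (by
    rw [lt_div_iff₀ hδ0, one_mul]; exact hδ1)
  have hpt : ∀ ω, (R.stopTime F Θ 𝒞 ε δ ω : ℝ≥0∞) ≤ ENNReal.ofReal (Δ⁻¹ * Real.log (1 / δ)) +
      ENNReal.ofReal (C₂ / Δ + 1) + ENNReal.ofReal ((p / Δ + 1)) * (H ω + 1) := by
    intro ω
    rcases eq_or_ne (H ω) ∞ with htop | htop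
    · rw [htop, top_add, ENNReal.mul_top (ENNReal.ofReal_pos.2 (by positivity)).ne', add_top]
      exact le_top
    -- `y` solves the linear stopping condition; adding `T₀` to its rounded-up value also puts the
    -- time past the accuracy time.
    · set T₀ := ⌈(H ω).toReal⌉₊ with hT₀
      have hHT₀ : H ω ≤ T₀ := by
        rw [← ENNReal.ofReal_toReal htop, ← ENNReal.ofReal_natCast]
        exact ENNReal.ofReal_le_ofReal (Nat.le_ceil _)
      have hT₀H : (T₀ : ℝ) ≤ (H ω).toReal + 1 := (Nat.ceil_lt_add_one ENNReal.toReal_nonneg).le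
      set y := (Real.log (1 / δ) + T₀ * p + C₂) / Δ with hy
      have hy0 : 0 ≤ y := by positivity
      have hle := hτ_le δ ω T₀ (T₀ + (⌊y⌋₊ + 1)) hHT₀ (by omega) (by
        rw [← div_lt_iff₀ hΔ, ← hy]
        have := Nat.lt_floor_add_one y
        push_cast
        have : (0 : ℝ) ≤ T₀ := Nat.cast_nonneg _
        linarith)
      refine hle.trans ?_
      have hH1 : H ω + 1 = ENNReal.ofReal ((H ω).toReal + 1) := by
        rw [ENNReal.ofReal_add ENNReal.toReal_nonneg zero_le_one, ENNReal.ofReal_toReal htop,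
          ENNReal.ofReal_one]
      have hH0 : 0 ≤ (H ω).toReal := ENNReal.toReal_nonneg
      rw [hH1, ← ENNReal.ofReal_mul (by positivity), ← ENNReal.ofReal_add (by positivity)
        (by positivity), ← ENNReal.ofReal_add (by positivity) (by positivity),
        ← ENNReal.ofReal_natCast]
      refine ENNReal.ofReal_le_ofReal ?_
      push_cast
      have h1 := Nat.floor_le hy0
      have h2 : y = Δ⁻¹ * Real.log (1 / δ) + T₀ * (p / Δ) + C₂ / Δ := by
        rw [hy]; field_simp
      have h3 : (T₀ : ℝ) * (p / Δ) ≤ ((H ω).toReal + 1) * (p / Δ) :=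
        mul_le_mul_of_nonneg_right hT₀H (by positivity)
      linarith
  calc ∫⁻ ω, (R.stopTime F Θ 𝒞 ε δ ω : ℝ≥0∞) ∂μ
      ≤ ∫⁻ ω, (ENNReal.ofReal (Δ⁻¹ * Real.log (1 / δ)) +
        ENNReal.ofReal (C₂ / Δ + 1) + ENNReal.ofReal ((p / Δ + 1)) * (H ω + 1)) ∂μ :=
        lintegral_mono hpt
    _ = ENNReal.ofReal (Δ⁻¹ * Real.log (1 / δ)) + (ENNReal.ofReal ((p / Δ + 1)) * (E + 1) +
        ENNReal.ofReal (C₂ / Δ + 1)) := by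
        rw [lintegral_add_left measurable_const,
          lintegral_const_mul' _ _ ENNReal.ofReal_ne_top, lintegral_add_right H measurable_const]
        simp only [lintegral_const, measure_univ, mul_one]
        rw [← hE]
        ring

/-- The sample complexity of EBC for a fixed perturbation size. -/
lemma IsEBC.slope_le_inv (hF : F.Regular Θ θ) (hX : IsSampling F θ μ 𝓕 X) (hc : 0 < c)
    (hR : IsEBC F Θ 𝒞 𝓕 X c R) {w : Fin M → ℝ} (hw : w ∈ stdSimplex ℝ (Fin M)) {ε : ℝ}
    (hε : 0 < ε) (hlt : F.eta Θ ε < F.psi Θ 𝒞 w θ) :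
    R.slope F Θ 𝒞 μ ε ≤ (F.psi Θ 𝒞 w θ - F.eta Θ ε)⁻¹ := by
  have hη : F.eta Θ ε ≠ ∞ := hlt.ne_top
  by_cases hne : (altSet Θ 𝒞 θ).Nonempty
  · have hψ := hF.psi_ne_top (𝒞 := 𝒞) hw.1 hF.instance_mem hne
    set p := (F.psi Θ 𝒞 w θ).toReal with hp
    set e := (F.eta Θ ε).toReal with he
    have hpe : e < p := (ENNReal.toReal_lt_toReal hη hψ).2 hlt
    have heq : (F.psi Θ 𝒞 w θ - F.eta Θ ε)⁻¹ = ENNReal.ofReal (p - e)⁻¹ := by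
      rw [ENNReal.ofReal_inv_of_pos (sub_pos.2 hpe), hp, he,
        ENNReal.ofReal_sub _ ENNReal.toReal_nonneg, ENNReal.ofReal_toReal hψ,
        ENNReal.ofReal_toReal hη]
    rw [heq]
    -- The slope does not involve `κ`, so the margin can be sent to zero.
    have hlim : Tendsto (fun κ : ℝ => ENNReal.ofReal (p - e - 4 * κ)⁻¹) (𝓝[>] 0)
        (𝓝 (ENNReal.ofReal (p - e - 4 * 0)⁻¹)) := by
      refine ENNReal.tendsto_ofReal (Tendsto.inv₀ ?_ (by simpa using (sub_pos.2 hpe).ne'))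
      exact (Continuous.tendsto (by fun_prop) 0).mono_left nhdsWithin_le_nhds
    rw [mul_zero, sub_zero] at hlim
    refine ge_of_tendsto hlim ?_
    filter_upwards [Ioo_mem_nhdsGT (by linarith : 0 < (p - e) / 4)] with κ hκ
    exact hR.slope_le_of_margin hF hX hc hw hne hε hη hκ.1 (by rw [← hp, ← he]; linarith [hκ.2])
  · rw [hR.slope_eq_zero hF hne hε hη]
    exact zero_le

end EBC

/-! ### Small perturbations -/

/-- The divergence vanishes at `(ρ, ρ)`, so continuity gives the bound for all `(ε, ρ')` near `(0,
ρ)`; compactness of `Θ` makes the range of `ε` uniform. -/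
lemma ArmFamily.Regular.eventually_kl_add_le (hF : F.Regular Θ θ) {V : Set (Param d)}
    (hV : IsOpen V) (hΘV : Θ ⊆ V) (m : Fin M)
    (hcont : ContinuousOn (fun q : Param d × Param d => F.kl m q.1 q.2) (Θ ×ˢ V)) (u : Param d)
    {r : ℝ≥0∞} (hr : 0 < r) :
    ∀ᶠ ε : ℝ in 𝓝 0, ∀ ρ ∈ Θ, ρ + ε • u ∈ V ∧ F.kl m ρ (ρ + ε • u) ≤ r := by
  have h : ∀ ρ ∈ Θ, ∀ᶠ z : ℝ × Param d in 𝓝 ((0 : ℝ), ρ),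
      z.2 ∈ Θ → z.2 + z.1 • u ∈ V ∧ F.kl m z.2 (z.2 + z.1 • u) ≤ r := by
    intro ρ hρ
    have hmap : Tendsto (fun z : ℝ × Param d => (z.2, z.2 + z.1 • u)) (𝓝 ((0 : ℝ), ρ))
        (𝓝 (ρ, ρ)) := by
      have hc : Continuous fun z : ℝ × Param d => (z.2, z.2 + z.1 • u) := by fun_prop
      simpa using hc.tendsto ((0 : ℝ), ρ)
    have hkl := hcont (ρ, ρ) ⟨hρ, hΘV hρ⟩
    have hlt : ∀ᶠ q in 𝓝[Θ ×ˢ V] (ρ, ρ), F.kl m q.1 q.2 < r := by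
      refine hkl.eventually_lt_const ?_
      exact (F.kl_self m (hF.subset_dom hρ)).trans_lt hr
    have hV' : ∀ᶠ q : Param d × Param d in 𝓝 (ρ, ρ), q.2 ∈ V :=
      (continuous_snd.tendsto (ρ, ρ)).eventually (hV.mem_nhds (hΘV hρ))
    filter_upwards [hmap.eventually (eventually_nhdsWithin_iff.1 hlt), hmap.eventually hV']
      with z hz hz' hzΘ
    exact ⟨hz', (hz ⟨hzΘ, hz'⟩).le⟩
  filter_upwards [hF.isCompact.eventually_forall_of_forall_eventually
    (P := fun (ε : ℝ) (ρ : Param d) => ρ ∈ Θ → ρ + ε • u ∈ V ∧ F.kl m ρ (ρ + ε • u) ≤ r) h]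
    with ε hε ρ hρ
  exact hε ρ hρ hρ

lemma ArmFamily.Regular.eventually_eta_le (hF : F.Regular Θ θ) {V : Set (Param d)}
    (hV : IsOpen V) (hΘV : Θ ⊆ V)
    (hcont : ∀ m, ContinuousOn (fun q : Param d × Param d => F.kl m q.1 q.2) (Θ ×ˢ V))
    {r : ℝ≥0∞} (hr : 0 < r) : ∀ᶠ ε : ℝ in 𝓝 0, F.eta Θ ε ≤ r := by
  have hr' : 0 < r / (d + 1) :=
    ENNReal.div_pos hr.ne' (ENNReal.add_ne_top.2 ⟨ENNReal.natCast_ne_top d, ENNReal.one_ne_top⟩)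
  have h1 : ∀ m i, ∀ᶠ ε : ℝ in 𝓝 0, ∀ ρ ∈ Θ,
      F.kl m ρ (ρ - ε • basisVec i) ≤ r / (d + 1) ∧ F.kl m ρ (ρ + ε • basisVec i) ≤ r / (d + 1) := by
    intro m i
    filter_upwards [hF.eventually_kl_add_le hV hΘV m (hcont m) (basisVec i) hr',
      hF.eventually_kl_add_le hV hΘV m (hcont m) (-basisVec i) hr'] with ε h₁ h₂ ρ hρ
    refine ⟨?_, (h₁ ρ hρ).2⟩
    have := (h₂ ρ hρ).2
    rwa [smul_neg, ← sub_eq_add_neg] at this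
  filter_upwards [eventually_all.2 fun m => eventually_all.2 fun i => h1 m i] with ε hε
  refine iSup₂_le fun ρ hρ => iSup_le fun m => ?_
  calc F.klPerturb ε m ρ ≤ ∑ _i : Fin d, r / (d + 1) :=
        Finset.sum_le_sum fun i _ => max_le (hε m i ρ hρ).1 (hε m i ρ hρ).2
    _ = d * (r / (d + 1)) := by simp
    _ ≤ (d + 1) * (r / (d + 1)) := by gcongr; exact le_self_add
    _ ≤ r := ENNReal.mul_div_le

lemma ArmFamily.Regular.tendsto_eta (hF : F.Regular Θ θ) {V : Set (Param d)}
    (hV : IsOpen V) (hΘV : Θ ⊆ V)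
    (hcont : ∀ m, ContinuousOn (fun q : Param d × Param d => F.kl m q.1 q.2) (Θ ×ˢ V)) :
    Tendsto (fun ε : ℝ => F.eta Θ ε) (𝓝[>] 0) (𝓝 0) :=
  ENNReal.tendsto_nhds_zero.2 fun _ hr =>
    (hF.eventually_eta_le hV hΘV hcont hr).filter_mono nhdsWithin_le_nhds

/-- Only the membership in `V` is used from the preceding estimate; the level one is arbitrary. -/
lemma ArmFamily.Regular.eventually_admissible (hF : F.Regular Θ θ) {V : Set (Param d)}
    (hV : IsOpen V) (hΘV : Θ ⊆ V) (hVdom : V ⊆ F.dom)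
    (m : Fin M) (hcont : ContinuousOn (fun q : Param d × Param d => F.kl m q.1 q.2) (Θ ×ˢ V)) :
    ∀ᶠ ε : ℝ in 𝓝[>] 0, F.Admissible Θ ε := by
  have h : ∀ i : Fin d, ∀ᶠ ε : ℝ in 𝓝 0, ∀ ρ ∈ Θ,
      ρ - ε • basisVec i ∈ F.dom ∧ ρ + ε • basisVec i ∈ F.dom := by
    intro i
    filter_upwards [hF.eventually_kl_add_le hV hΘV m hcont (basisVec i) zero_lt_one,
      hF.eventually_kl_add_le hV hΘV m hcont (-basisVec i) zero_lt_one] with ε h₁ h₂ ρ hρ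
    refine ⟨?_, hVdom (h₁ ρ hρ).1⟩
    have := (h₂ ρ hρ).1
    rw [smul_neg, ← sub_eq_add_neg] at this
    exact hVdom this
  filter_upwards [nhdsWithin_le_nhds (eventually_all.2 h), self_mem_nhdsWithin] with ε hε hε0
  exact ⟨hε0, fun ρ hρ i => hε i ρ hρ⟩

lemma ArmFamily.charTime_eq {𝒞 : (Fin M → Param d) → Fin M → Fin K} {w : Fin M → ℝ}
    (hw : w ∈ F.optimalWeights Θ 𝒞 θ) : F.charTime Θ 𝒞 θ = (F.psi Θ 𝒞 w θ)⁻¹ := by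
  rw [ArmFamily.charTime, le_antisymm (iSup₂_le hw.2) (le_iSup₂_of_le w hw.1 le_rfl)]

end

end BanditClustering

end

theorem theorem3 {M K d : ℕ} {𝒳 : Type*} [MeasurableSpace 𝒳]
    {Ω : Type*} {mΩ : MeasurableSpace Ω}
    (F : BanditClustering.ArmFamily M d 𝒳) (Θ : Set (BanditClustering.Param d))
    (θ : Fin M → BanditClustering.Param d) (hF : F.Regular Θ θ)
    (𝒞 : (Fin M → BanditClustering.Param d) → Fin M → Fin K) (h𝒞 : BanditClustering.IsSlink Θ 𝒞)
    (μ : Measure Ω) [IsProbabilityMeasure μ] (𝓕 : Filtration ℕ mΩ) (X : Fin M → ℕ → Ω → 𝒳)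
    (hX : BanditClustering.IsSampling F θ μ 𝓕 X)
    (c : ℝ) (hc : 0 < c) (R : BanditClustering.EBCProcess M d Ω)
    (hR : BanditClustering.IsEBC F Θ 𝒞 𝓕 X c R)
    (wstar : Fin M → ℝ) (hw : wstar ∈ F.optimalWeights Θ 𝒞 θ) :
    (∀ ε : ℝ, F.Admissible Θ ε → F.eta Θ ε < F.psi Θ 𝒞 wstar θ →
      R.slope F Θ 𝒞 μ ε ≤ (F.psi Θ 𝒞 wstar θ - F.eta Θ ε)⁻¹) ∧
    ((∃ V : Set (BanditClustering.Param d), IsOpen V ∧ Θ ⊆ V ∧ V ⊆ F.dom ∧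
        ∀ m, ContinuousOn
          (fun q : BanditClustering.Param d × BanditClustering.Param d => F.kl m q.1 q.2)
          (Θ ×ˢ V)) →
      Tendsto (fun ε : ℝ => (F.psi Θ 𝒞 wstar θ - F.eta Θ ε)⁻¹) (𝓝[>] 0)
          (𝓝 (F.charTime Θ 𝒞 θ)) ∧
        limsup (fun ε : ℝ => R.slope F Θ 𝒞 μ ε) (𝓝[>] 0) ≤ F.charTime Θ 𝒞 θ) := by
  have hbound : ∀ ε : ℝ, F.Admissible Θ ε → F.eta Θ ε < F.psi Θ 𝒞 wstar θ →
      R.slope F Θ 𝒞 μ ε ≤ (F.psi Θ 𝒞 wstar θ - F.eta Θ ε)⁻¹ := fun ε hε hlt =>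
    hR.slope_le_inv hF hX hc hw.1 hε.1 hlt
  refine ⟨hbound, ?_⟩
  rintro ⟨V, hV, hΘV, hVdom, hcont⟩
  rw [BanditClustering.ArmFamily.charTime_eq hw]
  have hη := hF.tendsto_eta hV hΘV hcont
  have hlim : Tendsto (fun ε : ℝ => (F.psi Θ 𝒞 wstar θ - F.eta Θ ε)⁻¹) (𝓝[>] 0)
      (𝓝 (F.psi Θ 𝒞 wstar θ)⁻¹) := by
    have h := (ENNReal.Tendsto.sub (tendsto_const_nhds (x := F.psi Θ 𝒞 wstar θ)) hη
      (Or.inr ENNReal.zero_ne_top)).inv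
    rwa [tsub_zero] at h
  refine ⟨hlim, ?_⟩
  rcases eq_zero_or_pos (F.psi Θ 𝒞 wstar θ) with h0 | hpos
  · rw [h0, ENNReal.inv_zero]
    exact le_top
  -- Weights summing to one force at least one arm, whose continuity hypothesis yields admissibility
  -- of small `ε`.
  · obtain ⟨m⟩ : Nonempty (Fin M) := by
      by_contra hM
      rw [not_nonempty_iff] at hM
      simpa using hw.1.2
    rw [← hlim.limsup_eq]
    refine limsup_le_limsup ?_
    filter_upwards [hF.eventually_admissible hV hΘV hVdom m (hcont m), hη.eventually_lt_const hpos]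
      with ε hε hlt
    exact hbound ε hε hlt
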